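/- **Theorem 1.7.** Let $n\ge 2$, let $\alpha_M>0$ and $\tilde\kappa<0$ be real constants, let $I=(0,\infty)$, and let $S$ be a compact smooth Riemannian manifold of dimension $m$ with Laplace–Beltrami operator $\Delta$. Put $a_0=2n(n-1)\alpha_M^{-1}$. Let $\mu$ be an eigenvalue of $-\Delta$ with $$\bar\mu=\tfrac4{n^2}a_0\mu-\tfrac{(m-1)^2}4\le 0,$$ and let $E_\mu$ be its eigenspace. For a real number $\bar\Lambda$ and functions $\psi=\psi(r,y)$ on $I\times S$ let (with $\bar V=0$) $$H\psi=r^{-1}\partial_r(r\,\partial_r\psi)+r^{-2}\bigl(-\tfrac4{n^2}a_0\Delta\psi-\tfrac{(m-1)^2}4\psi\bigr)+\tfrac{16}{n^2}\bar\Lambda r^2\psi-\tfrac{16}{n^2}\tilde\kappa\, r^{\frac{2(n-2)}n}\psi .$$ Let $L^2(I,1)$ be the Hilbert space of the measurable $u:I\to\mathbb C$ with $\int_I r|u|^2<\infty$, and let $\mathcal H_2(\bar\mu)$ be the completion of $C^\infty_c(I)$ with respect to the scalar product $$\langle u,v\rangle_2=\int_I r\,u'\bar v'-\bar\mu\int_I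 r^{-1}u\bar v+\int_I r^3u\bar v ,$$ regarded as a space of functions with weak derivatives. For $\bar\Lambda<0$ consider the eigenvalue problem $$Bu-\tfrac{16}{n^2}\bar\Lambda r^2u=-\tfrac{16}{n^2}\tilde\kappa\, r^{\frac{2(n-2)}n}u,\qquad u\in\mathcal H_2(\bar\mu),\tag{1.35.2}$$ where $Bu=-r^{-1}(ru')'-r^{-2}\bar\mu u$. The equation is understood weakly: $\int_I r u'\bar v'-\bar\mu\int_I r^{-1}u\bar v-\tfrac{16}{n^2}\bar\Lambda\int_I r^3u\bar v=-\tfrac{16}{n^2}\tilde\kappa\int_I r^{\frac{3n-4}n}u\bar v$ for all $v\in\mathcal H_2(\bar\mu)$. Then the numbers $\bar\Lambda<0$ for which (1.35.2) has a solution $u\ne0$ form a sequence $(\bar\Lambda_i)_{i\in\mathbb N}$ with $$\bar\Lambda_i<\bar\Lambda_{i+1}<0\quad\text{for all } i,\qquad \lim_i\bar\Lambda_i=0,$$ and each of them has multiplicity one: its eigenspace is spanned by a single $u_i\in\mathcal H_2(\bar\mu)$, which is smooth in $(0,\infty)$. For every $\eta\in E_\mu$ and every $i$ the wave function $\psi_i=u_i\eta$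 satisfies $H\psi_i=0$ in $I\times S$, where $\bar\Lambda=\bar\Lambda_i$ in $H$. Finally, let $$\tilde u_i(r)=u_i\bigl(\lambda_i^{\frac n{4(n-1)}}r\bigr),\qquad \lambda_i=(-\bar\Lambda_i)^{-\frac{n-1}n}.$$ Then the $(\tilde u_i)$ form a basis of $\mathcal H_2(\bar\mu)$, i.e., there are biorthogonal continuous linear functionals $c_i$ on $\mathcal H_2(\bar\mu)$ such that every $v\in\mathcal H_2(\bar\mu)$ is the unconditionally convergent sum $v=\sum_i c_i(v)\tilde u_i$. They also belong to $L^2(I,1)$, where they form a basis in the sense of a complete minimal system: their linear span is dense in $L^2(I,1)$, and they have a biorthogonal sequence of continuous linear functionals on $L^2(I,1)$. -/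

import Mathlib

open MeasureTheory Set Filter Topology Manifold Bundle
open scoped ContDiff Distributions

namespace QuantumFriedman

noncomputable section

/-! ### The Laplace–Beltrami operator -/

section Laplace

variable {m : ℕ} {S : Type*} [TopologicalSpace S]
  [ChartedSpace (EuclideanSpace ℝ (Fin m)) S] [IsManifold (𝓡 m) ∞ S]

/-- Smooth Riemannian metrics on the smooth `m`-dimensional manifold `S`. -/
abbrev RiemMetric (m : ℕ) (S : Type*) [TopologicalSpace S]
    [ChartedSpace (EuclideanSpace ℝ (Fin m)) S] [IsManifold (𝓡 m) ∞ S] :=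
  ContMDiffRiemannianMetric (𝓡 m) ∞ (EuclideanSpace ℝ (Fin m))
    (fun y : S => TangentSpace (𝓡 m) y)

/-- The `A`-th coordinate vector field of the chart at `x`, at the point with coordinates `z`. -/
def coordVec (x : S) (z : EuclideanSpace ℝ (Fin m)) (A : Fin m) :
    TangentSpace (𝓡 m) ((extChartAt (𝓡 m) x).symm z) :=
  mfderiv 𝓘(ℝ, EuclideanSpace ℝ (Fin m)) (𝓡 m) (extChartAt (𝓡 m) x).symm z
    (EuclideanSpace.single A (1 : ℝ) : EuclideanSpace ℝ (Fin m))

/-- The matrix `(G_AB)` of the metric in the chart at `x`, at the point with coordinates `z`. -/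
def metricMatrix (G : RiemMetric m S) (x : S) (z : EuclideanSpace ℝ (Fin m)) :
    Matrix (Fin m) (Fin m) ℝ :=
  Matrix.of fun A B =>
    G.inner ((extChartAt (𝓡 m) x).symm z) (coordVec x z A) (coordVec x z B)

/-- The partial derivative in the direction of the `A`-th coordinate. -/
def partialDeriv (A : Fin m) (f : EuclideanSpace ℝ (Fin m) → ℂ)
    (z : EuclideanSpace ℝ (Fin m)) : ℂ :=
  fderiv ℝ f z (EuclideanSpace.single A (1 : ℝ))

/-- The Laplace–Beltrami operator, `Δη = |G|^(-1/2) ∂_A (|G|^(1/2) G^AB ∂_B η)`, computed at each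
point `x` in the preferred chart at `x`. -/
def laplaceBeltrami (G : RiemMetric m S) (η : S → ℂ) (x : S) : ℂ :=
  ((Real.sqrt (metricMatrix G x (extChartAt (𝓡 m) x x)).det)⁻¹ : ℝ) *
    ∑ A, partialDeriv A
      (fun z => (Real.sqrt (metricMatrix G x z).det : ℝ) *
        ∑ B, (((metricMatrix G x z)⁻¹ A B : ℝ) : ℂ) *
          partialDeriv B (η ∘ (extChartAt (𝓡 m) x).symm) z)
      (extChartAt (𝓡 m) x x)

/-- `η` belongs to the space `E_μ` of smooth complex functions on `S` with `-Δη = μη`. -/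
def InEigenspace (G : RiemMetric m S) (μ : ℝ) (η : S → ℂ) : Prop :=
  ContMDiff (𝓡 m) 𝓘(ℝ, ℂ) ∞ η ∧ ∀ y, -laplaceBeltrami G η y = μ * η y

/-- `μ` is an eigenvalue of `-Δ` on `S`. -/
def IsEigenvalue (G : RiemMetric m S) (μ : ℝ) : Prop :=
  ∃ η : S → ℂ, InEigenspace G μ η ∧ η ≠ 0

/-! ### The Hamilton operator -/

/-- `a₀ = 2n(n-1)/α_M`. -/
def aZero (n : ℕ) (αM : ℝ) : ℝ := 2 * n * (n - 1) / αM

/-- `μ̄ = (4/n²) a₀ μ - (m-1)²/4`. -/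
def muBar (n m : ℕ) (αM μ : ℝ) : ℝ :=
  4 / (n : ℝ) ^ 2 * aZero n αM * μ - ((m : ℝ) - 1) ^ 2 / 4

/-- The Hamilton operator
`Hψ = r⁻¹ ∂_r (r ∂_r ψ) + r⁻² (-(4/n²) a₀ Δψ - ((m-1)²/4) ψ)
  + (16/n²) (V̄ + Λ̄) r² ψ - (16/n²) κ r^(2(n-2)/n) ψ`
for functions `ψ` on `(0,∞) × S`. -/
def hamilton (n : ℕ) (G : RiemMetric m S) (αM Vbar Lbar κ : ℝ)
    (ψ : ℝ → S → ℂ) (r : ℝ) (y : S) : ℂ :=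
  (r : ℂ)⁻¹ * deriv (fun s : ℝ => (s : ℂ) * deriv (fun t : ℝ => ψ t y) s) r
    + ((r : ℂ) ^ 2)⁻¹ * (-((4 / (n : ℝ) ^ 2 * aZero n αM : ℝ) : ℂ) * laplaceBeltrami G (ψ r) y
        - ((((m : ℝ) - 1) ^ 2 / 4 : ℝ) : ℂ) * ψ r y)
    + ((16 / (n : ℝ) ^ 2 * (Vbar + Lbar) * r ^ 2 : ℝ) : ℂ) * ψ r y
    - ((16 / (n : ℝ) ^ 2 * κ * r ^ (2 * ((n : ℝ) - 2) / n) : ℝ) : ℂ) * ψ r y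

end Laplace

/-! ### Function spaces on `I = (0,∞)` -/

/-- The interval `(0,∞)`. -/
def halfLine : TopologicalSpace.Opens ℝ := ⟨Ioi 0, isOpen_Ioi⟩

/-- The measure `w(r) dr` on `(0,∞)`. -/
def weighted (w : ℝ → ℝ) : Measure ℝ :=
  (volume.restrict (Ioi 0)).withDensity fun r => ENNReal.ofReal (w r)

/-- The Hilbert space `L²(I,q)`, `I = (0,∞)`, with `‖u‖² = ∫_I r^q |u|²`. -/
abbrev L2 (q : ℝ) : Type := Lp ℂ 2 (weighted fun r => r ^ q)

/-- The Hilbert space of pairs `(f, u)` with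
`‖(f, u)‖² = ∫_I r |f|² - μ̄ ∫_I r⁻¹ |u|² + ∫_I r³ |u|²`, for `μ̄ ≤ 0`. -/
abbrev GraphSpace (mb : ℝ) : Type :=
  WithLp 2 (Lp ℂ 2 (weighted fun r => r) × Lp ℂ 2 (weighted fun r => -mb * r⁻¹ + r ^ 3))

/-- The test functions `φ ∈ C_c^∞(I)`, each of them identified with the pair `(φ', φ)`, so that
`‖φ‖² = ∫_I r |φ'|² - μ̄ ∫_I r⁻¹ |φ|² + ∫_I r³ |φ|²`. -/
def testFunctions (mb : ℝ) : Submodule ℂ (GraphSpace mb) where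
  carrier := {p | ∃ φ : 𝓓(halfLine, ℂ),
    (p.fst : ℝ → ℂ) =ᵐ[weighted fun r => r] deriv φ ∧
    (p.snd : ℝ → ℂ) =ᵐ[weighted fun r => -mb * r⁻¹ + r ^ 3] φ}
  zero_mem' := by
    refine ⟨0, ?_, ?_⟩
    · have h : deriv ((0 : 𝓓(halfLine, ℂ)) : ℝ → ℂ) = 0 := by ext; simp
      rw [h]
      exact Lp.coeFn_zero _ _ _
    · exact Lp.coeFn_zero _ _ _
  add_mem' := by
    rintro p q ⟨φ, h1, h2⟩ ⟨χ, h3, h4⟩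
    refine ⟨φ + χ, ?_, ?_⟩
    · filter_upwards [Lp.coeFn_add p.fst q.fst, h1, h3] with r a b c
      have : deriv (⇑(φ + χ)) r = deriv φ r + deriv χ r :=
        deriv_add (φ.contDiff.differentiable (by simp)).differentiableAt
          (χ.contDiff.differentiable (by simp)).differentiableAt
      rw [this, ← b, ← c]
      exact a
    · filter_upwards [Lp.coeFn_add p.snd q.snd, h2, h4] with r a b c
      change _ = φ r + χ r
      rw [← b, ← c]
      exact a
  smul_mem' := by
    rintro c p ⟨φ, h1, h2⟩
    refine ⟨c • φ, ?_, ?_⟩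
    · filter_upwards [Lp.coeFn_smul c p.fst, h1] with r a b
      have : deriv (⇑(c • φ)) r = c • deriv φ r :=
        deriv_const_smul c (φ.contDiff.differentiable (by simp)).differentiableAt
      rw [this, ← b]
      exact a
    · filter_upwards [Lp.coeFn_smul c p.snd, h2] with r a b
      change _ = c • φ r
      rw [← b]
      exact a

/-- Test functions on `(0,∞)` are square integrable for every continuous weight. -/
theorem memLp_weighted {w : ℝ → ℝ} (hw : ContinuousOn w (Ioi 0)) {f : ℝ → ℂ}
    (hf : Continuous f) (hc : HasCompactSupport f) (hs : tsupport f ⊆ Ioi 0) :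
    MemLp f 2 (weighted w) := by
  have hm : MeasurableSet (tsupport f) := (isClosed_tsupport f).measurableSet
  have hfin : weighted w (tsupport f) < ⊤ := by
    obtain ⟨C, hC⟩ := (IsCompact.bddAbove_image (f := w) hc (hw.mono hs))
    have : weighted w (tsupport f) ≤ ENNReal.ofReal C * volume (tsupport f) := by
      rw [weighted, withDensity_apply _ hm]
      calc _ ≤ ∫⁻ r in tsupport f, ENNReal.ofReal C ∂(volume.restrict (Ioi 0)) := by
            refine setLIntegral_mono_ae' hm (ae_of_all _ fun r hr => ?_)
            exact ENNReal.ofReal_le_ofReal (hC (mem_image_of_mem _ hr))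
        _ ≤ _ := by
            rw [setLIntegral_const]
            gcongr
            exact Measure.restrict_le_self
    exact this.trans_lt (ENNReal.mul_lt_top ENNReal.ofReal_lt_top hc.measure_lt_top)
  obtain ⟨C, hC⟩ := hc.exists_bound_of_continuous hf
  have h1 : MemLp f 2 ((weighted w).restrict (tsupport f)) := by
    have : IsFiniteMeasure ((weighted w).restrict (tsupport f)) :=
      ⟨by simpa using hfin⟩
    exact MemLp.of_bound hf.aestronglyMeasurable C (ae_of_all _ hC)
  have := (memLp_indicator_iff_restrict hm).2 h1
  rwa [Set.indicator_eq_self.2 (subset_tsupport f)] at this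

/-- Every function in `C_c^∞(I)` does occur in `testFunctions`. -/
theorem exists_mem_testFunctions (mb : ℝ) (φ : 𝓓(halfLine, ℂ)) :
    ∃ p ∈ testFunctions mb, (p.fst : ℝ → ℂ) =ᵐ[weighted fun r => r] deriv φ ∧
    (p.snd : ℝ → ℂ) =ᵐ[weighted fun r => -mb * r⁻¹ + r ^ 3] φ := by
  have hd : MemLp (deriv φ) 2 (weighted fun r => r) :=
    memLp_weighted (by fun_prop) (φ.contDiff.continuous_deriv (by simp))
      φ.hasCompactSupport.deriv
      ((closure_minimal support_deriv_subset (isClosed_tsupport _)).trans φ.tsupport_subset)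
  have h0 : MemLp φ 2 (weighted fun r => -mb * r⁻¹ + r ^ 3) :=
    memLp_weighted (by
      refine ContinuousOn.add (continuousOn_const.mul (continuousOn_inv₀.mono ?_)) (by fun_prop)
      intro x hx; exact ne_of_gt hx) φ.contDiff.continuous
      φ.hasCompactSupport φ.tsupport_subset
  exact ⟨WithLp.toLp 2 (hd.toLp _, h0.toLp _), ⟨φ, hd.coeFn_toLp, h0.coeFn_toLp⟩,
    hd.coeFn_toLp, h0.coeFn_toLp⟩

/-- The Hilbert space `H₂(μ̄)`: the completion of `C_c^∞(I)` with respect to the scalar product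
`⟨u,v⟩₂ = ∫_I r u' v̄' - μ̄ ∫_I r⁻¹ u v̄ + ∫_I r³ u v̄`, realized as the closure of `C_c^∞(I)` in
the complete space of pairs `(f, u)`. An element is thus a pair `(u', u)`, in which `u'` is the
weak derivative of `u`. -/
abbrev H2 (mb : ℝ) : Submodule ℂ (GraphSpace mb) := (testFunctions mb).topologicalClosure

/-- The element `x` of `H₂(μ̄)`, as a function on `(0,∞)` (up to null sets). -/
def fn {mb : ℝ} (x : H2 mb) : ℝ → ℂ := (x : GraphSpace mb).snd

/-- The weak derivative of `x`, as a function on `(0,∞)` (up to null sets). -/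
def dfn {mb : ℝ} (x : H2 mb) : ℝ → ℂ := (x : GraphSpace mb).fst

/-- The function `u` on `(0,∞)` is the element `x` of `H₂(μ̄)`. -/
def Represents {mb : ℝ} (x : H2 mb) (u : ℝ → ℂ) : Prop :=
  fn x =ᵐ[volume.restrict (Ioi 0)] u

/-- `x ∈ H₂(μ̄)` solves `Bx - (16/n²) Λ̄ r² x = -(16/n²) κ r^(2(n-2)/n) x`, where the Bessel operator
`Bx = -r⁻¹ (r x')' - r⁻² μ̄ x` is given by `⟨Bx,v⟩ = ∫_I r x' v̄' - μ̄ ∫_I r⁻¹ x v̄`; both sides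
are paired with `v ∈ H₂(μ̄)` in `L²(I,1)`. -/
def SolvesEigenvalueProblem (n : ℕ) (κ mb Lbar : ℝ) (x : H2 mb) : Prop :=
  ∀ v : H2 mb,
    (∫ r in Ioi (0 : ℝ), (r : ℂ) * (dfn x r * star (dfn v r)))
        - mb * (∫ r in Ioi (0 : ℝ), ((r⁻¹ : ℝ) : ℂ) * (fn x r * star (fn v r)))
        - (16 / (n : ℝ) ^ 2 * Lbar : ℝ)
            * (∫ r in Ioi (0 : ℝ), ((r ^ 3 : ℝ) : ℂ) * (fn x r * star (fn v r)))
      = -(16 / (n : ℝ) ^ 2 * κ : ℝ)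
            * (∫ r in Ioi (0 : ℝ), ((r * r ^ (2 * ((n : ℝ) - 2) / n) : ℝ) : ℂ)
                * (fn x r * star (fn v r)))

/-- `λ = (-Λ̄)^(-(n-1)/n)`. -/
def lam (n : ℕ) (Lbar : ℝ) : ℝ := (-Lbar) ^ (-(((n : ℝ) - 1) / n))

/-- The rescaled function `ũ(r) = u(λ^(n/(4(n-1))) r)`, `λ = (-Λ̄)^(-(n-1)/n)`. -/
def rescaled (n : ℕ) (Lbar : ℝ) (u : ℝ → ℂ) (r : ℝ) : ℂ :=
  u (lam n Lbar ^ ((n : ℝ) / (4 * ((n : ℝ) - 1))) * r)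

/-- The sequence `e` is complete (its linear span is dense) and minimal (it has a biorthogonal
sequence of continuous linear functionals). -/
def IsCompleteMinimal {X : Type*} [NormedAddCommGroup X] [NormedSpace ℂ X] (e : ℕ → X) : Prop :=
  (Submodule.span ℂ (range e)).topologicalClosure = ⊤ ∧
    ∃ f : ℕ → StrongDual ℂ X, ∀ i j, f i (e j) = if i = j then 1 else 0

end

end QuantumFriedman

namespace QuantumFriedman

noncomputable section

/-! ### Weighted measures on the half line -/

section Weighted

variable {w : ℝ → ℝ}

/-! In weak form the equation reads `-(r u')' - mb r⁻¹ u + c r³ u = d r^s u`, with `c = 16/n² (-L)`,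
`d = 16/n² (-κ)` and `s = 1 + 2(n-2)/n ∈ [1, 3)`. The unknown `L` sits in the coefficient of `r³`,
on the wrong side for the spectral theorem. Dilations repair this. The forms `∫ r |u'|²` and `∫ r⁻¹
|u|²` are invariant under `u ↦ u(ρ ·)`, so a dilation turns the coefficients `(c, d)` into `(c ρ⁴, d
ρ^(1+s))` (`IsWeakSolution.dilate`). With `L = -ρ⁻⁴` one normalizes to `L = -1`: now `c = 16/n²` is
fixed and `d = 16/n² (-κ) ρ^(1+s)` is a genuine eigenvalue parameter. The normalized eigenfunctions
are exactly the rescaled functions `ũ_i`.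

For fixed `c > 0` the left side is a scalar product equivalent to that of `H₂(μ̄)`
(`norm_le_energyMap`), and the form `∫ r^s |u|²` is compact (`isCompactOperator_embedPow`). Point
values satisfy `|u(t)|² ≤ 6 (1 + t + 1/t) ‖u‖²`, so the embedding is given on `(0, R)` by a square
integrable family of functionals; beyond `R` one gains `R^(s-3)` against the `r³` term of the norm.
The spectral theorem for compact self-adjoint operators gives eigenfunctions orthogonal in the
energy product, hence an unconditional basis of `H₂(μ̄)` (`exists_eigenbasis`).

Simplicity comes from the differential equation. Weak solutions are classical by du Bois-Reymond.
The Wronskian `r (u₁ u₂' - u₂ u₁')` of two of them is constant, and integrable at infinity because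
both lie in `H₂(μ̄)`; so it vanishes, and initial value uniqueness makes them proportional.
Bootstrapping gives smoothness.

In `L²(I,1)` completeness follows from density of `H₂(μ̄)`. For minimality, eigenfunctions with
different `d` are orthogonal with weight `r^s`, so pairing with `r^(s-1) ũ_i` in `L²(I,1)` is
biorthogonal up to normalization. That this multiplier lies in `L²(I,1)` requires decay beyond that
of `H₂(μ̄)`, provided by `IsODESolution.integrableOn_pow_five`. -/

theorem ae_weighted (hm : Measurable w) (hw : ∀ r > 0, 0 < w r) :
    ae (weighted w) = ae (volume.restrict (Ioi (0 : ℝ))) := by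
  refine Filter.ext fun s => ?_
  change (∀ᵐ r ∂(weighted w), r ∈ s) ↔ ∀ᵐ r ∂(volume.restrict (Ioi (0 : ℝ))), r ∈ s
  rw [weighted, ae_withDensity_iff hm.ennreal_ofReal]
  refine eventually_congr ?_
  filter_upwards [ae_restrict_mem measurableSet_Ioi] with r hr
  have := hw r hr
  simp [this]

theorem integral_weighted {E : Type*} [NormedAddCommGroup E] [NormedSpace ℝ E]
    (hm : Measurable w) (hw : ∀ r > 0, 0 < w r) (f : ℝ → E) :
    ∫ r, f r ∂(weighted w) = ∫ r in Ioi (0 : ℝ), w r • f r := by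
  rw [weighted, integral_withDensity_eq_integral_toReal_smul hm.ennreal_ofReal
    (ae_of_all _ fun _ => ENNReal.ofReal_lt_top)]
  refine setIntegral_congr_fun measurableSet_Ioi fun r hr => ?_
  simp [ENNReal.toReal_ofReal (hw r hr).le]

theorem integrable_weighted_iff {E : Type*} [NormedAddCommGroup E] [NormedSpace ℝ E]
    (hm : Measurable w) (hw : ∀ r > 0, 0 < w r) (f : ℝ → E) :
    Integrable f (weighted w) ↔ IntegrableOn (fun r => w r • f r) (Ioi (0 : ℝ)) := by
  rw [weighted, integrable_withDensity_iff_integrable_smul' hm.ennreal_ofReal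
    (ae_of_all _ fun _ => ENNReal.ofReal_lt_top)]
  refine integrable_congr ?_
  filter_upwards [ae_restrict_mem measurableSet_Ioi] with r hr
  simp [ENNReal.toReal_ofReal (hw r hr).le]

theorem aestronglyMeasurable_weighted_iff {E : Type*} [NormedAddCommGroup E]
    (hm : Measurable w) (hw : ∀ r > 0, 0 < w r) (f : ℝ → E) :
    AEStronglyMeasurable f (weighted w) ↔ AEStronglyMeasurable f (volume.restrict (Ioi (0 : ℝ))) := by
  have h := ae_weighted hm hw
  constructor <;> rintro ⟨g, hg, hfg⟩ <;> refine ⟨g, hg, ?_⟩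
  · exact (h ▸ hfg : _)
  · change ∀ᶠ _ in _, _
    rw [h]; exact hfg

theorem memLp_weighted_iff {E : Type*} [NormedAddCommGroup E]
    (hm : Measurable w) (hw : ∀ r > 0, 0 < w r) (f : ℝ → E) :
    MemLp f 2 (weighted w) ↔ AEStronglyMeasurable f (volume.restrict (Ioi (0 : ℝ))) ∧
      IntegrableOn (fun r => w r * ‖f r‖ ^ 2) (Ioi (0 : ℝ)) := by
  constructor
  · intro h
    have h1 := (aestronglyMeasurable_weighted_iff hm hw f).1 h.1
    refine ⟨h1, ?_⟩
    have h2 := (memLp_two_iff_integrable_sq_norm h.1).1 h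
    simpa using (integrable_weighted_iff hm hw _).1 h2
  · rintro ⟨h1, h2⟩
    have h3 := (aestronglyMeasurable_weighted_iff hm hw f).2 h1
    rw [memLp_two_iff_integrable_sq_norm h3, integrable_weighted_iff hm hw]
    simpa using h2

theorem integrableOn_normSq (hm : Measurable w) (hw : ∀ r > 0, 0 < w r)
    (f : Lp ℂ 2 (weighted w)) : IntegrableOn (fun r => w r * ‖f r‖ ^ 2) (Ioi (0 : ℝ)) :=
  ((memLp_weighted_iff hm hw _).1 (Lp.memLp f)).2

theorem inner_weighted (hm : Measurable w) (hw : ∀ r > 0, 0 < w r) (f g : Lp ℂ 2 (weighted w)) :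
    inner ℂ f g = ∫ r in Ioi (0 : ℝ), (w r : ℂ) * (g r * star (f r)) := by
  rw [L2.inner_def, integral_weighted hm hw]
  simp [RCLike.inner_apply]

theorem normSq_weighted (hm : Measurable w) (hw : ∀ r > 0, 0 < w r) (f : Lp ℂ 2 (weighted w)) :
    ‖f‖ ^ 2 = ∫ r in Ioi (0 : ℝ), w r * ‖f r‖ ^ 2 := by
  have h := inner_weighted hm hw f f
  rw [inner_self_eq_norm_sq_to_K] at h
  have : (fun r => (w r : ℂ) * (f r * star (f r))) = fun r => ((w r * ‖f r‖ ^ 2 : ℝ) : ℂ) := by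
    funext r
    have := RCLike.mul_conj (f r)
    simp only [RCLike.star_def, this]
    push_cast; rfl
  rw [this, integral_complex_ofReal] at h
  have norm_sq_eq := congrArg Complex.re h
  simpa [← Complex.ofReal_pow] using norm_sq_eq

/-- Cauchy-Schwarz for the pairing of a weighted `L²` function with an indicator function. -/
theorem norm_setIntegral_le_of_weighted {A : Set ℝ} (hA : MeasurableSet A) (hA0 : A ⊆ Ioi 0)
    (hm : Measurable w) (hw : ∀ r > 0, 0 < w r) {g : ℝ → ℝ} (hg : Measurable g)
    (hi : IntegrableOn (fun r => g r ^ 2 / w r) A) (f : Lp ℂ 2 (weighted w)) :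
    IntegrableOn (fun r => (g r : ℂ) * f r) A ∧
      ‖∫ r in A, (g r : ℂ) * f r‖ ^ 2 ≤ (∫ r in A, g r ^ 2 / w r) * ‖f‖ ^ 2 := by
  -- The functional `f ↦ ∫_A g f` is represented in the weighted space by `g / w` on `A`, whose
  -- squared norm is `∫_A g² / w`.
  have hmem : MemLp (A.indicator fun r => ((g r / w r : ℝ) : ℂ)) 2 (weighted w) := by
    rw [memLp_weighted_iff hm hw]
    refine ⟨((Complex.measurable_ofReal.comp (hg.div hm)).indicator hA).aestronglyMeasurable, ?_⟩
    have : (fun r => w r * ‖A.indicator (fun r => ((g r / w r : ℝ) : ℂ)) r‖ ^ 2)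
        =ᵐ[volume.restrict (Ioi 0)] A.indicator fun r => g r ^ 2 / w r := by
      filter_upwards [ae_restrict_mem measurableSet_Ioi] with r hr
      by_cases h : r ∈ A
      · have := (hw r hr).ne'
        simp only [indicator_of_mem h, Complex.norm_real, Real.norm_eq_abs, sq_abs]
        field_simp
      · simp [indicator_of_notMem h]
    refine Integrable.congr ?_ this.symm
    rw [integrable_indicator_iff hA]
    rwa [IntegrableOn, Measure.restrict_restrict hA, inter_eq_left.2 hA0]
  set G := hmem.toLp _ with hG
  have hGc : ∀ᵐ r ∂(volume.restrict (Ioi 0)), G r = A.indicator (fun r => ((g r / w r : ℝ) : ℂ)) r := by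
    have := hmem.coeFn_toLp
    change ∀ᶠ _ in _, _ at this
    rwa [ae_weighted hm hw] at this
  have hin : (fun r => (w r : ℂ) * (f r * star (G r))) =ᵐ[volume.restrict (Ioi 0)]
      A.indicator fun r => (g r : ℂ) * f r := by
    filter_upwards [hGc, ae_restrict_mem measurableSet_Ioi] with r h hr
    rw [h]
    by_cases hA : r ∈ A
    · have : (w r : ℂ) ≠ 0 := by exact_mod_cast (hw r hr).ne'
      simp [indicator_of_mem hA]
      field_simp
    · simp [indicator_of_notMem hA]
  have hr : (volume.restrict (Ioi 0)).restrict A = volume.restrict A := by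
    rw [Measure.restrict_restrict hA, inter_eq_left.2 hA0]
  have h1 : inner ℂ G f = ∫ r in A, (g r : ℂ) * f r := by
    rw [inner_weighted hm hw, integral_congr_ae hin, integral_indicator hA, hr]
  have h2 : ‖G‖ ^ 2 = ∫ r in A, g r ^ 2 / w r := by
    rw [normSq_weighted hm hw, ← hr, ← integral_indicator hA]
    refine integral_congr_ae ?_
    filter_upwards [hGc, ae_restrict_mem measurableSet_Ioi] with r h hr
    rw [h]
    by_cases hA : r ∈ A
    · have := (hw r hr).ne'
      simp only [indicator_of_mem hA, Complex.norm_real, Real.norm_eq_abs, sq_abs]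
      field_simp
    · simp [indicator_of_notMem hA]
  constructor
  · have h3 : Integrable (fun r => inner ℂ (G r) (f r)) (weighted w) := L2.integrable_inner G f
    rw [integrable_weighted_iff hm hw] at h3
    have h4 : Integrable (fun r => (w r : ℂ) * (f r * star (G r))) (volume.restrict (Ioi 0)) := by
      refine h3.congr (ae_of_all _ fun r => ?_)
      simp [RCLike.inner_apply]
    have h5 := h4.congr hin
    rwa [integrable_indicator_iff hA, IntegrableOn, hr] at h5
  · rw [← h1, ← h2, ← mul_pow]
    exact pow_le_pow_left₀ (norm_nonneg _) (norm_inner_le_norm _ _) 2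

end Weighted

/-! ### Continuous representatives of the elements of `H₂(μ̄)` -/

/-- The cubic term keeps the weight positive even for `mb = 0`. Strict positivity gives the weighted
measure the same null sets as Lebesgue measure. -/
theorem potential_weight_pos {mb : ℝ} (hmb : mb ≤ 0) : ∀ r > 0, 0 < -mb * r⁻¹ + r ^ 3 := by
  intro r hr
  have : 0 ≤ -mb * r⁻¹ := mul_nonneg (by linarith) (by positivity)
  positivity

theorem measurable_potential_weight (mb : ℝ) : Measurable fun r : ℝ => -mb * r⁻¹ + r ^ 3 := by
  fun_prop

theorem id_weight_pos : ∀ r > (0 : ℝ), 0 < r := fun _ h => h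

section Representative

variable {mb : ℝ}

theorem norm_fst_le (x : H2 mb) : ‖(x : GraphSpace mb).fst‖ ≤ ‖x‖ := by
  have := WithLp.prod_norm_sq_eq_of_L2 (x : GraphSpace mb)
  refine abs_le_of_sq_le_sq' ?_ (norm_nonneg _) |>.2
  rw [Submodule.coe_norm, this]
  nlinarith [sq_nonneg ‖(x : GraphSpace mb).snd‖]

theorem norm_snd_le (x : H2 mb) : ‖(x : GraphSpace mb).snd‖ ≤ ‖x‖ := by
  have := WithLp.prod_norm_sq_eq_of_L2 (x : GraphSpace mb)
  refine abs_le_of_sq_le_sq' ?_ (norm_nonneg _) |>.2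
  rw [Submodule.coe_norm, this]
  nlinarith [sq_nonneg ‖(x : GraphSpace mb).fst‖]

theorem normSq_eq (hmb : mb ≤ 0) (x : H2 mb) :
    ‖x‖ ^ 2 = (∫ r in Ioi (0 : ℝ), r * ‖dfn x r‖ ^ 2) +
      ∫ r in Ioi (0 : ℝ), (-mb * r⁻¹ + r ^ 3) * ‖fn x r‖ ^ 2 := by
  rw [Submodule.coe_norm, WithLp.prod_norm_sq_eq_of_L2, normSq_weighted measurable_id id_weight_pos,
    normSq_weighted (measurable_potential_weight mb) (potential_weight_pos hmb)]
  rfl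

theorem integrableOn_dfn_sq (x : H2 mb) :
    IntegrableOn (fun r => r * ‖dfn x r‖ ^ 2) (Ioi (0 : ℝ)) :=
  integrableOn_normSq measurable_id id_weight_pos _

theorem integrableOn_fn_sq (hmb : mb ≤ 0) (x : H2 mb) :
    IntegrableOn (fun r => (-mb * r⁻¹ + r ^ 3) * ‖fn x r‖ ^ 2) (Ioi (0 : ℝ)) :=
  integrableOn_normSq (measurable_potential_weight mb) (potential_weight_pos hmb) _

theorem ae_of_ae_fst {P : ℝ → Prop} (h : ∀ᵐ r ∂(weighted fun r => r), P r) :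
    ∀ᵐ r ∂(volume.restrict (Ioi (0 : ℝ))), P r := by
  change ∀ᶠ _ in _, _ at h
  rwa [ae_weighted (w := fun r => r) measurable_id id_weight_pos] at h

theorem ae_of_ae_snd (hmb : mb ≤ 0) {P : ℝ → Prop}
    (h : ∀ᵐ r ∂(weighted fun r => -mb * r⁻¹ + r ^ 3), P r) :
    ∀ᵐ r ∂(volume.restrict (Ioi (0 : ℝ))), P r := by
  change ∀ᶠ _ in _, _ at h
  rwa [ae_weighted (measurable_potential_weight mb) (potential_weight_pos hmb)] at h

theorem dfn_add (x y : H2 mb) :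
    ∀ᵐ r ∂(volume.restrict (Ioi (0 : ℝ))), dfn (x + y) r = dfn x r + dfn y r :=
  ae_of_ae_fst (Lp.coeFn_add (x : GraphSpace mb).fst (y : GraphSpace mb).fst)

theorem dfn_smul (c : ℂ) (x : H2 mb) :
    ∀ᵐ r ∂(volume.restrict (Ioi (0 : ℝ))), dfn (c • x) r = c * dfn x r :=
  ae_of_ae_fst (Lp.coeFn_smul c (x : GraphSpace mb).fst)

theorem fn_add (hmb : mb ≤ 0) (x y : H2 mb) :
    ∀ᵐ r ∂(volume.restrict (Ioi (0 : ℝ))), fn (x + y) r = fn x r + fn y r :=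
  ae_of_ae_snd hmb (Lp.coeFn_add (x : GraphSpace mb).snd (y : GraphSpace mb).snd)

theorem fn_smul (hmb : mb ≤ 0) (c : ℂ) (x : H2 mb) :
    ∀ᵐ r ∂(volume.restrict (Ioi (0 : ℝ))), fn (c • x) r = c * fn x r :=
  ae_of_ae_snd hmb (Lp.coeFn_smul c (x : GraphSpace mb).snd)

/-- Both components are compared, since it is not yet known that the function determines its weak
derivative; `H2_ext_val` removes the first condition. -/
theorem H2_ext (hmb : mb ≤ 0) {x y : H2 mb} (h1 : dfn x =ᵐ[volume.restrict (Ioi 0)] dfn y)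
    (h2 : fn x =ᵐ[volume.restrict (Ioi 0)] fn y) : x = y := by
  refine Subtype.ext (WithLp.ofLp_injective 2 (Prod.ext ?_ ?_))
  · refine Lp.ext ?_
    change ∀ᶠ _ in _, _
    rw [ae_weighted (w := fun r => r) measurable_id id_weight_pos]
    exact h1
  · refine Lp.ext ?_
    change ∀ᶠ _ in _, _
    rw [ae_weighted (measurable_potential_weight mb) (potential_weight_pos hmb)]
    exact h2

/-- The element of `H₂(μ̄)` given by a test function. -/
def ofTest (mb : ℝ) (φ : 𝓓(halfLine, ℂ)) : H2 mb :=
  ⟨(exists_mem_testFunctions mb φ).choose,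
    Submodule.le_topologicalClosure _ (exists_mem_testFunctions mb φ).choose_spec.1⟩

theorem dfn_ofTest (φ : 𝓓(halfLine, ℂ)) :
    dfn (ofTest mb φ) =ᵐ[volume.restrict (Ioi 0)] deriv φ :=
  ae_of_ae_fst (exists_mem_testFunctions mb φ).choose_spec.2.1

theorem fn_ofTest (hmb : mb ≤ 0) (φ : 𝓓(halfLine, ℂ)) :
    fn (ofTest mb φ) =ᵐ[volume.restrict (Ioi 0)] φ :=
  ae_of_ae_snd hmb (exists_mem_testFunctions mb φ).choose_spec.2.2

theorem exists_seq_ofTest_tendsto (hmb : mb ≤ 0) (x : H2 mb) :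
    ∃ φ : ℕ → 𝓓(halfLine, ℂ), Tendsto (fun k => ofTest mb (φ k)) atTop (𝓝 x) := by
  obtain ⟨p, hp, hpx⟩ := mem_closure_iff_seq_limit.1
    (show (x : GraphSpace mb) ∈ closure (testFunctions mb : Set (GraphSpace mb)) from x.2)
  choose φ h1 h2 using hp
  refine ⟨φ, ?_⟩
  rw [tendsto_subtype_rng]
  refine hpx.congr fun k => ?_
  let y : H2 mb := ⟨p k, Submodule.le_topologicalClosure _ ⟨φ k, h1 k, h2 k⟩⟩
  have : y = ofTest mb (φ k) := by
    refine H2_ext hmb ?_ ?_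
    · exact (show dfn y =ᵐ[volume.restrict (Ioi 0)] deriv (φ k) from ae_of_ae_fst (h1 k)).trans
        (dfn_ofTest _).symm
    · exact (show fn y =ᵐ[volume.restrict (Ioi 0)] φ k from ae_of_ae_snd hmb (h2 k)).trans
        (fn_ofTest hmb _).symm
  exact congrArg Subtype.val this

/-- Cauchy-Schwarz against the weight `r`; the logarithm is `∫ 1/r` over the interval. -/
theorem dfn_integral_aux {a b : ℝ} (ha : 0 < a) (hab : a ≤ b) (x : H2 mb) :
    IntegrableOn (dfn x) (Ioc a b) ∧
      ‖∫ r in Ioc a b, dfn x r‖ ^ 2 ≤ Real.log (b / a) * ‖x‖ ^ 2 := by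
  have hb : 0 < b := ha.trans_le hab
  have hint : IntervalIntegrable (fun r : ℝ => r⁻¹) volume a b :=
    intervalIntegral.intervalIntegrable_inv (fun r hr => by
      rw [uIcc_of_le hab] at hr; exact (ha.trans_le hr.1).ne') continuousOn_id
  have h := norm_setIntegral_le_of_weighted (w := fun r => r) (g := fun _ => 1)
    (A := Ioc a b) measurableSet_Ioc
    (fun r hr => ha.trans hr.1) measurable_id id_weight_pos measurable_const
    (by simpa using (intervalIntegrable_iff_integrableOn_Ioc_of_le hab).1 hint)
    (x : GraphSpace mb).fst
  simp only [Complex.ofReal_one, one_mul, one_pow, one_div] at h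
  refine ⟨h.1, h.2.trans ?_⟩
  rw [← intervalIntegral.integral_of_le hab, integral_inv_of_pos ha hb]
  have := norm_fst_le x
  have hl : 0 ≤ Real.log (b / a) := Real.log_nonneg ((one_le_div ha).2 hab)
  gcongr

theorem intervalIntegrable_dfn {a b : ℝ} (ha : 0 < a) (hb : 0 < b) (x : H2 mb) :
    IntervalIntegrable (dfn x) volume a b := by
  rcases le_total a b with h | h
  · exact (intervalIntegrable_iff_integrableOn_Ioc_of_le h).2 (dfn_integral_aux ha h x).1
  · exact ((intervalIntegrable_iff_integrableOn_Ioc_of_le h).2 (dfn_integral_aux hb h x).1).symm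

theorem norm_integral_dfn_sq_le {a b : ℝ} (ha : 0 < a) (hb : 0 < b) (x : H2 mb) :
    ‖∫ r in a..b, dfn x r‖ ^ 2 ≤ |Real.log (b / a)| * ‖x‖ ^ 2 := by
  rcases le_total a b with h | h
  · rw [intervalIntegral.integral_of_le h]
    refine (dfn_integral_aux ha h x).2.trans ?_
    gcongr
    exact le_abs_self _
  · rw [intervalIntegral.integral_of_ge h, norm_neg]
    refine (dfn_integral_aux hb h x).2.trans ?_
    gcongr
    rw [Real.log_div ha.ne' hb.ne', Real.log_div hb.ne' ha.ne', abs_sub_comm]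
    exact le_abs_self _

/-- The factor `r - 1` arises from `φ(2) = ∫ φ + ∫ (r - 1) φ'` over `[1, 2]`, which expresses a
point value by quantities continuous in the norm; `val` is built on it. -/
theorem weighted_dfn_integral_aux (x : H2 mb) :
    IntegrableOn (fun r => ((r - 1 : ℝ) : ℂ) * dfn x r) (Ioc 1 2) ∧
      ‖∫ r in Ioc (1 : ℝ) 2, ((r - 1 : ℝ) : ℂ) * dfn x r‖ ^ 2 ≤ ‖x‖ ^ 2 := by
  have hle : ∀ r ∈ Ioc (1 : ℝ) 2, (r - 1) ^ 2 / r ≤ 1 := by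
    intro r hr
    rw [div_le_one (by linarith [hr.1])]
    nlinarith [hr.1, hr.2]
  have hi : IntegrableOn (fun r : ℝ => (r - 1) ^ 2 / r) (Ioc 1 2) := by
    refine (ContinuousOn.integrableOn_Icc ?_).mono_set Ioc_subset_Icc_self
    exact ContinuousOn.div (by fun_prop) (by fun_prop) fun r hr => by linarith [hr.1]
  have h := norm_setIntegral_le_of_weighted (w := fun r => r) (g := fun r => r - 1)
    (A := Ioc 1 2) measurableSet_Ioc (fun r hr => by simp only [mem_Ioi]; linarith [hr.1])
    measurable_id id_weight_pos
    (by fun_prop) hi (x : GraphSpace mb).fst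
  refine ⟨h.1, h.2.trans ?_⟩
  have h1 : ∫ r in Ioc (1 : ℝ) 2, (r - 1) ^ 2 / r ≤ 1 := by
    calc _ ≤ ∫ r in Ioc (1 : ℝ) 2, (1 : ℝ) :=
          setIntegral_mono_on hi (by simp) measurableSet_Ioc hle
      _ = 1 := by simp; norm_num
  have h2 := pow_le_pow_left₀ (norm_nonneg _) (norm_fst_le x) 2
  nlinarith [sq_nonneg ‖(x : GraphSpace mb).fst‖]

theorem fn_integral_aux (hmb : mb ≤ 0) (x : H2 mb) :
    IntegrableOn (fn x) (Ioc 1 2) ∧ ‖∫ r in Ioc (1 : ℝ) 2, fn x r‖ ^ 2 ≤ ‖x‖ ^ 2 := by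
  have hle : ∀ r ∈ Ioc (1 : ℝ) 2, (1 : ℝ) ^ 2 / (-mb * r⁻¹ + r ^ 3) ≤ 1 := by
    intro r hr
    have h0 : 0 < r := by linarith [hr.1]
    rw [div_le_one (potential_weight_pos hmb r h0)]
    have : 0 ≤ -mb * r⁻¹ := mul_nonneg (by linarith) (by positivity)
    nlinarith [one_le_pow₀ hr.1.le (n := 3)]
  have hi : IntegrableOn (fun r : ℝ => (1 : ℝ) ^ 2 / (-mb * r⁻¹ + r ^ 3)) (Ioc 1 2) := by
    refine Integrable.mono' (g := fun _ => (1 : ℝ)) (by simp)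
      (measurable_const.div (measurable_potential_weight mb)).aestronglyMeasurable ?_
    filter_upwards [ae_restrict_mem measurableSet_Ioc] with r hr
    rw [Real.norm_of_nonneg]
    · exact hle r hr
    · have := potential_weight_pos hmb r (by linarith [hr.1])
      positivity
  have h := norm_setIntegral_le_of_weighted (w := fun r => -mb * r⁻¹ + r ^ 3) (g := fun _ => 1)
    (A := Ioc 1 2) measurableSet_Ioc (fun r hr => by simp only [mem_Ioi]; linarith [hr.1])
    (measurable_potential_weight mb) (potential_weight_pos hmb)
    measurable_const hi (x : GraphSpace mb).snd
  simp only [Complex.ofReal_one, one_mul] at h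
  refine ⟨h.1, h.2.trans ?_⟩
  have h1 : ∫ r in Ioc (1 : ℝ) 2, (1 : ℝ) ^ 2 / (-mb * r⁻¹ + r ^ 3) ≤ 1 := by
    calc _ ≤ ∫ r in Ioc (1 : ℝ) 2, (1 : ℝ) :=
          setIntegral_mono_on hi (by simp) measurableSet_Ioc hle
      _ = 1 := by simp; norm_num
  have h2 := pow_le_pow_left₀ (norm_nonneg _) (norm_snd_le x) 2
  nlinarith [sq_nonneg ‖(x : GraphSpace mb).snd‖]

/-- The continuous representative of an element of `H₂(μ̄)`; the formula reproduces
`C¹` functions. -/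
def val (x : H2 mb) (t : ℝ) : ℂ :=
  (∫ r in Ioc (1 : ℝ) 2, fn x r) + (∫ r in Ioc (1 : ℝ) 2, ((r - 1 : ℝ) : ℂ) * dfn x r)
    + ∫ r in (2 : ℝ)..t, dfn x r

theorem val_sub_val {a b : ℝ} (ha : 0 < a) (hb : 0 < b) (x : H2 mb) :
    val x b - val x a = ∫ r in a..b, dfn x r := by
  have := intervalIntegral.integral_interval_sub_left
    (intervalIntegrable_dfn (by norm_num : (0 : ℝ) < 2) hb x)
    (intervalIntegrable_dfn (by norm_num : (0 : ℝ) < 2) ha x)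
  rw [← this, val, val]; ring

theorem norm_val_sub_sq_le {a b : ℝ} (ha : 0 < a) (hb : 0 < b) (x : H2 mb) :
    ‖val x b - val x a‖ ^ 2 ≤ |Real.log (b / a)| * ‖x‖ ^ 2 := by
  rw [val_sub_val ha hb]; exact norm_integral_dfn_sq_le ha hb x

theorem abs_log_half_le {t : ℝ} (ht : 0 < t) : |Real.log (t / 2)| ≤ t + 2 / t := by
  have h1 := Real.log_le_self (x := t / 2) (by positivity)
  have h2 := Real.log_le_self (x := 2 / t) (by positivity)
  have h3 : Real.log (2 / t) = - Real.log (t / 2) := by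
    rw [← Real.log_inv, inv_div]
  have h4 : 0 < 2 / t := by positivity
  rw [abs_le]
  constructor <;> linarith

/-- The squares of the three terms of `val` are at most `1`, `1` and `t + 2/t` times `‖x‖²`, and
squaring the sum costs a factor `3`. The bound is crude at `0`, but multiplication by `t` already
makes it bounded there. -/
theorem norm_val_sq_le (hmb : mb ≤ 0) {t : ℝ} (ht : 0 < t) (x : H2 mb) :
    ‖val x t‖ ^ 2 ≤ 6 * (1 + t + t⁻¹) * ‖x‖ ^ 2 := by
  have h1 := (fn_integral_aux hmb x).2
  have h2 := (weighted_dfn_integral_aux x).2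
  have h3 := norm_integral_dfn_sq_le (by norm_num : (0 : ℝ) < 2) ht x
  have h4 := abs_log_half_le ht
  rw [val]
  set A := ∫ r in Ioc (1 : ℝ) 2, fn x r
  set B := ∫ r in Ioc (1 : ℝ) 2, ((r - 1 : ℝ) : ℂ) * dfn x r
  set C := ∫ r in (2 : ℝ)..t, dfn x r
  have h5 : ‖A + B + C‖ ≤ ‖A‖ + ‖B‖ + ‖C‖ := norm_add₃_le
  have h6 : ‖A + B + C‖ ^ 2 ≤ 3 * (‖A‖ ^ 2 + ‖B‖ ^ 2 + ‖C‖ ^ 2) := by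
    refine (pow_le_pow_left₀ (norm_nonneg _) h5 2).trans ?_
    nlinarith [sq_nonneg (‖A‖ - ‖B‖), sq_nonneg (‖A‖ - ‖C‖), sq_nonneg (‖B‖ - ‖C‖)]
  have h7 : ‖C‖ ^ 2 ≤ (t + 2 / t) * ‖x‖ ^ 2 := h3.trans (by gcongr)
  have h8 : 2 / t = 2 * t⁻¹ := div_eq_mul_inv _ _
  rw [h8] at h7
  nlinarith [mul_nonneg ht.le (sq_nonneg ‖x‖)]

theorem val_add (hmb : mb ≤ 0) {t : ℝ} (ht : 0 < t) (x y : H2 mb) :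
    val (x + y) t = val x t + val y t := by
  have hsub : Ioc (1 : ℝ) 2 ⊆ Ioi 0 := fun r hr => by simp only [mem_Ioi]; linarith [hr.1]
  have h1 : ∫ r in Ioc (1 : ℝ) 2, fn (x + y) r
      = (∫ r in Ioc (1 : ℝ) 2, fn x r) + ∫ r in Ioc (1 : ℝ) 2, fn y r := by
    rw [← integral_add (fn_integral_aux hmb x).1 (fn_integral_aux hmb y).1]
    exact integral_congr_ae (ae_restrict_of_ae_restrict_of_subset hsub (fn_add hmb x y))
  have h2 : ∫ r in Ioc (1 : ℝ) 2, ((r - 1 : ℝ) : ℂ) * dfn (x + y) r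
      = (∫ r in Ioc (1 : ℝ) 2, ((r - 1 : ℝ) : ℂ) * dfn x r)
        + ∫ r in Ioc (1 : ℝ) 2, ((r - 1 : ℝ) : ℂ) * dfn y r := by
    rw [← integral_add (weighted_dfn_integral_aux x).1 (weighted_dfn_integral_aux y).1]
    refine integral_congr_ae (ae_restrict_of_ae_restrict_of_subset hsub ?_)
    filter_upwards [dfn_add x y] with r hr
    rw [hr, mul_add]
  have h3 : ∫ r in (2 : ℝ)..t, dfn (x + y) r
      = (∫ r in (2 : ℝ)..t, dfn x r) + ∫ r in (2 : ℝ)..t, dfn y r := by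
    rw [← intervalIntegral.integral_add (intervalIntegrable_dfn two_pos ht x)
      (intervalIntegrable_dfn two_pos ht y)]
    refine intervalIntegral.integral_congr_ae ?_
    filter_upwards [(ae_restrict_iff' measurableSet_Ioi).1 (dfn_add x y)] with r hr h
    exact hr ((lt_min two_pos ht).trans h.1)
  rw [val, h1, h2, h3, val, val]; ring

theorem val_smul (hmb : mb ≤ 0) {t : ℝ} (ht : 0 < t) (c : ℂ) (x : H2 mb) :
    val (c • x) t = c * val x t := by
  have hsub : Ioc (1 : ℝ) 2 ⊆ Ioi 0 := fun r hr => by simp only [mem_Ioi]; linarith [hr.1]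
  have h1 : ∫ r in Ioc (1 : ℝ) 2, fn (c • x) r = c * ∫ r in Ioc (1 : ℝ) 2, fn x r := by
    rw [← integral_const_mul]
    exact integral_congr_ae (ae_restrict_of_ae_restrict_of_subset hsub (fn_smul hmb c x))
  have h2 : ∫ r in Ioc (1 : ℝ) 2, ((r - 1 : ℝ) : ℂ) * dfn (c • x) r
      = c * ∫ r in Ioc (1 : ℝ) 2, ((r - 1 : ℝ) : ℂ) * dfn x r := by
    rw [← integral_const_mul]
    refine integral_congr_ae (ae_restrict_of_ae_restrict_of_subset hsub ?_)
    filter_upwards [dfn_smul c x] with r hr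
    rw [hr]; ring
  have h3 : ∫ r in (2 : ℝ)..t, dfn (c • x) r = c * ∫ r in (2 : ℝ)..t, dfn x r := by
    rw [← intervalIntegral.integral_const_mul]
    refine intervalIntegral.integral_congr_ae ?_
    filter_upwards [(ae_restrict_iff' measurableSet_Ioi).1 (dfn_smul c x)] with r hr h
    exact hr ((lt_min two_pos ht).trans h.1)
  rw [val, h1, h2, h3, val]; ring

/-- Evaluation at `t`, as a continuous linear functional. -/
def evalCLM (hmb : mb ≤ 0) {t : ℝ} (ht : 0 < t) : StrongDual ℂ (H2 mb) :=
  LinearMap.mkContinuous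
    { toFun := fun x => val x t
      map_add' := val_add hmb ht
      map_smul' := val_smul hmb ht } (Real.sqrt (6 * (1 + t + t⁻¹))) fun x => by
    have h := Real.sqrt_le_sqrt (norm_val_sq_le hmb ht x)
    rwa [Real.sqrt_sq (norm_nonneg _), Real.sqrt_mul (by positivity),
      Real.sqrt_sq (norm_nonneg _)] at h

@[simp]
theorem evalCLM_apply (hmb : mb ≤ 0) {t : ℝ} (ht : 0 < t) (x : H2 mb) :
    evalCLM hmb ht x = val x t := rfl

theorem continuous_val (hmb : mb ≤ 0) {t : ℝ} (ht : 0 < t) :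
    Continuous fun x : H2 mb => val x t := (evalCLM hmb ht).continuous

theorem continuousOn_val (x : H2 mb) : ContinuousOn (val x) (Ioi 0) := by
  intro a ha
  refine ContinuousAt.continuousWithinAt ?_
  rw [ContinuousAt, tendsto_iff_norm_sub_tendsto_zero]
  have h0 : Tendsto (fun b => Real.sqrt (|Real.log (b / a)| * ‖x‖ ^ 2)) (𝓝 a) (𝓝 0) := by
    have ha' : a ≠ 0 := (mem_Ioi.1 ha).ne'
    have : ContinuousAt (fun b => Real.sqrt (|Real.log (b / a)| * ‖x‖ ^ 2)) a := by
      have h1 : ContinuousAt (fun b => Real.log (b / a)) a :=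
        ContinuousAt.log (by fun_prop) (by rw [div_self ha']; norm_num)
      exact (h1.abs.mul continuousAt_const).sqrt
    simpa [ContinuousAt, div_self ha'] using this
  refine squeeze_zero' (Eventually.of_forall fun _ => norm_nonneg _) ?_ h0
  filter_upwards [Ioi_mem_nhds (mem_Ioi.1 ha)] with b hb
  exact Real.le_sqrt_of_sq_le (norm_val_sub_sq_le ha hb x)

theorem val_ofTest (hmb : mb ≤ 0) (φ : 𝓓(halfLine, ℂ)) {t : ℝ} (ht : 0 < t) :
    val (ofTest mb φ) t = φ t := by
  have hsub : Ioc (1 : ℝ) 2 ⊆ Ioi 0 := fun r hr => by simp only [mem_Ioi]; linarith [hr.1]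
  have hd : ∀ r, HasDerivAt φ (deriv φ r) r := fun r =>
    (φ.contDiff.differentiable (by simp) r).hasDerivAt
  have hc : Continuous (deriv φ) := φ.contDiff.continuous_deriv (by simp)
  have h1 : ∫ r in Ioc (1 : ℝ) 2, fn (ofTest mb φ) r = ∫ r in (1 : ℝ)..2, φ r := by
    rw [intervalIntegral.integral_of_le one_le_two]
    exact integral_congr_ae (ae_restrict_of_ae_restrict_of_subset hsub (fn_ofTest hmb φ))
  have h2 : ∫ r in Ioc (1 : ℝ) 2, ((r - 1 : ℝ) : ℂ) * dfn (ofTest mb φ) r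
      = ∫ r in (1 : ℝ)..2, ((r - 1 : ℝ) : ℂ) * deriv φ r := by
    rw [intervalIntegral.integral_of_le one_le_two]
    refine integral_congr_ae (ae_restrict_of_ae_restrict_of_subset hsub ?_)
    filter_upwards [dfn_ofTest (mb := mb) φ] with r hr
    rw [hr]
  have h3 : ∫ r in (2 : ℝ)..t, dfn (ofTest mb φ) r = φ t - φ 2 := by
    rw [← intervalIntegral.integral_eq_sub_of_hasDerivAt (fun r _ => hd r)
      (hc.intervalIntegrable _ _)]
    refine intervalIntegral.integral_congr_ae ?_
    filter_upwards [(ae_restrict_iff' measurableSet_Ioi).1 (dfn_ofTest (mb := mb) φ)] with r hr h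
    exact hr ((lt_min two_pos ht).trans h.1)
  -- Since `r - 1` vanishes at `1`, integration by parts leaves only the boundary value `φ 2`.
  have h4 := intervalIntegral.integral_mul_deriv_eq_deriv_mul (a := 1) (b := 2)
    (u := fun r : ℝ => ((r - 1 : ℝ) : ℂ)) (u' := fun _ => 1) (v := φ) (v' := deriv φ)
    (fun r _ => by simpa using ((hasDerivAt_id r).sub_const 1).ofReal_comp) (fun r _ => hd r)
    (by simp) (hc.intervalIntegrable _ _)
  rw [val, h1, h2, h3, h4]
  simp only [one_mul]
  push_cast
  ring

/-- `val x` is a representative of `x`. -/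
theorem fn_ae_eq_val (hmb : mb ≤ 0) (x : H2 mb) :
    fn x =ᵐ[volume.restrict (Ioi 0)] val x := by
  obtain ⟨φ, hφ⟩ := exists_seq_ofTest_tendsto hmb x
  have h1 : Tendsto (fun k => ((ofTest mb (φ k) : H2 mb) : GraphSpace mb).snd) atTop
      (𝓝 (x : GraphSpace mb).snd) :=
    ((WithLp.sndL 2 ℂ _ _).continuous.tendsto _).comp
      ((continuous_subtype_val.tendsto x).comp hφ)
  -- Norm convergence gives almost everywhere convergence of a subsequence to `fn x`, while
  -- continuity of the evaluations gives convergence everywhere to `val x`.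
  obtain ⟨ns, hns, h2⟩ := (tendstoInMeasure_of_tendsto_Lp h1).exists_seq_tendsto_ae
  have h3 := ae_of_ae_snd hmb h2
  have h4 : ∀ᵐ r ∂(volume.restrict (Ioi (0 : ℝ))), ∀ k, fn (ofTest mb (φ k)) r = φ k r :=
    ae_all_iff.2 fun k => fn_ofTest hmb (φ k)
  filter_upwards [h3, h4, ae_restrict_mem measurableSet_Ioi] with r hr1 hr2 hr
  refine tendsto_nhds_unique hr1 ?_
  have h5 := (((continuous_val hmb hr).tendsto x).comp hφ).comp hns.tendsto_atTop
  refine h5.congr fun k => ?_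
  simp only [Function.comp]
  rw [val_ofTest hmb _ hr, ← hr2]
  rfl

theorem represents_val (hmb : mb ≤ 0) (x : H2 mb) : Represents x (val x) := fn_ae_eq_val hmb x

/-- Lebesgue differentiation of the indefinite integral on each `[1/(n+1), n+1]`; countably many
such intervals exhaust the half line. -/
theorem ae_hasDerivAt_val (x : H2 mb) :
    ∀ᵐ r ∂(volume.restrict (Ioi (0 : ℝ))), HasDerivAt (val x) (dfn x r) r := by
  have h : ∀ n : ℕ, ∀ᵐ r : ℝ, r ∈ uIcc ((n + 1 : ℝ)⁻¹) (n + 1) → ∀ c ∈ uIcc ((n + 1 : ℝ)⁻¹) (n + 1),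
      HasDerivAt (fun s => ∫ t in c..s, dfn x t) (dfn x r) r := fun n =>
    (intervalIntegrable_dfn (by positivity) (by positivity) x).ae_hasDerivAt_integral
  rw [ae_restrict_iff' measurableSet_Ioi]
  filter_upwards [ae_all_iff.2 h] with r hr h0
  obtain ⟨n, hn⟩ := exists_nat_gt (max r r⁻¹)
  have h0 : 0 < r := h0
  have hn1 : r < n := (le_max_left _ _).trans_lt hn
  have hn2 : r⁻¹ < n := (le_max_right _ _).trans_lt hn
  have hle : (n + 1 : ℝ)⁻¹ ≤ n + 1 :=
    (inv_le_one_of_one_le₀ (by linarith [h0.trans hn1])).trans (by linarith [h0.trans hn1])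
  have hmem : r ∈ uIcc ((n + 1 : ℝ)⁻¹) (n + 1) := by
    rw [uIcc_of_le hle]
    exact ⟨inv_le_of_inv_le₀ h0 (by linarith), by linarith⟩
  have h1 := (hr n hmem r hmem).const_add (val x r)
  refine h1.congr_of_eventuallyEq ?_
  filter_upwards [Ioi_mem_nhds h0] with s hs
  rw [← val_sub_val h0 hs]; ring

theorem dfn_ae_eq_of_hasDerivAt {x : H2 mb} {F : ℝ → ℂ}
    (h : ∀ r > 0, HasDerivAt (val x) (F r) r) : dfn x =ᵐ[volume.restrict (Ioi 0)] F := by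
  filter_upwards [ae_hasDerivAt_val x, ae_restrict_mem measurableSet_Ioi] with r hr h0
  exact hr.unique (h r h0)

/-- The derivative component is recovered almost everywhere by differentiating `val`, so the
completion really is a space of functions. -/
theorem H2_ext_val (hmb : mb ≤ 0) {x y : H2 mb} (h : ∀ r > 0, val x r = val y r) : x = y := by
  refine H2_ext hmb ?_ ?_
  · filter_upwards [ae_hasDerivAt_val x, ae_hasDerivAt_val y, ae_restrict_mem measurableSet_Ioi]
      with r h1 h2 h0
    refine h1.unique (h2.congr_of_eventuallyEq ?_)
    filter_upwards [Ioi_mem_nhds (mem_Ioi.1 h0)] with s hs using h s hs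
  · filter_upwards [fn_ae_eq_val hmb x, fn_ae_eq_val hmb y, ae_restrict_mem measurableSet_Ioi]
      with r h1 h2 h0
    rw [h1, h2, h r h0]

end Representative

/-! ### Compactness of integral operators with square integrable kernels -/

section KernelOperator

variable {α : Type*} [MeasurableSpace α] {ν : Measure α} {H : Type*} [NormedAddCommGroup H]
  [NormedSpace ℂ H]

/-- The operator `x ↦ (a ↦ k a x)` given by a square integrable family of functionals. -/
def kernelOperator :
    Lp (StrongDual ℂ H) 2 ν →L[ℂ] H →L[ℂ] Lp ℂ 2 ν :=
  LinearMap.mkContinuous₂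
    (LinearMap.mk₂ ℂ (fun k x => (ContinuousLinearMap.apply ℂ ℂ x).compLp k)
      (fun k l x => ((ContinuousLinearMap.apply ℂ ℂ x).compLpₗ 2 ν).map_add k l)
      (fun c k x => ((ContinuousLinearMap.apply ℂ ℂ x).compLpₗ 2 ν).map_smul c k)
      (fun k x y => by
        refine Lp.ext ?_
        filter_upwards [(ContinuousLinearMap.apply ℂ ℂ (x + y)).coeFn_compLp k,
          (ContinuousLinearMap.apply ℂ ℂ x).coeFn_compLp k,
          (ContinuousLinearMap.apply ℂ ℂ y).coeFn_compLp k,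
          Lp.coeFn_add ((ContinuousLinearMap.apply ℂ ℂ x).compLp k)
            ((ContinuousLinearMap.apply ℂ ℂ y).compLp k)] with a h1 h2 h3 h4
        rw [h1, h4, Pi.add_apply, h2, h3]
        exact map_add (k a) x y)
      (fun c k x => by
        refine Lp.ext ?_
        filter_upwards [(ContinuousLinearMap.apply ℂ ℂ (c • x)).coeFn_compLp k,
          (ContinuousLinearMap.apply ℂ ℂ x).coeFn_compLp k,
          Lp.coeFn_smul c ((ContinuousLinearMap.apply ℂ ℂ x).compLp k)] with a h1 h2 h4
        rw [h1, h4, Pi.smul_apply, h2]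
        exact map_smul (k a) c x)) 1 fun k x => by
    refine (ContinuousLinearMap.norm_compLp_le _ _).trans ?_
    rw [one_mul, mul_comm]
    gcongr
    exact ContinuousLinearMap.opNorm_le_bound _ (norm_nonneg _) fun f => by
      simpa [mul_comm] using f.le_opNorm x

theorem coeFn_kernelOperator (k : Lp (StrongDual ℂ H) 2 ν) (x : H) :
    ∀ᵐ a ∂ν, kernelOperator k x a = k a x :=
  (ContinuousLinearMap.apply ℂ ℂ x).coeFn_compLp k

/-- An indicator times a constant functional gives an operator of rank one. Sums and norm limits of
compact operators are compact, and simple functions are dense in `Lp`: the Hilbert-Schmidt argument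
for kernels with values in the dual. -/
theorem isCompactOperator_kernelOperator (k : Lp (StrongDual ℂ H) 2 ν) :
    IsCompactOperator (kernelOperator k) := by
  refine Lp.induction (p := 2) (by norm_num)
    (motive := fun k => IsCompactOperator (kernelOperator k)) ?_ ?_ ?_ k
  · intro c s hs hν
    let g : Lp ℂ 2 ν := indicatorConstLp 2 hs hν.ne (1 : ℂ)
    have h : kernelOperator (Lp.simpleFunc.indicatorConst 2 hs hν.ne c : Lp (StrongDual ℂ H) 2 ν)
        = (ContinuousLinearMap.toSpanSingleton ℂ g).comp c := by
      refine ContinuousLinearMap.ext fun x => Lp.ext ?_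
      filter_upwards [coeFn_kernelOperator
        (Lp.simpleFunc.indicatorConst 2 hs hν.ne c : Lp (StrongDual ℂ H) 2 ν) x,
        Lp.coeFn_smul (c x) g,
        (indicatorConstLp_coeFn : ⇑(indicatorConstLp 2 hs hν.ne c) =ᵐ[ν] _),
        (indicatorConstLp_coeFn : g =ᵐ[ν] _)] with a h1 h2 h3 h4
      rw [Lp.simpleFunc.coe_indicatorConst] at h1 ⊢
      rw [h1, h3]
      change _ = (c x • g) a
      rw [h2, Pi.smul_apply, h4]
      by_cases ha : a ∈ s <;> simp [ha]
    rw [h]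
    have h1 : IsCompactOperator c := isCompactOperator_of_locallyCompactSpace_dom c
    exact h1.clm_comp (ContinuousLinearMap.toSpanSingleton ℂ g)
  · intro f g hf hg _ h1 h2
    rw [map_add]
    exact h1.add h2
  · exact isClosed_setOfPred_isCompactOperator.preimage kernelOperator.continuous

end KernelOperator

/-! ### Embeddings of `H₂(μ̄)` into weighted `L²` spaces -/

section Embedding

variable {mb : ℝ} {w : ℝ → ℝ} {C : ℝ}

/-- The space `H₂(μ̄)` is continuously embedded into `L²` with weight `w`. -/
def EmbedsWithBound (mb : ℝ) (w : ℝ → ℝ) (C : ℝ) : Prop :=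
  ∀ x : H2 mb, IntegrableOn (fun r => w r * ‖val x r‖ ^ 2) (Ioi 0) ∧
    ∫ r in Ioi (0 : ℝ), w r * ‖val x r‖ ^ 2 ≤ C * ‖x‖ ^ 2

theorem memLp_val (hm : Measurable w) (hw : ∀ r > 0, 0 < w r) (h : EmbedsWithBound mb w C)
    (x : H2 mb) : MemLp (val x) 2 (weighted w) :=
  (memLp_weighted_iff hm hw _).2
    ⟨(continuousOn_val x).aestronglyMeasurable measurableSet_Ioi, (h x).1⟩

theorem ae_weighted_of_forall (hm : Measurable w) (hw : ∀ r > 0, 0 < w r) {P : ℝ → Prop}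
    (h : ∀ r > 0, P r) : ∀ᵐ r ∂(weighted w), P r := by
  change ∀ᶠ _ in _, _
  rw [ae_weighted hm hw]
  filter_upwards [ae_restrict_mem measurableSet_Ioi] with r hr using h r hr

/-- The embedding of `H₂(μ̄)` into a weighted `L²` space. -/
def embed (hmb : mb ≤ 0) (hm : Measurable w) (hw : ∀ r > 0, 0 < w r)
    (h : EmbedsWithBound mb w C) : H2 mb →L[ℂ] Lp ℂ 2 (weighted w) :=
  LinearMap.mkContinuous
    { toFun := fun x => (memLp_val hm hw h x).toLp _
      map_add' := fun x y => by
        rw [← MemLp.toLp_add, MemLp.toLp_eq_toLp_iff]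
        exact ae_weighted_of_forall hm hw fun r hr => val_add hmb hr x y
      map_smul' := fun c x => by
        rw [RingHom.id_apply, ← MemLp.toLp_const_smul, MemLp.toLp_eq_toLp_iff]
        exact ae_weighted_of_forall hm hw fun r hr => val_smul hmb hr c x }
    (Real.sqrt C) fun x => by
    have h1 : ‖(memLp_val hm hw h x).toLp _‖ ^ 2 ≤ C * ‖x‖ ^ 2 := by
      rw [normSq_weighted hm hw]
      refine le_of_eq_of_le (integral_congr_ae ?_) (h x).2
      have h2 := (memLp_val hm hw h x).coeFn_toLp
      change ∀ᶠ _ in _, _ at h2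
      rw [ae_weighted hm hw] at h2
      filter_upwards [h2] with r hr
      rw [hr]
    have h3 := Real.sqrt_le_sqrt h1
    rwa [Real.sqrt_sq (norm_nonneg _), Real.sqrt_mul' _ (sq_nonneg _),
      Real.sqrt_sq (norm_nonneg _)] at h3

theorem coeFn_embed (hmb : mb ≤ 0) (hm : Measurable w) (hw : ∀ r > 0, 0 < w r)
    (h : EmbedsWithBound mb w C) (x : H2 mb) :
    embed hmb hm hw h x =ᵐ[volume.restrict (Ioi 0)] val x := by
  have h2 := (memLp_val hm hw h x).coeFn_toLp
  change ∀ᶠ _ in _, _ at h2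
  rwa [ae_weighted hm hw] at h2

theorem inner_embed (hmb : mb ≤ 0) (hm : Measurable w) (hw : ∀ r > 0, 0 < w r)
    (h : EmbedsWithBound mb w C) (v x : H2 mb) :
    inner ℂ (embed hmb hm hw h v) (embed hmb hm hw h x)
      = ∫ r in Ioi (0 : ℝ), (w r : ℂ) * (val x r * star (val v r)) := by
  rw [inner_weighted hm hw]
  refine integral_congr_ae ?_
  filter_upwards [coeFn_embed hmb hm hw h v, coeFn_embed hmb hm hw h x] with r h1 h2
  rw [h1, h2]

theorem normSq_embed (hmb : mb ≤ 0) (hm : Measurable w) (hw : ∀ r > 0, 0 < w r)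
    (h : EmbedsWithBound mb w C) (x : H2 mb) :
    ‖embed hmb hm hw h x‖ ^ 2 = ∫ r in Ioi (0 : ℝ), w r * ‖val x r‖ ^ 2 := by
  rw [normSq_weighted hm hw]
  refine integral_congr_ae ?_
  filter_upwards [coeFn_embed hmb hm hw h x] with r h1
  rw [h1]

theorem embed_injective (hmb : mb ≤ 0) (hm : Measurable w) (hw : ∀ r > 0, 0 < w r)
    (h : EmbedsWithBound mb w C) : Function.Injective (embed hmb hm hw h) := by
  intro x y hxy
  have h1 : val x =ᵐ[volume.restrict (Ioi 0)] val y :=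
    (coeFn_embed hmb hm hw h x).symm.trans (hxy ▸ coeFn_embed hmb hm hw h y)
  have h2 := Measure.eqOn_open_of_ae_eq h1 isOpen_Ioi (continuousOn_val x) (continuousOn_val y)
  exact H2_ext_val hmb h2

theorem integrableOn_val_sq (hmb : mb ≤ 0) (x : H2 mb) :
    IntegrableOn (fun r => (-mb * r⁻¹ + r ^ 3) * ‖val x r‖ ^ 2) (Ioi (0 : ℝ)) := by
  refine (integrableOn_fn_sq hmb x).congr ?_
  filter_upwards [fn_ae_eq_val hmb x] with r hr
  rw [hr]

theorem integral_val_sq_le (hmb : mb ≤ 0) (x : H2 mb) :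
    ∫ r in Ioi (0 : ℝ), (-mb * r⁻¹ + r ^ 3) * ‖val x r‖ ^ 2 ≤ ‖x‖ ^ 2 := by
  have h1 := normSq_eq hmb x
  have h2 : ∫ r in Ioi (0 : ℝ), (-mb * r⁻¹ + r ^ 3) * ‖fn x r‖ ^ 2
      = ∫ r in Ioi (0 : ℝ), (-mb * r⁻¹ + r ^ 3) * ‖val x r‖ ^ 2 := by
    refine integral_congr_ae ?_
    filter_upwards [fn_ae_eq_val hmb x] with r hr
    rw [hr]
  have h3 : 0 ≤ ∫ r in Ioi (0 : ℝ), r * ‖dfn x r‖ ^ 2 :=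
    setIntegral_nonneg measurableSet_Ioi fun r (hr : 0 < r) => by positivity
  linarith

theorem EmbedsWithBound.of_le_const_mul (hmb : mb ≤ 0) (hm : Measurable w)
    (hw : ∀ r > 0, 0 < w r) (hC : ∀ r > 0, w r ≤ C * (-mb * r⁻¹ + r ^ 3)) :
    EmbedsWithBound mb w C := by
  intro x
  have hmeas : AEStronglyMeasurable (fun r => w r * ‖val x r‖ ^ 2) (volume.restrict (Ioi 0)) :=
    hm.aestronglyMeasurable.mul
      (((continuousOn_val x).aestronglyMeasurable measurableSet_Ioi).norm.pow 2)
  have hC0 : 0 ≤ C := by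
    have h1 := (hw 1 one_pos).le.trans (hC 1 one_pos)
    have h2 := potential_weight_pos hmb 1 one_pos
    exact nonneg_of_mul_nonneg_left h1 h2
  have hle : ∀ r ∈ Ioi (0 : ℝ), w r * ‖val x r‖ ^ 2
      ≤ C * ((-mb * r⁻¹ + r ^ 3) * ‖val x r‖ ^ 2) := fun r hr => by
    rw [← mul_assoc]
    have := hC r hr
    gcongr
  have hi : IntegrableOn (fun r => w r * ‖val x r‖ ^ 2) (Ioi 0) := by
    refine Integrable.mono' ((integrableOn_val_sq hmb x).const_mul C) hmeas ?_
    filter_upwards [ae_restrict_mem measurableSet_Ioi] with r hr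
    have := (hw r hr).le
    rw [Real.norm_of_nonneg (by positivity)]
    exact hle r hr
  refine ⟨hi, (setIntegral_mono_on hi ((integrableOn_val_sq hmb x).const_mul C)
    measurableSet_Ioi hle).trans ?_⟩
  rw [integral_const_mul]
  have := integral_val_sq_le hmb x
  gcongr

theorem rpow_weight_pos (s : ℝ) : ∀ r > (0 : ℝ), 0 < r ^ s := fun _ h => Real.rpow_pos_of_pos h s

theorem measurable_rpow_weight (s : ℝ) : Measurable fun r : ℝ => r ^ s :=
  measurable_id.pow_const s

/-- Near `0` the factor `r^s ≤ r` absorbs the `1/r` of the evaluation bound, which is where `1 ≤ s`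
enters; for `r ≥ 1` one uses `r^s ≤ r³`. -/
theorem rpow_mul_le {s r : ℝ} (hs : 1 ≤ s) (hs3 : s ≤ 3) (hr : 0 < r) :
    r ^ s * (6 * (1 + r + r⁻¹)) ≤ 18 * (1 + r ^ 4) := by
  have h0 : 0 < r⁻¹ := by positivity
  rcases le_total r 1 with h | h
  · have h1 : r ^ s ≤ r := by
      simpa using Real.rpow_le_rpow_of_exponent_ge hr h hs
    calc r ^ s * (6 * (1 + r + r⁻¹)) ≤ r * (6 * (1 + r + r⁻¹)) := by gcongr
      _ = 6 * (r + r ^ 2 + 1) := by field_simp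
      _ ≤ _ := by nlinarith [pow_nonneg hr.le 4]
  · have h1 : r ^ s ≤ r ^ 3 := by
      have := Real.rpow_le_rpow_of_exponent_le h hs3
      exact_mod_cast this
    calc r ^ s * (6 * (1 + r + r⁻¹)) ≤ r ^ 3 * (6 * (1 + r + r⁻¹)) := by gcongr
      _ ≤ r ^ 3 * (6 * (r + r + r)) := by
        have : r⁻¹ ≤ r := (inv_le_one_of_one_le₀ h).trans h
        gcongr
      _ ≤ _ := by nlinarith

theorem rpow_le_weight {s r : ℝ} (hmb : mb ≤ 0) (hs3 : s ≤ 3) (hr : 1 ≤ r) :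
    r ^ s ≤ -mb * r⁻¹ + r ^ 3 := by
  have h1 : r ^ s ≤ r ^ 3 := by
    have := Real.rpow_le_rpow_of_exponent_le hr hs3
    exact_mod_cast this
  have : 0 ≤ -mb * r⁻¹ := mul_nonneg (by linarith) (by positivity)
  linarith

/-- For `mb = 0` the norm does not control `|u|²` near `0` through its potential term, so on `(0,
1]` the pointwise bound is integrated; it contributes `36 = 18 (1 + 1)`. On `(1, ∞)` the weight
`r^s` is below that of the norm, contributing `1`. -/
theorem embedsWithBound_rpow (hmb : mb ≤ 0) {s : ℝ} (hs : 1 ≤ s) (hs3 : s ≤ 3) :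
    EmbedsWithBound mb (fun r => r ^ s) 37 := by
  intro x
  have hmeas : AEStronglyMeasurable (fun r => r ^ s * ‖val x r‖ ^ 2) (volume.restrict (Ioi 0)) :=
    (measurable_rpow_weight s).aestronglyMeasurable.mul
      (((continuousOn_val x).aestronglyMeasurable measurableSet_Ioi).norm.pow 2)
  set g : ℝ → ℝ := fun r => (Ioc (0 : ℝ) 1).indicator (fun _ => 36 * ‖x‖ ^ 2) r
    + (-mb * r⁻¹ + r ^ 3) * ‖val x r‖ ^ 2 with hg
  have hind : IntegrableOn ((Ioc (0 : ℝ) 1).indicator fun _ => 36 * ‖x‖ ^ 2) (Ioi 0) := by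
    rw [IntegrableOn, integrable_indicator_iff measurableSet_Ioc, IntegrableOn,
      Measure.restrict_restrict measurableSet_Ioc, inter_eq_left.2 Ioc_subset_Ioi_self]
    exact integrableOn_const (by simp)
  have hgi : IntegrableOn g (Ioi 0) := hind.add (integrableOn_val_sq hmb x)
  have hle : ∀ r ∈ Ioi (0 : ℝ), r ^ s * ‖val x r‖ ^ 2 ≤ g r := by
    intro r hr
    have hr0 : 0 < r := hr
    have h0 : 0 ≤ (-mb * r⁻¹ + r ^ 3) * ‖val x r‖ ^ 2 := by
      have := (potential_weight_pos hmb r hr).le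
      positivity
    have hp := (rpow_weight_pos s r hr).le
    rcases le_or_gt r 1 with h | h
    · have h1 : r ^ s * ‖val x r‖ ^ 2 ≤ 36 * ‖x‖ ^ 2 := by
        calc _ ≤ r ^ s * (6 * (1 + r + r⁻¹) * ‖x‖ ^ 2) := by
              gcongr; exact norm_val_sq_le hmb hr x
          _ = r ^ s * (6 * (1 + r + r⁻¹)) * ‖x‖ ^ 2 := by ring
          _ ≤ 18 * (1 + r ^ 4) * ‖x‖ ^ 2 :=
            mul_le_mul_of_nonneg_right (rpow_mul_le hs hs3 hr) (sq_nonneg _)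
          _ ≤ 36 * ‖x‖ ^ 2 := by
            have := pow_le_one₀ hr0.le h (n := 4)
            gcongr; linarith
      simp only [hg, indicator_of_mem (show r ∈ Ioc (0 : ℝ) 1 from ⟨hr, h⟩)]
      linarith
    · simp only [hg, indicator_of_notMem (show r ∉ Ioc (0 : ℝ) 1 from fun h' => h.not_ge h'.2),
        zero_add]
      have := rpow_le_weight hmb hs3 h.le
      gcongr
  have hi : IntegrableOn (fun r => r ^ s * ‖val x r‖ ^ 2) (Ioi 0) := by
    refine Integrable.mono' hgi hmeas ?_
    filter_upwards [ae_restrict_mem measurableSet_Ioi] with r hr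
    have := (rpow_weight_pos s r hr).le
    rw [Real.norm_of_nonneg (by positivity)]
    exact hle r hr
  refine ⟨hi, (setIntegral_mono_on hi hgi measurableSet_Ioi hle).trans ?_⟩
  rw [hg, integral_add hind (integrableOn_val_sq hmb x), integral_indicator measurableSet_Ioc,
    Measure.restrict_restrict measurableSet_Ioc, inter_eq_left.2 Ioc_subset_Ioi_self]
  have := integral_val_sq_le hmb x
  rw [setIntegral_const]
  simp only [measureReal_def, Real.volume_Ioc, sub_zero, ENNReal.toReal_ofReal zero_le_one, one_smul]
  linarith

/-- The embedding of `H₂(μ̄)` into `L²(I,s)` for `1 ≤ s ≤ 3`. -/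
def embedPow (hmb : mb ≤ 0) {s : ℝ} (hs : 1 ≤ s) (hs3 : s ≤ 3) : H2 mb →L[ℂ] L2 s :=
  embed hmb (measurable_rpow_weight s) (rpow_weight_pos s) (embedsWithBound_rpow hmb hs hs3)

/-- Truncations `r ↦ E r` of a family of functionals to `(0,R)`. -/
def truncate {H : Type*} [NormedAddCommGroup H] [NormedSpace ℂ H] (E : ℝ → StrongDual ℂ H)
    (R : ℝ) : ℝ → StrongDual ℂ H := (Ioo 0 R).indicator E

/-! ### Compactness of maps given by point evaluations -/

section Truncation

variable {H : Type*} [NormedAddCommGroup H] [NormedSpace ℂ H] {E : ℝ → StrongDual ℂ H}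

/-- The estimate is uniform in `x`, so the evaluations are continuous in the norm of the dual; this
makes them strongly measurable, hence usable as a kernel. -/
theorem continuousOn_of_norm_sub_sq_le
    (hlog : ∀ a b, 0 < a → 0 < b → ∀ x, ‖E b x - E a x‖ ^ 2 ≤ |Real.log (b / a)| * ‖x‖ ^ 2) :
    ContinuousOn E (Ioi 0) := by
  intro a ha
  refine ContinuousAt.continuousWithinAt ?_
  rw [ContinuousAt, tendsto_iff_norm_sub_tendsto_zero]
  have h0 : Tendsto (fun b => Real.sqrt |Real.log (b / a)|) (𝓝 a) (𝓝 0) := by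
    have ha' : a ≠ 0 := (mem_Ioi.1 ha).ne'
    have : ContinuousAt (fun b => Real.sqrt |Real.log (b / a)|) a := by
      have h1 : ContinuousAt (fun b => Real.log (b / a)) a :=
        ContinuousAt.log (by fun_prop) (by rw [div_self ha']; norm_num)
      exact h1.abs.sqrt
    simpa [ContinuousAt, div_self ha'] using this
  refine squeeze_zero' (Eventually.of_forall fun _ => norm_nonneg _) ?_ h0
  filter_upwards [Ioi_mem_nhds (mem_Ioi.1 ha)] with b hb
  refine ContinuousLinearMap.opNorm_le_bound _ (Real.sqrt_nonneg _) fun x => ?_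
  have h := Real.sqrt_le_sqrt (hlog a b ha hb x)
  rwa [Real.sqrt_sq (norm_nonneg _), Real.sqrt_mul (abs_nonneg _),
    Real.sqrt_sq (norm_nonneg _)] at h

theorem norm_sq_le_of_norm_apply_sq_le {D : ℝ} (hD : 0 ≤ D) {f : StrongDual ℂ H}
    (h : ∀ x, ‖f x‖ ^ 2 ≤ D * ‖x‖ ^ 2) : ‖f‖ ^ 2 ≤ D := by
  have h1 : ‖f‖ ≤ Real.sqrt D := by
    refine ContinuousLinearMap.opNorm_le_bound _ (Real.sqrt_nonneg _) fun x => ?_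
    have h := Real.sqrt_le_sqrt (h x)
    rwa [Real.sqrt_sq (norm_nonneg _), Real.sqrt_mul hD, Real.sqrt_sq (norm_nonneg _)] at h
  have h2 := pow_le_pow_left₀ (norm_nonneg _) h1 2
  rwa [Real.sq_sqrt hD] at h2

variable {s : ℝ}

/-- On `(0, R)` the quantity `r^s ‖E r‖²` is bounded by `rpow_mul_le`, so the truncated kernel is
square integrable and its operator compact. -/
theorem memLp_truncate (hs : 1 ≤ s) (hs3 : s ≤ 3)
    (hlog : ∀ a b, 0 < a → 0 < b → ∀ x, ‖E b x - E a x‖ ^ 2 ≤ |Real.log (b / a)| * ‖x‖ ^ 2)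
    (hbound : ∀ t > 0, ∀ x, ‖E t x‖ ^ 2 ≤ 6 * (1 + t + t⁻¹) * ‖x‖ ^ 2) (R : ℝ) :
    MemLp (truncate E R) 2 (weighted fun r => r ^ s) := by
  have hmeas : AEStronglyMeasurable (truncate E R) (volume.restrict (Ioi 0)) := by
    rw [truncate, aestronglyMeasurable_indicator_iff measurableSet_Ioo,
      Measure.restrict_restrict measurableSet_Ioo, inter_eq_left.2 Ioo_subset_Ioi_self]
    exact ((continuousOn_of_norm_sub_sq_le hlog).mono Ioo_subset_Ioi_self).aestronglyMeasurable
      measurableSet_Ioo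
  rw [memLp_weighted_iff (measurable_rpow_weight s) (rpow_weight_pos s)]
  refine ⟨hmeas, ?_⟩
  refine Integrable.mono' (g := (Ioo 0 R).indicator fun _ => 18 * (1 + R ^ 4)) ?_
    ((measurable_rpow_weight s).aestronglyMeasurable.mul (hmeas.norm.pow 2)) ?_
  · rw [integrable_indicator_iff measurableSet_Ioo, IntegrableOn,
      Measure.restrict_restrict measurableSet_Ioo, inter_eq_left.2 Ioo_subset_Ioi_self]
    exact integrableOn_const (by simp)
  · filter_upwards [ae_restrict_mem measurableSet_Ioi] with r hr
    have h0 := (rpow_weight_pos s r hr).le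
    have hr0 : 0 < r := hr
    rw [Real.norm_of_nonneg (by positivity)]
    by_cases h : r ∈ Ioo 0 R
    · rw [indicator_of_mem h, truncate, indicator_of_mem h]
      have h1 : r ^ 4 ≤ R ^ 4 := pow_le_pow_left₀ h.1.le h.2.le 4
      calc _ ≤ r ^ s * (6 * (1 + r + r⁻¹)) :=
            mul_le_mul_of_nonneg_left
              (norm_sq_le_of_norm_apply_sq_le (by positivity) (hbound r hr)) h0
        _ ≤ 18 * (1 + r ^ 4) := rpow_mul_le hs hs3 hr
        _ ≤ _ := by linarith
    · rw [indicator_of_notMem h, truncate, indicator_of_notMem h]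
      simp

/-- A map into `L²(I,s)` given by Hölder continuous point evaluations is compact, if there is a
little decay at infinity to spare. -/
theorem isCompactOperator_of_evaluations (hs : 1 ≤ s) (hs3 : s < 3)
    (hlog : ∀ a b, 0 < a → 0 < b → ∀ x, ‖E b x - E a x‖ ^ 2 ≤ |Real.log (b / a)| * ‖x‖ ^ 2)
    (hbound : ∀ t > 0, ∀ x, ‖E t x‖ ^ 2 ≤ 6 * (1 + t + t⁻¹) * ‖x‖ ^ 2)
    (hi : ∀ x, IntegrableOn (fun r => r ^ 3 * ‖E r x‖ ^ 2) (Ioi 0))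
    (hle : ∀ x, ∫ r in Ioi (0 : ℝ), r ^ 3 * ‖E r x‖ ^ 2 ≤ ‖x‖ ^ 2)
    (J : H →L[ℂ] L2 s) (hJ : ∀ x, ∀ᵐ r ∂(volume.restrict (Ioi (0 : ℝ))), J x r = E r x) :
    IsCompactOperator J := by
  have hmem := memLp_truncate hs hs3.le hlog hbound
  -- The error lives on `r ≥ R`, where `r^s = r^(s-3) r³ ≤ R^(s-3) r³`. It tends to zero in operator
  -- norm because `s < 3`.
  have hnorm : ∀ R : ℝ, 1 ≤ R → ‖J - kernelOperator (hmem R).toLp‖ ≤ Real.sqrt (R ^ (s - 3)) := by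
    intro R hR
    refine ContinuousLinearMap.opNorm_le_bound _ (Real.sqrt_nonneg _) fun x => ?_
    have hR0 : 0 < R := by linarith
    have hp : 0 < R ^ (s - 3) := Real.rpow_pos_of_pos hR0 _
    have key : ‖(J - kernelOperator (hmem R).toLp) x‖ ^ 2 ≤ R ^ (s - 3) * ‖x‖ ^ 2 := by
      rw [normSq_weighted (measurable_rpow_weight s) (rpow_weight_pos s)]
      set k := (hmem R).toLp with hk
      have h1 : ∀ᵐ r ∂(volume.restrict (Ioi (0 : ℝ))), (J - kernelOperator k) x r
          = E r x - truncate E R r x := by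
        have h2 := Lp.coeFn_sub (J x) (kernelOperator k x)
        have h3 := coeFn_kernelOperator k x
        have h4 := (hmem R).coeFn_toLp
        change ∀ᶠ _ in _, _ at h2 h3 h4
        rw [ae_weighted (measurable_rpow_weight s) (rpow_weight_pos s)] at h2 h3 h4
        filter_upwards [h2, h3, h4, hJ x] with r h2 h3 h4 h5
        rw [sub_apply, h2, Pi.sub_apply, h3, h4, h5]
      have h6 : ∀ᵐ r ∂(volume.restrict (Ioi (0 : ℝ))),
          r ^ s * ‖(J - kernelOperator k) x r‖ ^ 2 ≤ R ^ (s - 3) * (r ^ 3 * ‖E r x‖ ^ 2) := by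
        filter_upwards [h1, ae_restrict_mem measurableSet_Ioi] with r h1 hr
        have hr0 : 0 < r := hr
        rw [h1, truncate]
        by_cases h : r ∈ Ioo 0 R
        · rw [indicator_of_mem h, sub_self]
          simp only [norm_zero, ne_eq, OfNat.ofNat_ne_zero, not_false_eq_true, zero_pow, mul_zero]
          positivity
        · have hrR : R ≤ r := not_lt.1 fun h' => h ⟨hr, h'⟩
          rw [indicator_of_notMem h, zero_apply, sub_zero, ← mul_assoc]
          gcongr
          have h7 : r ^ s = r ^ (s - 3) * r ^ 3 := by
            rw [← Real.rpow_natCast r 3, ← Real.rpow_add hr0]; norm_num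
          have h8 : r ^ (s - 3) ≤ R ^ (s - 3) :=
            Real.rpow_le_rpow_of_nonpos hR0 hrR (by linarith)
          rw [h7]
          gcongr
      calc _ ≤ ∫ r in Ioi (0 : ℝ), R ^ (s - 3) * (r ^ 3 * ‖E r x‖ ^ 2) :=
            integral_mono_ae (integrableOn_normSq (measurable_rpow_weight s) (rpow_weight_pos s) _)
              ((hi x).const_mul _) h6
        _ ≤ _ := by
          rw [integral_const_mul]
          have := hle x
          gcongr
    have h := Real.sqrt_le_sqrt key
    rwa [Real.sqrt_sq (norm_nonneg _), Real.sqrt_mul hp.le, Real.sqrt_sq (norm_nonneg _)] at h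
  refine isCompactOperator_of_tendsto (l := atTop)
    (F := fun R : ℝ => kernelOperator (hmem R).toLp) ?_
    (Eventually.of_forall fun R => isCompactOperator_kernelOperator _)
  rw [tendsto_iff_norm_sub_tendsto_zero]
  have h0 : Tendsto (fun R : ℝ => Real.sqrt (R ^ (s - 3))) atTop (𝓝 0) := by
    have h1 := tendsto_rpow_neg_atTop (y := 3 - s) (by linarith)
    simpa using (h1.congr fun R => by rw [neg_sub]).sqrt
  refine squeeze_zero' (Eventually.of_forall fun _ => norm_nonneg _) ?_ h0
  filter_upwards [eventually_ge_atTop 1] with R hR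
  rw [norm_sub_rev]
  exact hnorm R hR

end Truncation

/-- The point evaluations, extended by zero. -/
def evaluation (hmb : mb ≤ 0) (r : ℝ) : StrongDual ℂ (H2 mb) :=
  if h : 0 < r then evalCLM hmb h else 0

theorem evaluation_apply (hmb : mb ≤ 0) {r : ℝ} (hr : 0 < r) (x : H2 mb) :
    evaluation hmb r x = val x r := by
  rw [evaluation, dif_pos hr]; rfl

theorem integrableOn_pow_three_val_sq (hmb : mb ≤ 0) (x : H2 mb) :
    IntegrableOn (fun r => r ^ 3 * ‖val x r‖ ^ 2) (Ioi (0 : ℝ)) := by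
  have := (embedsWithBound_rpow hmb (s := 3) (by norm_num) le_rfl x).1
  exact_mod_cast this

theorem integral_pow_three_val_sq_le (hmb : mb ≤ 0) (x : H2 mb) :
    ∫ r in Ioi (0 : ℝ), r ^ 3 * ‖val x r‖ ^ 2 ≤ ‖x‖ ^ 2 := by
  refine (setIntegral_mono_on (integrableOn_pow_three_val_sq hmb x) (integrableOn_val_sq hmb x)
    measurableSet_Ioi fun r hr => ?_).trans (integral_val_sq_le hmb x)
  have : 0 ≤ -mb * r⁻¹ := mul_nonneg (by linarith) (inv_nonneg.2 (mem_Ioi.1 hr).le)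
  gcongr
  linarith

theorem isCompactOperator_embedPow (hmb : mb ≤ 0) {s : ℝ} (hs : 1 ≤ s) (hs3 : s < 3) :
    IsCompactOperator (embedPow hmb hs hs3.le) := by
  refine isCompactOperator_of_evaluations (E := evaluation hmb) hs hs3 ?_ ?_ ?_ ?_ _ ?_
  · intro a b ha hb x
    rw [evaluation_apply hmb ha, evaluation_apply hmb hb]
    exact norm_val_sub_sq_le ha hb x
  · intro t ht x
    rw [evaluation_apply hmb ht]
    exact norm_val_sq_le hmb ht x
  · intro x
    refine (integrableOn_pow_three_val_sq hmb x).congr_fun (fun r hr => ?_) measurableSet_Ioi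
    simp only [evaluation_apply hmb hr]
  · intro x
    refine le_of_eq_of_le (setIntegral_congr_fun measurableSet_Ioi fun r hr => ?_)
      (integral_pow_three_val_sq_le hmb x)
    simp only [evaluation_apply hmb hr]
  · intro x
    filter_upwards [coeFn_embed hmb (measurable_rpow_weight s) (rpow_weight_pos s)
        (embedsWithBound_rpow hmb hs hs3.le) x, ae_restrict_mem measurableSet_Ioi] with r h hr
    rw [evaluation_apply hmb hr]
    exact h

end Embedding

/-! ### The energy embedding -/

section Energy

variable {mb c : ℝ}

theorem energy_weight_pos (hmb : mb ≤ 0) (hc : 0 < c) : ∀ r > 0, 0 < -mb * r⁻¹ + c * r ^ 3 := by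
  intro r hr
  have : 0 ≤ -mb * r⁻¹ := mul_nonneg (by linarith) (by positivity)
  positivity

theorem measurable_energy_weight (mb c : ℝ) : Measurable fun r : ℝ => -mb * r⁻¹ + c * r ^ 3 := by
  fun_prop

theorem embedsWithBound_energy (hmb : mb ≤ 0) (hc : 0 < c) :
    EmbedsWithBound mb (fun r => -mb * r⁻¹ + c * r ^ 3) (1 + c) := by
  refine EmbedsWithBound.of_le_const_mul hmb (measurable_energy_weight mb c)
    (energy_weight_pos hmb hc) fun r hr => ?_
  have : 0 ≤ -mb * r⁻¹ := mul_nonneg (by linarith) (by positivity)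
  nlinarith [mul_nonneg hc.le this, pow_pos hr 3]

/-- The space carrying the energy scalar product with the coefficient `c`. -/
abbrev EnergySpace (mb c : ℝ) : Type :=
  WithLp 2 (Lp ℂ 2 (weighted fun r => r) × Lp ℂ 2 (weighted fun r => -mb * r⁻¹ + c * r ^ 3))

/-- The pair of two continuous linear maps, as a map into the Hilbert product. -/
def hilbertPair {H A B : Type*} [NormedAddCommGroup H] [NormedSpace ℂ H] [NormedAddCommGroup A]
    [InnerProductSpace ℂ A] [NormedAddCommGroup B] [InnerProductSpace ℂ B]
    (f : H →L[ℂ] A) (g : H →L[ℂ] B) : H →L[ℂ] WithLp 2 (A × B) :=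
  (WithLp.prodContinuousLinearEquiv 2 ℂ A B).symm.toContinuousLinearMap.comp (f.prod g)

section HilbertPair

variable {H A B : Type*} [NormedAddCommGroup H] [NormedSpace ℂ H] [NormedAddCommGroup A]
    [InnerProductSpace ℂ A] [NormedAddCommGroup B] [InnerProductSpace ℂ B]
    (f : H →L[ℂ] A) (g : H →L[ℂ] B)

theorem inner_hilbertPair (v x : H) :
    inner ℂ (hilbertPair f g v) (hilbertPair f g x) = inner ℂ (f v) (f x) + inner ℂ (g v) (g x) :=
  rfl

theorem normSq_hilbertPair (x : H) : ‖hilbertPair f g x‖ ^ 2 = ‖f x‖ ^ 2 + ‖g x‖ ^ 2 :=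
  WithLp.prod_norm_sq_eq_of_L2 _

end HilbertPair

/-- The weak derivative as a continuous linear map. -/
def derivCLM (mb : ℝ) : H2 mb →L[ℂ] Lp ℂ 2 (weighted fun r => r) :=
  (WithLp.fstL 2 ℂ _ _).comp (H2 mb).subtypeL

/-- The embedding of `H₂(μ̄)` into `L²` with the weight of the energy scalar product. -/
def energyEmbed (hmb : mb ≤ 0) (hc : 0 < c) :
    H2 mb →L[ℂ] Lp ℂ 2 (weighted fun r => -mb * r⁻¹ + c * r ^ 3) :=
  embed hmb (measurable_energy_weight mb c) (energy_weight_pos hmb hc)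
    (embedsWithBound_energy hmb hc)

/-- The map from `H₂(μ̄)` whose pulled back scalar product is
`∫ r u' v̄' - μ̄ ∫ r⁻¹ u v̄ + c ∫ r³ u v̄`. -/
def energyMap (hmb : mb ≤ 0) (hc : 0 < c) : H2 mb →L[ℂ] EnergySpace mb c :=
  hilbertPair (derivCLM mb) (energyEmbed hmb hc)

theorem inner_derivCLM (v x : H2 mb) : inner ℂ (derivCLM mb v) (derivCLM mb x)
    = ∫ r in Ioi (0 : ℝ), (r : ℂ) * (dfn x r * star (dfn v r)) :=
  inner_weighted (w := fun r => r) measurable_id id_weight_pos _ _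

theorem normSq_derivCLM (x : H2 mb) :
    ‖derivCLM mb x‖ ^ 2 = ∫ r in Ioi (0 : ℝ), r * ‖dfn x r‖ ^ 2 :=
  normSq_weighted (w := fun r => r) measurable_id id_weight_pos _

theorem inner_energyMap (hmb : mb ≤ 0) (hc : 0 < c) (v x : H2 mb) :
    inner ℂ (energyMap hmb hc v) (energyMap hmb hc x)
      = (∫ r in Ioi (0 : ℝ), (r : ℂ) * (dfn x r * star (dfn v r))) +
        ∫ r in Ioi (0 : ℝ), ((-mb * r⁻¹ + c * r ^ 3 : ℝ) : ℂ) * (val x r * star (val v r)) := by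
  have h1 := inner_derivCLM v x
  have h2 := inner_embed hmb (measurable_energy_weight mb c) (energy_weight_pos hmb hc)
    (embedsWithBound_energy hmb hc) v x
  rw [← h1, ← h2, energyMap, inner_hilbertPair, energyEmbed]

theorem normSq_energyMap (hmb : mb ≤ 0) (hc : 0 < c) (x : H2 mb) :
    ‖energyMap hmb hc x‖ ^ 2 = (∫ r in Ioi (0 : ℝ), r * ‖dfn x r‖ ^ 2) +
        ∫ r in Ioi (0 : ℝ), (-mb * r⁻¹ + c * r ^ 3) * ‖val x r‖ ^ 2 := by
  have h1 := normSq_derivCLM x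
  have h2 := normSq_embed hmb (measurable_energy_weight mb c) (energy_weight_pos hmb hc)
    (embedsWithBound_energy hmb hc) x
  rw [← h1, ← h2, energyMap, normSq_hilbertPair, energyEmbed]

/-- Coercivity of the energy. The cubic coefficient `(1 + 1/c) c = 1 + c` is at least `1`, and the
other terms are only enlarged. -/
theorem norm_le_energyMap (hmb : mb ≤ 0) (hc : 0 < c) (x : H2 mb) :
    ‖x‖ ^ 2 ≤ (1 + c⁻¹) * ‖energyMap hmb hc x‖ ^ 2 := by
  have h1 := normSq_eq hmb x
  have h2 : ∫ r in Ioi (0 : ℝ), (-mb * r⁻¹ + r ^ 3) * ‖fn x r‖ ^ 2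
      = ∫ r in Ioi (0 : ℝ), (-mb * r⁻¹ + r ^ 3) * ‖val x r‖ ^ 2 := by
    refine integral_congr_ae ?_
    filter_upwards [fn_ae_eq_val hmb x] with r hr
    rw [hr]
  have h3 : 0 ≤ ∫ r in Ioi (0 : ℝ), r * ‖dfn x r‖ ^ 2 :=
    setIntegral_nonneg measurableSet_Ioi fun r (hr : 0 < r) => by positivity
  have h4 : ∫ r in Ioi (0 : ℝ), (-mb * r⁻¹ + r ^ 3) * ‖val x r‖ ^ 2
      ≤ (1 + c⁻¹) * ∫ r in Ioi (0 : ℝ), (-mb * r⁻¹ + c * r ^ 3) * ‖val x r‖ ^ 2 := by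
    rw [← integral_const_mul]
    refine setIntegral_mono_on (integrableOn_val_sq hmb x)
      ((embedsWithBound_energy hmb hc x).1.const_mul _) measurableSet_Ioi fun r hr => ?_
    rw [← mul_assoc]
    gcongr
    have hr0 : 0 < r := hr
    have h5 : 0 ≤ -mb * r⁻¹ := mul_nonneg (by linarith) (by positivity)
    have h6 : (1 + c⁻¹) * (-mb * r⁻¹ + c * r ^ 3)
        = -mb * r⁻¹ + r ^ 3 + (c⁻¹ * (-mb * r⁻¹) + c * r ^ 3) := by field_simp; ring
    rw [h6]
    have : 0 ≤ c⁻¹ * (-mb * r⁻¹) + c * r ^ 3 := by positivity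
    linarith
  rw [normSq_energyMap, h1, h2]
  have : 0 < c⁻¹ := by positivity
  nlinarith

end Energy

/-! ### The lemma of du Bois-Reymond on the half line -/

section DuBoisReymond

theorem tsupport_deriv_subset_tsupport (g : ℝ → ℝ) : tsupport (deriv g) ⊆ tsupport g :=
  closure_minimal support_deriv_subset (isClosed_tsupport _)

theorem exists_Ioo_of_isCompact {K : Set ℝ} (hK : IsCompact K) (h0 : K ⊆ Ioi 0) :
    ∃ a b : ℝ, 0 < a ∧ a < b ∧ K ⊆ Ioo a b := by
  rcases K.eq_empty_or_nonempty with rfl | hne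
  · exact ⟨1, 2, one_pos, one_lt_two, empty_subset _⟩
  · obtain ⟨a, ha, ha'⟩ := hK.exists_isLeast hne
    obtain ⟨b, hb, hb'⟩ := hK.exists_isGreatest hne
    have h1 : 0 < a := h0 ha
    have h2 : a ≤ b := ha' hb
    exact ⟨a / 2, b + 1, by positivity, by linarith, fun r hr =>
      ⟨by linarith [ha' hr], by linarith [hb' hr]⟩⟩

theorem integral_eq_interval_of_tsupport {E : Type*} [NormedAddCommGroup E] [NormedSpace ℝ E]
    {f : ℝ → E} {a b : ℝ} (hf : ∀ r ∉ Ioo a b, f r = 0) :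
    ∫ r, f r = ∫ r in a..b, f r := by
  refine (intervalIntegral.integral_eq_integral_of_support_subset fun r hr => ?_).symm
  by_contra h
  exact hr (hf r fun h' => h (Ioo_subset_Ioc_self h'))

theorem contDiff_primitive {g : ℝ → ℝ} (hg : ContDiff ℝ ∞ g) (a : ℝ) :
    ContDiff ℝ ∞ (fun t => ∫ r in a..t, g r) ∧ deriv (fun t => ∫ r in a..t, g r) = g := by
  have hd : deriv (fun t => ∫ r in a..t, g r) = g :=
    funext fun t => hg.continuous.deriv_integral _ _ _
  refine ⟨contDiff_infty_iff_deriv.2 ⟨fun t => ?_, by rw [hd]; exact hg⟩, hd⟩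
  exact (hg.continuous.integral_hasStrictDerivAt a t).hasDerivAt.differentiableAt

theorem integrable_smul_of_tsupport {h : ℝ → ℂ}
    (hh : ∀ a b : ℝ, 0 < a → 0 < b → IntervalIntegrable h volume a b) {g : ℝ → ℝ}
    (hg : Continuous g) (hc : HasCompactSupport g) (hs : tsupport g ⊆ Ioi 0) :
    Integrable fun r => g r • h r := by
  obtain ⟨a, b, ha, hab, hK⟩ := exists_Ioo_of_isCompact hc hs
  have h1 : IntegrableOn (fun r => g r • h r) (Icc a b) :=
    (((intervalIntegrable_iff_integrableOn_Icc_of_le hab.le).1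
      (hh a b ha (ha.trans hab)))).continuousOn_smul hg.continuousOn isCompact_Icc
  rw [← integrableOn_iff_integrable_of_support_subset (s := Icc a b)]
  · exact h1
  · intro r hr
    have : r ∈ Function.support g := fun h => hr (by simp [h])
    exact Ioo_subset_Icc_self (hK (subset_tsupport g this))

theorem locallyIntegrableOn_of_intervalIntegrable {h : ℝ → ℂ}
    (hh : ∀ a b : ℝ, 0 < a → 0 < b → IntervalIntegrable h volume a b) :
    LocallyIntegrableOn h (Ioi 0) := by
  rw [locallyIntegrableOn_iff isOpen_Ioi.isLocallyClosed]
  intro K hK hKc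
  obtain ⟨a, b, ha, hab, hK⟩ := exists_Ioo_of_isCompact hKc hK
  exact ((intervalIntegrable_iff_integrableOn_Icc_of_le hab.le).1
      (hh a b ha (ha.trans hab))).mono_set (hK.trans Ioo_subset_Icc_self)

/-- A function on the half line with vanishing weak derivative is constant. -/
theorem exists_ae_eq_const_of_weak_deriv_eq_zero {h : ℝ → ℂ}
    (hh : ∀ a b : ℝ, 0 < a → 0 < b → IntervalIntegrable h volume a b)
    (hz : ∀ g : ℝ → ℝ, ContDiff ℝ ∞ g → HasCompactSupport g → tsupport g ⊆ Ioi 0 →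
      ∫ r, deriv g r • h r = 0) :
    ∃ c : ℂ, ∀ᵐ r ∂(volume.restrict (Ioi (0 : ℝ))), h r = c := by
  -- A bump of integral one, supported in the half line, picks out the constant as `∫ θ h`.
  let β : ContDiffBump (1 : ℝ) := ⟨1 / 4, 1 / 2, by norm_num, by norm_num⟩
  set θ : ℝ → ℝ := β.normed volume with hθ
  have hθs : ContDiff ℝ ∞ θ := β.contDiff_normed
  have hθc : HasCompactSupport θ := β.hasCompactSupport_normed
  have hθ0 : tsupport θ ⊆ Ioi 0 := by
    rw [hθ, β.tsupport_normed_eq]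
    intro r hr
    have h2 : |r - 1| ≤ 1 / 2 := by rw [← Real.dist_eq]; exact hr
    have := (abs_le.1 h2).1
    simp only [mem_Ioi]; linarith
  have hθ1 : ∫ r, θ r = 1 := β.integral_normed
  set c : ℂ := ∫ r, θ r • h r with hcdef
  refine ⟨c, ?_⟩
  have hh' : ∀ a b : ℝ, 0 < a → 0 < b → IntervalIntegrable (fun r => h r - c) volume a b :=
    fun a b ha hb => (hh a b ha hb).sub intervalIntegrable_const
  have key := isOpen_Ioi.ae_eq_zero_of_integral_contDiff_smul_eq_zero
    (locallyIntegrableOn_of_intervalIntegrable hh') (fun ψ hψ hψc hψ0 => ?_)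
  · rw [ae_restrict_iff' measurableSet_Ioi]
    filter_upwards [key] with r hr h0
    exact sub_eq_zero.1 (hr h0)
  have hψi : Integrable ψ := hψ.continuous.integrable_of_hasCompactSupport hψc
  have hθi : Integrable θ := hθs.continuous.integrable_of_hasCompactSupport hθc
  set I : ℝ := ∫ r, ψ r with hI
  -- Subtracting a multiple of `θ` makes the mean zero, so that the primitive vanishes to the right
  -- of the support and is itself an admissible test function.
  set χ : ℝ → ℝ := fun r => ψ r - I * θ r with hχ
  have hχs : ContDiff ℝ ∞ χ := hψ.sub (contDiff_const.mul hθs)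
  have hχ1 : ∫ r, χ r = 0 := by
    rw [hχ, integral_sub hψi (hθi.const_mul I), integral_const_mul, hθ1]; simp [hI]
  obtain ⟨a, b, ha, hab, hK⟩ := exists_Ioo_of_isCompact (hψc.isCompact.union hθc.isCompact)
    (union_subset hψ0 hθ0)
  have hχ0 : ∀ r ∉ Ioo a b, χ r = 0 := by
    intro r hr
    have h1 : r ∉ tsupport ψ := fun h' => hr (hK (Or.inl h'))
    have h2 : r ∉ tsupport θ := fun h' => hr (hK (Or.inr h'))
    simp [hχ, image_eq_zero_of_notMem_tsupport h1, image_eq_zero_of_notMem_tsupport h2]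
  obtain ⟨hΨs, hΨd⟩ := contDiff_primitive hχs 0
  set Ψ : ℝ → ℝ := fun t => ∫ r in (0 : ℝ)..t, χ r with hΨ
  have hΨ0 : ∀ t ∉ Icc a b, Ψ t = 0 := by
    intro t ht
    rcases lt_or_ge t a with hta | hta
    · refine intervalIntegral.integral_zero_ae (ae_of_all _ fun r hr => hχ0 r fun h' => ?_)
      have := hr.2.trans (max_le ha.le hta.le)
      linarith [h'.1]
    · have htb : b < t := not_le.1 fun h' => ht ⟨hta, h'⟩
      rw [← hχ1]
      refine intervalIntegral.integral_eq_integral_of_support_subset fun r hr => ?_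
      have hr' : r ∈ Ioo a b := by
        by_contra h'
        exact hr (hχ0 r h')
      exact ⟨ha.trans hr'.1, hr'.2.le.trans htb.le⟩
  have hΨt : tsupport Ψ ⊆ Icc a b := closure_minimal (fun t ht => by
    by_contra h'
    exact ht (hΨ0 t h')) isClosed_Icc
  have h1 := hz Ψ hΨs (isCompact_Icc.of_isClosed_subset (isClosed_tsupport _) hΨt)
    (hΨt.trans fun t ht => ha.trans_le ht.1)
  rw [hΨd] at h1
  have hi1 := integrable_smul_of_tsupport hh hψ.continuous hψc hψ0
  have hi2 := integrable_smul_of_tsupport hh hθs.continuous hθc hθ0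
  have h2 : ∫ r, χ r • h r = (∫ r, ψ r • h r) - I • c := by
    rw [hcdef, ← integral_smul]
    refine Eq.trans ?_ (integral_sub hi1 (hi2.smul I))
    refine integral_congr_ae (ae_of_all _ fun r => ?_)
    simp only [hχ, sub_smul, mul_smul]
  have h3 : ∫ r, ψ r • (h r - c) = (∫ r, ψ r • h r) - I • c := by
    rw [hI, ← integral_smul_const, ← integral_sub hi1 (hψi.smul_const c)]
    simp only [smul_sub]
  rw [h3, ← h2, h1]

end DuBoisReymond

/-! ### Weak solutions -/

section WeakSolution

variable {mb c d s : ℝ}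

/-- `x` is a weak solution of `-(r x')' - μ̄ r⁻¹ x + c r³ x = d r^s x`. -/
def IsWeakSolution (c d s : ℝ) (x : H2 mb) : Prop :=
  ∀ v : H2 mb, (∫ r in Ioi (0 : ℝ), (r : ℂ) * (dfn x r * star (dfn v r))) +
      (∫ r in Ioi (0 : ℝ), ((-mb * r⁻¹ + c * r ^ 3 : ℝ) : ℂ) * (val x r * star (val v r)))
    = d * ∫ r in Ioi (0 : ℝ), ((r ^ s : ℝ) : ℂ) * (val x r * star (val v r))

theorem isWeakSolution_iff_inner (hmb : mb ≤ 0) (hc : 0 < c) (hs : 1 ≤ s) (hs3 : s ≤ 3)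
    (x : H2 mb) :
    IsWeakSolution c d s x ↔ ∀ v, inner ℂ (energyMap hmb hc v) (energyMap hmb hc x)
      = d * inner ℂ (embedPow hmb hs hs3 v) (embedPow hmb hs hs3 x) := by
  refine forall_congr' fun v => ?_
  rw [inner_energyMap, embedPow, inner_embed]

/-- The coefficient of the second order equation. -/
def coefficient (mb c d s r : ℝ) : ℝ := -mb * r⁻¹ + c * r ^ 3 - d * r ^ s

/-- `u` is a solution of `(r u')' = (-μ̄ r⁻¹ + c r³ - d r^s) u` in `(0,∞)`, with derivative `F`. -/
def IsODESolution (mb c d s : ℝ) (u F : ℝ → ℂ) : Prop :=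
  (∀ r > 0, HasDerivAt u (F r) r) ∧
    ∀ r > 0, HasDerivAt (fun r : ℝ => (r : ℂ) * F r) ((coefficient mb c d s r : ℂ) * u r) r

theorem contDiffOn_coefficient (mb c d s : ℝ) : ContDiffOn ℝ ∞ (coefficient mb c d s) (Ioi 0) := by
  unfold coefficient
  have h : ∀ r ∈ Ioi (0 : ℝ), r ≠ 0 := fun r hr => (mem_Ioi.1 hr).ne'
  refine ContDiffOn.sub (ContDiffOn.add ?_ (by fun_prop)) ?_
  · exact contDiffOn_const.mul (contDiffOn_id.inv h)
  · exact contDiffOn_const.mul (contDiffOn_id.rpow_const_of_ne h)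

/-- A real test function on the half line, as a complex one. -/
def realTest {g : ℝ → ℝ} (hg : ContDiff ℝ ∞ g) (hc : HasCompactSupport g)
    (hs : tsupport g ⊆ Ioi 0) : 𝓓(halfLine, ℂ) where
  toFun := fun r => (g r : ℂ)
  contDiff' := Complex.ofRealCLM.contDiff.comp hg
  hasCompactSupport' := hc.comp_left (g := fun r : ℝ => (r : ℂ)) Complex.ofReal_zero
  tsupport_subset' := by
    refine (closure_mono ?_).trans hs
    intro r hr h'
    exact hr (by simp [h'])

theorem realTest_apply {g : ℝ → ℝ} (hg : ContDiff ℝ ∞ g) (hc : HasCompactSupport g)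
    (hs : tsupport g ⊆ Ioi 0) (r : ℝ) : realTest hg hc hs r = g r := rfl

theorem deriv_realTest {g : ℝ → ℝ} (hg : ContDiff ℝ ∞ g) (hc : HasCompactSupport g)
    (hs : tsupport g ⊆ Ioi 0) (r : ℝ) : deriv (realTest hg hc hs) r = deriv g r :=
  (hg.differentiable (by simp) r).hasDerivAt.ofReal_comp.deriv

theorem setIntegral_Ioi_eq_integral {E : Type*} [NormedAddCommGroup E] [NormedSpace ℝ E]
    {f : ℝ → E} (hf : ∀ r ∉ Ioi (0 : ℝ), f r = 0) : ∫ r in Ioi (0 : ℝ), f r = ∫ r, f r :=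
  setIntegral_eq_integral_of_forall_compl_eq_zero hf

theorem intervalIntegrable_of_continuousOn {h : ℝ → ℂ} (hh : ContinuousOn h (Ioi 0)) (a b : ℝ)
    (ha : 0 < a) (hb : 0 < b) : IntervalIntegrable h volume a b :=
  (hh.mono fun _ hr => (lt_min ha hb).trans_le hr.1).intervalIntegrable

/-- The weak equation, tested with real test functions. -/
theorem IsWeakSolution.integral_test (hmb : mb ≤ 0) {x : H2 mb} (hx : IsWeakSolution c d s x)
    {g : ℝ → ℝ} (hg : ContDiff ℝ ∞ g) (hc : HasCompactSupport g) (hs : tsupport g ⊆ Ioi 0) :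
    (∫ r, deriv g r • ((r : ℂ) * dfn x r))
      + ∫ r, g r • ((coefficient mb c d s r : ℂ) * val x r) = 0 := by
  have h := hx (ofTest mb (realTest hg hc hs))
  have hd : ∀ r ∉ Ioi (0 : ℝ), deriv g r = 0 := fun r hr =>
    image_eq_zero_of_notMem_tsupport fun h' => hr (hs (tsupport_deriv_subset_tsupport g h'))
  have hg0 : ∀ r ∉ Ioi (0 : ℝ), g r = 0 := fun r hr =>
    image_eq_zero_of_notMem_tsupport fun h' => hr (hs h')
  have h1 : ∫ r in Ioi (0 : ℝ), (r : ℂ) * (dfn x r * star (dfn (ofTest mb (realTest hg hc hs)) r))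
      = ∫ r, deriv g r • ((r : ℂ) * dfn x r) := by
    rw [← setIntegral_Ioi_eq_integral fun r hr => by rw [hd r hr, zero_smul]]
    refine integral_congr_ae ?_
    filter_upwards [dfn_ofTest (mb := mb) (realTest hg hc hs)] with r hr
    rw [hr, deriv_realTest]
    simp only [RCLike.star_def, Complex.conj_ofReal, Complex.real_smul]
    ring
  have h2 : ∀ w : ℝ → ℝ, ∫ r in Ioi (0 : ℝ), (w r : ℂ) *
      (val x r * star (val (ofTest mb (realTest hg hc hs)) r))
      = ∫ r, g r • ((w r : ℂ) * val x r) := by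
    intro w
    rw [← setIntegral_Ioi_eq_integral fun r hr => by rw [hg0 r hr, zero_smul]]
    refine setIntegral_congr_fun measurableSet_Ioi fun r hr => ?_
    simp only [val_ofTest hmb _ hr, realTest_apply]
    simp only [RCLike.star_def, Complex.conj_ofReal, Complex.real_smul]
    ring
  rw [h1, h2, h2, ← integral_const_mul] at h
  have hcont : ∀ w : ℝ → ℝ, ContinuousOn w (Ioi 0) →
      Integrable fun r => g r • ((w r : ℂ) * val x r) := fun w hw =>
    integrable_smul_of_tsupport (intervalIntegrable_of_continuousOn
      ((Complex.continuous_ofReal.comp_continuousOn hw).mul (continuousOn_val x)))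
      hg.continuous hc hs
  have hne : ∀ r ∈ Ioi (0 : ℝ), r ≠ 0 := fun r hr => (mem_Ioi.1 hr).ne'
  have hw1 : ContinuousOn (fun r : ℝ => -mb * r⁻¹ + c * r ^ 3) (Ioi 0) :=
    (continuousOn_const.mul (continuousOn_id.inv₀ hne)).add (by fun_prop)
  have hw2 : ContinuousOn (fun r : ℝ => r ^ s) (Ioi 0) :=
    continuousOn_id.rpow_const fun r hr => Or.inl (hne r hr)
  have h3 : ∫ r, g r • ((coefficient mb c d s r : ℂ) * val x r)
      = (∫ r, g r • (((-mb * r⁻¹ + c * r ^ 3 : ℝ) : ℂ) * val x r))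
        - ∫ r, (d : ℂ) * g r • (((r ^ s : ℝ) : ℂ) * val x r) := by
    rw [← integral_sub (hcont _ hw1) ((hcont _ hw2).const_mul _)]
    refine integral_congr_ae (ae_of_all _ fun r => ?_)
    simp only [coefficient, Complex.real_smul]
    push_cast
    ring
  rw [h3, ← h]
  ring

theorem hasDerivAt_primitive {G : ℝ → ℂ} (hG : ContinuousOn G (Ioi 0)) {r : ℝ} (hr : 0 < r) :
    HasDerivAt (fun t => ∫ τ in (1 : ℝ)..t, G τ) (G r) r :=
  intervalIntegral.integral_hasDerivAt_right
    (intervalIntegrable_of_continuousOn hG _ _ one_pos hr)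
    (hG.stronglyMeasurableAtFilter isOpen_Ioi _ hr) (hG.continuousAt (Ioi_mem_nhds hr))

/-- Weak solutions are classical ones. -/
theorem IsWeakSolution.exists_isODESolution (hmb : mb ≤ 0) {x : H2 mb}
    (hx : IsWeakSolution c d s x) : ∃ F, IsODESolution mb c d s (val x) F := by
  set G : ℝ → ℂ := fun r => (coefficient mb c d s r : ℂ) * val x r with hG
  have hGc : ContinuousOn G (Ioi 0) :=
    (Complex.continuous_ofReal.comp_continuousOn (contDiffOn_coefficient mb c d s).continuousOn).mul
      (continuousOn_val x)
  set P : ℝ → ℂ := fun t => ∫ τ in (1 : ℝ)..t, G τ with hP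
  have hPd : ∀ r > 0, HasDerivAt P (G r) r := fun r hr => hasDerivAt_primitive hGc hr
  have hPc : ContinuousOn P (Ioi 0) := fun r hr => (hPd r hr).continuousAt.continuousWithinAt
  have hfi : ∀ a b : ℝ, 0 < a → 0 < b →
      IntervalIntegrable (fun r : ℝ => (r : ℂ) * dfn x r) volume a b := fun a b ha hb =>
    (intervalIntegrable_dfn ha hb x).continuousOn_mul (by fun_prop)
  -- By the weak equation `r x'` and the primitive `P` of `coefficient * x` have the same weak
  -- derivative, so they differ by a constant.
  obtain ⟨c0, hc0⟩ := exists_ae_eq_const_of_weak_deriv_eq_zero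
    (h := fun r => (r : ℂ) * dfn x r - P r)
    (fun a b ha hb => (hfi a b ha hb).sub (intervalIntegrable_of_continuousOn hPc a b ha hb))
    (by
      intro g hg hc hs
      have hgd : Continuous (deriv g) := hg.continuous_deriv (by simp)
      have hs' : tsupport (deriv g) ⊆ Ioi 0 := (tsupport_deriv_subset_tsupport g).trans hs
      have h1 := hx.integral_test hmb hg hc hs
      have h2 : ∫ r, deriv g r • P r = -∫ r, g r • G r := by
        obtain ⟨a, b, ha, hab, hK⟩ := exists_Ioo_of_isCompact hc hs
        have hga : ∀ r ∉ Ioo a b, g r = 0 := fun r hr =>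
          image_eq_zero_of_notMem_tsupport fun h' => hr (hK h')
        have hda : ∀ r ∉ Ioo a b, deriv g r = 0 := fun r hr =>
          image_eq_zero_of_notMem_tsupport fun h' => hr (hK (tsupport_deriv_subset_tsupport g h'))
        rw [integral_eq_interval_of_tsupport fun r hr => by rw [hda r hr, zero_smul],
          integral_eq_interval_of_tsupport fun r hr => by rw [hga r hr, zero_smul]]
        have hpos : ∀ r ∈ uIcc a b, 0 < r := fun r hr => by
          rw [uIcc_of_le hab.le] at hr; exact ha.trans_le hr.1
        have h3 := intervalIntegral.integral_mul_deriv_eq_deriv_mul (a := a) (b := b)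
          (u := P) (u' := G) (v := fun r => (g r : ℂ)) (v' := fun r => ((deriv g r : ℝ) : ℂ))
          (fun r hr => hPd r (hpos r hr))
          (fun r _ => (hg.differentiable (by simp) r).hasDerivAt.ofReal_comp)
          (intervalIntegrable_of_continuousOn hGc a b ha (ha.trans hab))
          (Continuous.intervalIntegrable (by fun_prop) _ _)
        rw [hga a (by simp), hga b (by simp)] at h3
        simp only [Complex.ofReal_zero, mul_zero, sub_zero, zero_sub] at h3
        simp only [Complex.real_smul]
        simpa only [mul_comm] using h3
      have h4 : ∫ r, deriv g r • ((r : ℂ) * dfn x r - P r)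
          = (∫ r, deriv g r • ((r : ℂ) * dfn x r)) - ∫ r, deriv g r • P r := by
        simp only [smul_sub]
        exact integral_sub (integrable_smul_of_tsupport hfi hgd hc.deriv hs')
          (integrable_smul_of_tsupport (intervalIntegrable_of_continuousOn hPc) hgd hc.deriv hs')
      rw [h4, h2, sub_neg_eq_add]
      exact h1)
  -- This is a continuous representative of the weak derivative; integrating it makes `val x`
  -- differentiable everywhere, and `r F = P + c0` has derivative `G`.
  set F : ℝ → ℂ := fun r => (P r + c0) / r with hF
  have hFc : ContinuousOn F (Ioi 0) :=
    (hPc.add continuousOn_const).div (by fun_prop) fun r hr => by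
      exact_mod_cast (mem_Ioi.1 hr).ne'
  have hfF : dfn x =ᵐ[volume.restrict (Ioi 0)] F := by
    filter_upwards [hc0, ae_restrict_mem measurableSet_Ioi] with r h1 h2
    have h3 : (r : ℂ) ≠ 0 := by exact_mod_cast (mem_Ioi.1 h2).ne'
    rw [hF, eq_div_iff h3, ← h1]; ring
  refine ⟨F, fun r hr => ?_, fun r hr => ?_⟩
  · have h1 := (hasDerivAt_primitive hFc hr).const_add (val x 1)
    refine h1.congr_of_eventuallyEq ?_
    filter_upwards [Ioi_mem_nhds hr] with t ht
    have h2 := val_sub_val one_pos ht x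
    have h3 : ∫ r in (1 : ℝ)..t, dfn x r = ∫ r in (1 : ℝ)..t, F r := by
      refine intervalIntegral.integral_congr_ae ?_
      filter_upwards [(ae_restrict_iff' measurableSet_Ioi).1 hfF] with r hr h
      exact hr ((lt_min one_pos ht).trans h.1)
    rw [← h3, ← h2]; ring
  · refine ((hPd r hr).add_const c0).congr_of_eventuallyEq ?_
    filter_upwards [Ioi_mem_nhds hr] with t ht
    have h3 : (t : ℂ) ≠ 0 := by exact_mod_cast (mem_Ioi.1 ht).ne'
    rw [hF]
    field_simp

end WeakSolution

/-! ### The ordinary differential equation -/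

section ODE

variable {mb c d s : ℝ} {u F u₁ F₁ u₂ F₂ : ℝ → ℂ}

namespace IsODESolution

theorem continuousOn_left (h : IsODESolution mb c d s u F) : ContinuousOn u (Ioi 0) :=
  fun r hr => (h.1 r hr).continuousAt.continuousWithinAt

theorem continuousOn_flux (h : IsODESolution mb c d s u F) :
    ContinuousOn (fun r : ℝ => (r : ℂ) * F r) (Ioi 0) :=
  fun r hr => (h.2 r hr).continuousAt.continuousWithinAt

theorem eq_inv_mul_flux {r : ℝ} (hr : 0 < r) : F r = ((r⁻¹ : ℝ) : ℂ) * ((r : ℂ) * F r) := by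
  have : (r : ℂ) ≠ 0 := by exact_mod_cast hr.ne'
  push_cast
  rw [← mul_assoc, inv_mul_cancel₀ this, one_mul]

theorem continuousOn_right (h : IsODESolution mb c d s u F) : ContinuousOn F (Ioi 0) := by
  have h1 : ContinuousOn (fun r : ℝ => ((r⁻¹ : ℝ) : ℂ)) (Ioi 0) :=
    Complex.continuous_ofReal.comp_continuousOn
      (continuousOn_id.inv₀ fun r hr => (mem_Ioi.1 hr).ne')
  exact (h1.mul h.continuousOn_flux).congr fun r hr => eq_inv_mul_flux hr

/-- Bootstrapping for the pair `(u, r F)`: from `u' = r⁻¹ (r F)` and `(r F)' = coefficient * u` both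
components gain one derivative at a time. -/
theorem contDiffOn (h : IsODESolution mb c d s u F) : ContDiffOn ℝ ∞ u (Ioi 0) := by
  have hof : ∀ {n : WithTop ℕ∞} {f : ℝ → ℝ}, ContDiffOn ℝ n f (Ioi 0) →
      ContDiffOn ℝ n (fun r => (f r : ℂ)) (Ioi 0) := fun hf =>
    Complex.ofRealCLM.contDiff.comp_contDiffOn hf
  have hinv : ContDiffOn ℝ ∞ (fun r : ℝ => ((r⁻¹ : ℝ) : ℂ)) (Ioi 0) :=
    hof (contDiffOn_id.inv fun r hr => (mem_Ioi.1 hr).ne')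
  have key : ∀ n : ℕ, ContDiffOn ℝ n u (Ioi 0) ∧
      ContDiffOn ℝ n (fun r : ℝ => (r : ℂ) * F r) (Ioi 0) := by
    intro n
    induction n with
    | zero =>
      exact ⟨contDiffOn_zero.2 h.continuousOn_left, contDiffOn_zero.2 h.continuousOn_flux⟩
    | succ n ih =>
      have hn : ((n : ℕ) : WithTop ℕ∞) ≤ ∞ := by exact_mod_cast le_top
      constructor
      · rw [Nat.cast_succ, contDiffOn_succ_iff_deriv_of_isOpen isOpen_Ioi]
        refine ⟨fun r hr => (h.1 r hr).differentiableAt.differentiableWithinAt, by simp, ?_⟩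
        refine ((hinv.of_le hn).mul ih.2).congr fun r hr => ?_
        rw [(h.1 r hr).deriv]
        exact eq_inv_mul_flux hr
      · rw [Nat.cast_succ, contDiffOn_succ_iff_deriv_of_isOpen isOpen_Ioi]
        refine ⟨fun r hr => (h.2 r hr).differentiableAt.differentiableWithinAt, by simp, ?_⟩
        refine (((hof (contDiffOn_coefficient mb c d s)).of_le hn).mul ih.1).congr fun r hr => ?_
        rw [(h.2 r hr).deriv]
  exact contDiffOn_infty.2 fun n => (key n).1

theorem sub_smul (h₁ : IsODESolution mb c d s u₁ F₁) (h₂ : IsODESolution mb c d s u₂ F₂) (α : ℂ) :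
    IsODESolution mb c d s (fun r => u₁ r - α * u₂ r) (fun r => F₁ r - α * F₂ r) := by
  refine ⟨fun r hr => (h₁.1 r hr).sub ((h₂.1 r hr).const_mul α), fun r hr => ?_⟩
  refine (((h₁.2 r hr).sub ((h₂.2 r hr).const_mul α)).congr_deriv (by ring)).congr_of_eventuallyEq
    (Eventually.of_forall fun t => ?_)
  simp only [Pi.sub_apply]
  ring

/-- Uniqueness for the initial value problem at `1`. -/
theorem eq_zero_of_initial (h : IsODESolution mb c d s u F) (h0 : u 1 = 0) (h1 : F 1 = 0) :
    ∀ r > 0, u r = 0 := by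
  intro r hr
  set a := min r 1 / 2 with ha
  set b := max r 1 + 1 with hb
  have ha0 : 0 < a := by positivity
  have hm : 0 < min r 1 := by positivity
  have har : a < r := by have := min_le_left r 1; linarith
  have ha1 : a < 1 := by have := min_le_right r 1; linarith
  have hbr : r < b := by have := le_max_left r 1; linarith
  have hb1 : 1 < b := by have := le_max_right r 1; linarith
  have hsub : Icc a b ⊆ Ioi 0 := fun t ht => ha0.trans_le ht.1
  obtain ⟨K, hK⟩ := isCompact_Icc.exists_bound_of_continuousOn
    ((contDiffOn_coefficient mb c d s).continuousOn.mono hsub)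
  -- The equation as a linear first order system for `(u, r F)`. On `[a, b]`, which has `r` and `1`
  -- in its interior and avoids `0`, it is Lipschitz with constant `max K a⁻¹`.
  set v : ℝ → ℂ × ℂ → ℂ × ℂ := fun t y =>
    (((t⁻¹ : ℝ) : ℂ) * y.2, (coefficient mb c d s t : ℂ) * y.1) with hv
  set M : ℝ := max K a⁻¹ with hM
  have hM0 : 0 ≤ M := le_max_of_le_right (by positivity)
  have hlip : ∀ t ∈ Ioo a b, LipschitzOnWith M.toNNReal (v t) univ := by
    intro t ht
    refine (LipschitzWith.of_dist_le_mul fun y z => ?_).lipschitzOnWith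
    rw [Real.coe_toNNReal _ hM0, Prod.dist_eq]
    have ht0 : 0 < t := ha0.trans ht.1
    have e1 : dist (((t⁻¹ : ℝ) : ℂ) * y.2) (((t⁻¹ : ℝ) : ℂ) * z.2) = t⁻¹ * dist y.2 z.2 := by
      rw [dist_eq_norm, ← mul_sub, norm_mul, Complex.norm_real, Real.norm_of_nonneg (by positivity),
        dist_eq_norm]
    have e2 : dist ((coefficient mb c d s t : ℂ) * y.1) ((coefficient mb c d s t : ℂ) * z.1)
        = ‖coefficient mb c d s t‖ * dist y.1 z.1 := by
      rw [dist_eq_norm, ← mul_sub, norm_mul, Complex.norm_real, dist_eq_norm]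
    refine max_le ?_ ?_
    · simp only [hv]
      rw [e1]
      refine mul_le_mul ((inv_anti₀ ha0 ht.1.le).trans (le_max_right _ _)) ?_ dist_nonneg hM0
      exact le_max_right (dist y.1 z.1) _
    · simp only [hv]
      rw [e2]
      refine mul_le_mul ((hK t (Ioo_subset_Icc_self ht)).trans (le_max_left _ _)) ?_ dist_nonneg hM0
      exact le_max_left _ (dist y.2 z.2)
  have huniq := ODE_solution_unique_of_mem_Icc (v := v) (s := fun _ => univ) (t₀ := 1)
    (f := fun t => (u t, (t : ℂ) * F t)) (g := fun _ => (0, 0)) hlip ⟨ha1, hb1⟩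
    ((h.continuousOn_left.prodMk h.continuousOn_flux).mono hsub)
    (fun t ht => by
      have ht0 : 0 < t := ha0.trans ht.1
      refine ((h.1 t ht0).prodMk (h.2 t ht0)).congr_deriv ?_
      simp only [hv, ← eq_inv_mul_flux ht0])
    (fun _ _ => mem_univ _) continuousOn_const
    (fun t _ => by simpa [hv] using! hasDerivAt_const t ((0 : ℂ), (0 : ℂ)))
    (fun _ _ => mem_univ _) (by simp [h0, h1])
  have := huniq ⟨har.le, hbr.le⟩
  exact congrArg Prod.fst this

/-- The Wronskian of two solutions which are square integrable at infinity vanishes. -/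
theorem wronskian_eq_zero (h₁ : IsODESolution mb c d s u₁ F₁) (h₂ : IsODESolution mb c d s u₂ F₂)
    (hu₁ : IntegrableOn (fun r => r * ‖u₁ r‖ ^ 2) (Ioi 1))
    (hF₁ : IntegrableOn (fun r => r * ‖F₁ r‖ ^ 2) (Ioi 1))
    (hu₂ : IntegrableOn (fun r => r * ‖u₂ r‖ ^ 2) (Ioi 1))
    (hF₂ : IntegrableOn (fun r => r * ‖F₂ r‖ ^ 2) (Ioi 1)) :
    u₁ 1 * F₂ 1 - u₂ 1 * F₁ 1 = 0 := by
  set W : ℝ → ℂ := fun r => u₁ r * ((r : ℂ) * F₂ r) - u₂ r * ((r : ℂ) * F₁ r) with hW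
  have hd : ∀ r > 0, HasDerivAt W 0 r := fun r hr => by
    refine (((h₁.1 r hr).mul (h₂.2 r hr)).sub ((h₂.1 r hr).mul (h₁.2 r hr))).congr_deriv ?_
    ring
  have hconst : ∀ r > 0, W r = W 1 := fun r hr =>
    isOpen_Ioi.is_const_of_deriv_eq_zero (convex_Ioi 0).isPreconnected
      (fun t ht => (hd t ht).differentiableAt.differentiableWithinAt)
      (fun t ht => (hd t ht).deriv) hr (mem_Ioi.2 one_pos)
  -- Since `|W| ≤ r (|u₁| |F₂| + |u₂| |F₁|)`, the constant `W` is integrable over a set of infinite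
  -- measure, so it is zero.
  have hint : IntegrableOn W (Ioi 1) := by
    refine Integrable.mono' (((hu₁.add hF₁).add (hu₂.add hF₂))) ?_ ?_
    · refine ContinuousOn.aestronglyMeasurable (fun r hr => ?_) measurableSet_Ioi
      exact (hd r (one_pos.trans hr)).continuousAt.continuousWithinAt
    · filter_upwards [ae_restrict_mem measurableSet_Ioi] with r hr
      have hr0 : 0 < r := one_pos.trans hr
      have e : ‖W r‖ ≤ ‖u₁ r‖ * (r * ‖F₂ r‖) + ‖u₂ r‖ * (r * ‖F₁ r‖) := by
        refine (norm_sub_le _ _).trans (le_of_eq ?_)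
        simp only [norm_mul, Complex.norm_real, Real.norm_of_nonneg hr0.le]
      refine e.trans ?_
      simp only [Pi.add_apply]
      nlinarith [mul_nonneg hr0.le (sq_nonneg (‖u₁ r‖ - ‖F₂ r‖)),
        mul_nonneg hr0.le (sq_nonneg (‖u₂ r‖ - ‖F₁ r‖)), mul_nonneg hr0.le (sq_nonneg (‖u₁ r‖)),
        mul_nonneg hr0.le (sq_nonneg (‖u₂ r‖)), mul_nonneg hr0.le (sq_nonneg (‖F₁ r‖)),
        mul_nonneg hr0.le (sq_nonneg (‖F₂ r‖))]
  have h0 : W 1 = 0 := by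
    have h3 : IntegrableOn (fun _ : ℝ => W 1) (Ioi 1) :=
      hint.congr_fun (fun r hr => hconst r (one_pos.trans hr)) measurableSet_Ioi
    rw [integrableOn_const_iff] at h3
    simpa using h3
  simpa [hW] using h0

/-- As `s < 3`, the term `d r^s` is eventually below half of `c r³`, whatever the sign and size of
`d`. -/
theorem eventually_coefficient_ge (hmb : mb ≤ 0) (hc : 0 < c) (hs3 : s < 3) :
    ∃ R ≥ (1 : ℝ), ∀ r ≥ R, c / 2 * r ^ 3 ≤ coefficient mb c d s r := by
  have h1 : Tendsto (fun r : ℝ => d * r ^ (s - 3)) atTop (𝓝 0) := by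
    have := tendsto_rpow_neg_atTop (y := 3 - s) (by linarith)
    simpa using (this.congr fun R => by rw [neg_sub]).const_mul d
  obtain ⟨R, hR⟩ := eventually_atTop.1 (h1.eventually (gt_mem_nhds (half_pos hc)))
  refine ⟨max R 1, le_max_right _ _, fun r hr => ?_⟩
  have hr0 : 0 < r := by linarith [le_max_right R 1]
  have h2 := hR r ((le_max_left _ _).trans hr)
  have h3 : r ^ s = r ^ (s - 3) * r ^ 3 := by
    rw [← Real.rpow_natCast r 3, ← Real.rpow_add hr0]; norm_num
  have h4 : 0 ≤ -mb * r⁻¹ := mul_nonneg (by linarith) (by positivity)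
  have h5 : d * r ^ s ≤ c / 2 * r ^ 3 := by
    rw [h3, ← mul_assoc]; gcongr
  rw [coefficient]
  linarith

/-- Solutions of finite energy decay at infinity. -/
theorem integrableOn_pow_five (h : IsODESolution mb c d s u F) (hmb : mb ≤ 0) (hc : 0 < c)
    (hs3 : s < 3) (hu : IntegrableOn (fun r => r ^ 3 * ‖u r‖ ^ 2) (Ioi 1))
    (hF : IntegrableOn (fun r => r * ‖F r‖ ^ 2) (Ioi 1)) :
    IntegrableOn (fun r => r ^ 5 * ‖u r‖ ^ 2) (Ioi 1) := by
  obtain ⟨R, hR1, hR⟩ := eventually_coefficient_ge (d := d) hmb hc hs3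
  have hR0 : 0 < R := by linarith
  -- Multiplying the equation by the conjugate of `u` gives `E' = coefficient * |u|² + r |F|²`,
  -- whose first term dominates `c/2 r³ |u|²` far out.
  set E : ℝ → ℝ := fun r => (((r : ℂ) * F r) * star (u r)).re with hE
  have hEd : ∀ r > 0, HasDerivAt E (coefficient mb c d s r * ‖u r‖ ^ 2 + r * ‖F r‖ ^ 2) r := by
    intro r hr
    have h1 := (h.2 r hr).mul (h.1 r hr).star
    have h2 := Complex.reCLM.hasFDerivAt.comp_hasDerivAt r h1
    refine h2.congr_deriv ?_
    have e1 : u r * star (u r) = ((‖u r‖ ^ 2 : ℝ) : ℂ) := by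
      rw [RCLike.star_def, RCLike.mul_conj]; push_cast; rfl
    have e2 : F r * star (F r) = ((‖F r‖ ^ 2 : ℝ) : ℂ) := by
      rw [RCLike.star_def, RCLike.mul_conj]; push_cast; rfl
    simp only [Complex.reCLM_apply]
    rw [mul_assoc, mul_assoc, e1, e2, ← Complex.ofReal_mul, ← Complex.ofReal_mul,
      ← Complex.ofReal_add, Complex.ofReal_re]
  have hEle : ∀ r > 0, |r * E r| ≤ (r ^ 3 * ‖u r‖ ^ 2 + r * ‖F r‖ ^ 2) / 2 := by
    intro r hr
    have h1 : |E r| ≤ r * ‖F r‖ * ‖u r‖ := by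
      refine (Complex.abs_re_le_norm _).trans (le_of_eq ?_)
      simp [Real.norm_of_nonneg hr.le]
    rw [abs_mul, abs_of_pos hr]
    have h2 : r * |E r| ≤ r * (r * ‖F r‖ * ‖u r‖) := by gcongr
    nlinarith [mul_nonneg hr.le (sq_nonneg (r * ‖u r‖ - ‖F r‖))]
  -- The factor `r²` raises the weight to `r⁵`. The extra term `2 r E` of `Φ'` is at least `-k` with
  -- the integrable `k = r³ |u|² + r |F|²`, so `c/2 ∫ r⁵ |u|²` over `[R, N]` is at most `Φ N - Φ R +
  -- ∫ k`.
  set Φ : ℝ → ℝ := fun r => r ^ 2 * E r with hΦ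
  set D : ℝ → ℝ := fun r => 2 * r * E r
    + r ^ 2 * (coefficient mb c d s r * ‖u r‖ ^ 2 + r * ‖F r‖ ^ 2) with hD
  have hΦd : ∀ r > 0, HasDerivAt Φ (D r) r := by
    intro r hr
    refine ((hasDerivAt_pow 2 r).mul (hEd r hr)).congr_deriv ?_
    simp [hD]
  have huc := h.continuousOn_left
  have hFc := h.continuousOn_right
  have hEc : ContinuousOn E (Ioi 0) := fun r hr => (hEd r hr).continuousAt.continuousWithinAt
  have hDc : ContinuousOn D (Ioi 0) := by
    have hQ := (contDiffOn_coefficient mb c d s).continuousOn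
    exact (ContinuousOn.mul (by fun_prop) hEc).add (ContinuousOn.mul (by fun_prop)
      ((hQ.mul (huc.norm.pow 2)).add (continuousOn_id.mul (hFc.norm.pow 2))))
  set k : ℝ → ℝ := fun r => r ^ 3 * ‖u r‖ ^ 2 + r * ‖F r‖ ^ 2 with hk
  have hki : IntegrableOn k (Ioi 1) := hu.add hF
  have hk0 : ∀ r > 0, 0 ≤ k r := fun r hr => by positivity
  have hkc : ContinuousOn k (Ioi 0) :=
    (ContinuousOn.mul (by fun_prop) (huc.norm.pow 2)).add (continuousOn_id.mul (hFc.norm.pow 2))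
  -- It is enough to bound `Φ` above along a sequence tending to infinity. If `r² E > 1` held from
  -- some point on, then `1/r < r E ≤ k` would be integrable at infinity.
  have hsmall : ∀ N : ℝ, ∃ N' ≥ max N R, Φ N' ≤ 1 := by
    intro N
    by_contra! hcon
    set A := max N R with hA
    have hA1 : 1 ≤ A := hR1.trans (le_max_right _ _)
    have h1 : IntegrableOn (fun r : ℝ => r⁻¹) (Ioi A) := by
      refine Integrable.mono' ((hki.mono_set (Ioi_subset_Ioi hA1))) (by fun_prop) ?_
      filter_upwards [ae_restrict_mem measurableSet_Ioi] with r hr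
      have hr0 : 0 < r := one_pos.trans_le (hA1.trans (le_of_lt hr))
      have h2 := hcon r (le_of_lt hr)
      have h3 := (le_abs_self _).trans (hEle r hr0)
      have h4 : r⁻¹ ≤ r * E r := by
        rw [inv_le_iff_one_le_mul₀ hr0]
        simp only [hΦ] at h2
        nlinarith
      rw [Real.norm_of_nonneg (by positivity)]
      have := hk0 r hr0
      simp only [hk] at this ⊢
      linarith
    exact not_integrableOn_Ioi_inv h1
  choose N hN hΦN using fun n : ℕ => hsmall n
  have hsub : Ioi R ⊆ Ioi 1 := Ioi_subset_Ioi hR1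
  have hfin : IntegrableOn (fun r => r ^ 5 * ‖u r‖ ^ 2) (Ioi R) := by
    have hfc : ContinuousOn (fun r => r ^ 5 * ‖u r‖ ^ 2) (Ioi 0) :=
      ContinuousOn.mul (by fun_prop) (huc.norm.pow 2)
    refine integrableOn_Ioi_of_intervalIntegral_norm_bounded (ι := ℕ) (l := atTop) (b := N)
      (2 / c * (1 + |Φ R| + ∫ r in Ioi R, k r)) R (fun n => ?_) ?_ ?_
    · refine (ContinuousOn.integrableOn_Icc (hfc.mono fun r hr => hR0.trans_le hr.1)).mono_set
        Ioc_subset_Icc_self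
    · exact tendsto_atTop_mono (fun n => (le_max_left _ _).trans (hN n)) tendsto_natCast_atTop_atTop
    · refine Eventually.of_forall fun n => ?_
      have hRN : R ≤ N n := (le_max_right _ _).trans (hN n)
      have hI : ∀ r ∈ uIcc R (N n), 0 < r := fun r hr => by
        rw [uIcc_of_le hRN] at hr; exact hR0.trans_le hr.1
      have hint : ∀ {g : ℝ → ℝ}, ContinuousOn g (Ioi 0) → IntervalIntegrable g volume R (N n) :=
        fun hg => (hg.mono hI).intervalIntegrable
      have h1 : ∫ r in R..(N n), D r = Φ (N n) - Φ R :=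
        intervalIntegral.integral_eq_sub_of_hasDerivAt (fun r hr => hΦd r (hI r hr)) (hint hDc)
      have h2 : ∫ r in R..(N n), k r ≤ ∫ r in Ioi R, k r := by
        rw [intervalIntegral.integral_of_le hRN]
        refine setIntegral_mono_set (hki.mono_set hsub) ?_ Ioc_subset_Ioi_self.eventuallyLE
        filter_upwards [ae_restrict_mem measurableSet_Ioi] with r hr
        exact hk0 r (hR0.trans hr)
      have h3 : ∫ r in R..(N n), ‖r ^ 5 * ‖u r‖ ^ 2‖ ≤ ∫ r in R..(N n), 2 / c * (D r + k r) := by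
        refine intervalIntegral.integral_mono_on hRN (hint hfc.norm)
          ((hint (hDc.add hkc)).const_mul _) fun r hr => ?_
        have hr0 : 0 < r := hR0.trans_le hr.1
        rw [Real.norm_of_nonneg (by positivity), div_mul_eq_mul_div, le_div_iff₀ hc]
        have h4 := hR r hr.1
        have h5 := (neg_abs_le _).trans' (neg_le_neg (hEle r hr0))
        have h6 : c / 2 * r ^ 3 * ‖u r‖ ^ 2 ≤ coefficient mb c d s r * ‖u r‖ ^ 2 := by gcongr
        have h7 : r ^ 2 * (c / 2 * r ^ 3 * ‖u r‖ ^ 2)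
            ≤ r ^ 2 * (coefficient mb c d s r * ‖u r‖ ^ 2) := by gcongr
        have h8 : 0 ≤ r ^ 2 * (r * ‖F r‖ ^ 2) := by positivity
        simp only [hD, hk]
        nlinarith
      refine h3.trans ?_
      rw [intervalIntegral.integral_const_mul, intervalIntegral.integral_add (hint hDc) (hint hkc),
        h1]
      have h9 := neg_abs_le (Φ R)
      have h10 := hΦN n
      gcongr
      linarith
  have hmid : IntegrableOn (fun r => r ^ 5 * ‖u r‖ ^ 2) (Icc 1 R) :=
    ContinuousOn.integrableOn_Icc (ContinuousOn.mul (by fun_prop)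
      ((huc.norm.pow 2).mono fun r hr => one_pos.trans_le hr.1))
  refine (hmid.union hfin).mono_set fun r hr => ?_
  rcases le_or_gt r R with h' | h'
  · exact Or.inl ⟨le_of_lt hr, h'⟩
  · exact Or.inr h'

end IsODESolution

end ODE

/-! ### Simplicity of the eigenvalues and decay of the eigenfunctions -/

section Eigenfunctions

variable {mb c d s : ℝ}

theorem integrableOn_Ioi_one_val_sq (hmb : mb ≤ 0) (x : H2 mb) :
    IntegrableOn (fun r => r * ‖val x r‖ ^ 2) (Ioi 1) := by
  have := (embedsWithBound_rpow hmb (s := 1) le_rfl (by norm_num) x).1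
  simp only [Real.rpow_one] at this
  exact this.mono_set (Ioi_subset_Ioi zero_le_one)

theorem IsODESolution.integrableOn_Ioi_one {x : H2 mb} {F : ℝ → ℂ}
    (h : IsODESolution mb c d s (val x) F) : IntegrableOn (fun r => r * ‖F r‖ ^ 2) (Ioi 1) := by
  have h1 : IntegrableOn (fun r => r * ‖F r‖ ^ 2) (Ioi 0) := by
    refine (integrableOn_dfn_sq x).congr ?_
    filter_upwards [dfn_ae_eq_of_hasDerivAt h.1] with r hr
    rw [hr]
  exact h1.mono_set (Ioi_subset_Ioi zero_le_one)

/-- Weak solutions are unique up to multiples. -/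
theorem IsWeakSolution.exists_eq_smul (hmb : mb ≤ 0) {x y : H2 mb} (hx : IsWeakSolution c d s x)
    (hy : IsWeakSolution c d s y) (hy0 : y ≠ 0) : ∃ α : ℂ, x = α • y := by
  obtain ⟨F, hF⟩ := hx.exists_isODESolution hmb
  obtain ⟨K, hK⟩ := hy.exists_isODESolution hmb
  have hW := hF.wronskian_eq_zero hK (integrableOn_Ioi_one_val_sq hmb x) hF.integrableOn_Ioi_one
    (integrableOn_Ioi_one_val_sq hmb y) hK.integrableOn_Ioi_one
  have hne : val y 1 ≠ 0 ∨ K 1 ≠ 0 := by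
    by_contra! hcon
    refine hy0 (H2_ext_val hmb fun r hr => ?_)
    rw [hK.eq_zero_of_initial hcon.1 hcon.2 r hr]
    have := val_smul hmb hr 0 y
    rw [zero_smul, zero_mul] at this
    exact this.symm
  -- `α` is read off from whichever initial datum of `y` at `1` is nonzero; the vanishing Wronskian
  -- supplies the other equation.
  obtain ⟨α, h1, h2⟩ : ∃ α : ℂ, val x 1 - α * val y 1 = 0 ∧ F 1 - α * K 1 = 0 := by
    rcases hne with h | h
    · refine ⟨val x 1 / val y 1, by field_simp; ring, ?_⟩
      field_simp
      linear_combination -hW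
    · refine ⟨F 1 / K 1, ?_, by field_simp; ring⟩
      field_simp
      linear_combination hW
  refine ⟨α, H2_ext_val hmb fun r hr => ?_⟩
  rw [val_smul hmb hr]
  exact sub_eq_zero.1 ((hF.sub_smul hK α).eq_zero_of_initial h1 h2 r hr)

/-- Weak solutions decay so fast that `r^(s-1) x` belongs to `L²(I,1)`. -/
theorem IsWeakSolution.memLp_rpow_mul (hmb : mb ≤ 0) (hc : 0 < c) (hs : 1 ≤ s) (hs3 : s < 3)
    {x : H2 mb} (hx : IsWeakSolution c d s x) :
    MemLp (fun r => ((r ^ (s - 1) : ℝ) : ℂ) * val x r) 2 (weighted fun r => r ^ (1 : ℝ)) := by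
  obtain ⟨F, hF⟩ := hx.exists_isODESolution hmb
  have h5 := hF.integrableOn_pow_five hmb hc hs3
    ((integrableOn_pow_three_val_sq hmb x).mono_set (Ioi_subset_Ioi zero_le_one))
    hF.integrableOn_Ioi_one
  have h1 := (embedsWithBound_rpow hmb (s := 1) le_rfl (by norm_num) x).1
  have hmeas : AEStronglyMeasurable (fun r => ((r ^ (s - 1) : ℝ) : ℂ) * val x r)
      (volume.restrict (Ioi 0)) :=
    (Complex.measurable_ofReal.comp (measurable_rpow_weight _)).aestronglyMeasurable.mul
      ((continuousOn_val x).aestronglyMeasurable measurableSet_Ioi)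
  rw [memLp_weighted_iff (measurable_rpow_weight _) (rpow_weight_pos _)]
  refine ⟨hmeas, ?_⟩
  have hfm : AEStronglyMeasurable (fun r => r ^ (1 : ℝ) * ‖((r ^ (s - 1) : ℝ) : ℂ) * val x r‖ ^ 2)
      (volume.restrict (Ioi 0)) :=
    (measurable_rpow_weight _).aestronglyMeasurable.mul (hmeas.norm.pow 2)
  have hval : ∀ r > 0, ‖r ^ (1 : ℝ) * ‖((r ^ (s - 1) : ℝ) : ℂ) * val x r‖ ^ 2‖
      = r * (r ^ (s - 1)) ^ 2 * ‖val x r‖ ^ 2 := fun r hr => by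
    have := (rpow_weight_pos (s - 1) r hr).le
    rw [Real.rpow_one, Real.norm_of_nonneg (by positivity), norm_mul, Complex.norm_real,
      Real.norm_of_nonneg this]
    ring
  -- The weight to be integrated is `r^(2s-1)`. Near `0` it is at most `r`, since `s ≥ 1`; at
  -- infinity it is at most `r⁵`, since `s < 3`, and the decay of solutions takes over.
  have hA : IntegrableOn (fun r => r ^ (1 : ℝ) * ‖((r ^ (s - 1) : ℝ) : ℂ) * val x r‖ ^ 2)
      (Ioc 0 1) := by
    refine Integrable.mono' (h1.mono_set Ioc_subset_Ioi_self)
      (hfm.mono_measure (Measure.restrict_mono Ioc_subset_Ioi_self le_rfl)) ?_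
    filter_upwards [ae_restrict_mem measurableSet_Ioc] with r hr
    have hr0 : 0 < r := hr.1
    rw [hval r hr.1, Real.rpow_one]
    have h2 : (r ^ (s - 1)) ^ 2 ≤ 1 :=
      pow_le_one₀ (rpow_weight_pos _ r hr.1).le (Real.rpow_le_one hr.1.le hr.2 (by linarith))
    have h3 : r * (r ^ (s - 1)) ^ 2 ≤ r := by nlinarith
    gcongr
  have hB : IntegrableOn (fun r => r ^ (1 : ℝ) * ‖((r ^ (s - 1) : ℝ) : ℂ) * val x r‖ ^ 2)
      (Ioi 1) := by
    refine Integrable.mono' h5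
      (hfm.mono_measure (Measure.restrict_mono (Ioi_subset_Ioi zero_le_one) le_rfl)) ?_
    filter_upwards [ae_restrict_mem measurableSet_Ioi] with r hr
    have hr0 : 0 < r := one_pos.trans hr
    rw [hval r hr0]
    have h2 : r ^ (s - 1) ≤ r ^ 2 := by
      have := Real.rpow_le_rpow_of_exponent_le (le_of_lt hr) (show s - 1 ≤ 2 by linarith)
      exact_mod_cast this
    have h3 := pow_le_pow_left₀ (rpow_weight_pos (s - 1) r hr0).le h2 2
    have h4 : r * (r ^ (s - 1)) ^ 2 ≤ r ^ 5 :=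
      (mul_le_mul_of_nonneg_left h3 hr0.le).trans (le_of_eq (by ring))
    gcongr
  rw [← Ioc_union_Ioi_eq_Ioi zero_le_one]
  exact hA.union hB

end Eigenfunctions

/-! ### Dilations -/

section Dilation

variable {mb c d s ρ : ℝ}

/-- The test function `r ↦ φ(ρ r)`. -/
def dilateTest (hρ : 0 < ρ) (φ : 𝓓(halfLine, ℂ)) : 𝓓(halfLine, ℂ) where
  toFun := fun r => φ (ρ * r)
  contDiff' := φ.contDiff.comp (contDiff_const.mul contDiff_id)
  hasCompactSupport' := φ.hasCompactSupport.comp_homeomorph (Homeomorph.mulLeft₀ ρ hρ.ne')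
  tsupport_subset' := by
    intro r hr
    have h1 : ρ * r ∈ tsupport φ :=
      tsupport_comp_subset_preimage (f := fun t : ℝ => ρ * t) φ (by fun_prop) hr
    exact pos_of_mul_pos_right (φ.tsupport_subset h1) hρ.le

theorem dilateTest_apply (hρ : 0 < ρ) (φ : 𝓓(halfLine, ℂ)) (r : ℝ) :
    dilateTest hρ φ r = φ (ρ * r) := rfl

theorem deriv_dilateTest (hρ : 0 < ρ) (φ : 𝓓(halfLine, ℂ)) (r : ℝ) :
    deriv (dilateTest hρ φ) r = ρ * deriv φ (ρ * r) := by
  have h1 : HasDerivAt φ (deriv φ (ρ * r)) (ρ * r) :=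
    (φ.contDiff.differentiable (by simp) _).hasDerivAt
  have h2 : HasDerivAt (fun t : ℝ => ρ * t) ρ r := by simpa using (hasDerivAt_id r).const_mul ρ
  have h3 := (h1.scomp r h2).deriv
  rw [Complex.real_smul] at h3
  exact h3

theorem val_sub (hmb : mb ≤ 0) {t : ℝ} (ht : 0 < t) (x y : H2 mb) :
    val (x - y) t = val x t - val y t := map_sub (evalCLM hmb ht) x y

theorem ofTest_sub (hmb : mb ≤ 0) (φ χ : 𝓓(halfLine, ℂ)) :
    ofTest mb (φ - χ) = ofTest mb φ - ofTest mb χ := by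
  refine H2_ext_val hmb fun r hr => ?_
  rw [val_sub hmb hr, val_ofTest hmb _ hr, val_ofTest hmb _ hr, val_ofTest hmb _ hr]
  rfl

theorem normSq_ofTest (hmb : mb ≤ 0) (φ : 𝓓(halfLine, ℂ)) :
    ‖ofTest mb φ‖ ^ 2 = (∫ r in Ioi (0 : ℝ), r * ‖deriv φ r‖ ^ 2) +
      ∫ r in Ioi (0 : ℝ), (-mb * r⁻¹ + r ^ 3) * ‖φ r‖ ^ 2 := by
  rw [normSq_eq hmb]
  congr 1
  · refine integral_congr_ae ?_
    filter_upwards [dfn_ofTest (mb := mb) φ] with r hr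
    rw [hr]
  · refine integral_congr_ae ?_
    filter_upwards [fn_ofTest hmb φ] with r hr
    rw [hr]

theorem setIntegral_comp_mul_left {E : Type*} [NormedAddCommGroup E] [NormedSpace ℝ E]
    (hρ : 0 < ρ) (g : ℝ → E) :
    ∫ r in Ioi (0 : ℝ), ρ • g (ρ * r) = ∫ r in Ioi (0 : ℝ), g r := by
  rw [integral_smul, integral_comp_mul_left_Ioi g 0 hρ, mul_zero, smul_smul,
    mul_inv_cancel₀ hρ.ne', one_smul]

/-- Two terms of the norm are dilation invariant and the cubic one is multiplied by `ρ⁻⁴`, so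
dilation is bounded on test functions. -/
theorem normSq_ofTest_dilateTest_le (hmb : mb ≤ 0) (hρ : 0 < ρ) (φ : 𝓓(halfLine, ℂ)) :
    ‖ofTest mb (dilateTest hρ φ)‖ ^ 2 ≤ (1 + (ρ ^ 4)⁻¹) * ‖ofTest mb φ‖ ^ 2 := by
  rw [normSq_ofTest hmb, normSq_ofTest hmb]
  have h1 : ∫ r in Ioi (0 : ℝ), r * ‖deriv (dilateTest hρ φ) r‖ ^ 2
      = ∫ r in Ioi (0 : ℝ), r * ‖deriv φ r‖ ^ 2 := by
    refine Eq.trans ?_ (setIntegral_comp_mul_left hρ _)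
    refine setIntegral_congr_fun measurableSet_Ioi fun r hr => ?_
    simp only [deriv_dilateTest, norm_mul, Complex.norm_real, Real.norm_of_nonneg hρ.le,
      smul_eq_mul]
    ring
  have h2 : ∫ r in Ioi (0 : ℝ), (-mb * r⁻¹ + r ^ 3) * ‖dilateTest hρ φ r‖ ^ 2
      = ∫ r in Ioi (0 : ℝ), (-mb * r⁻¹ + (ρ ^ 4)⁻¹ * r ^ 3) * ‖φ r‖ ^ 2 := by
    refine Eq.trans ?_ (setIntegral_comp_mul_left hρ _)
    refine setIntegral_congr_fun measurableSet_Ioi fun r hr => ?_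
    have hr0 : r ≠ 0 := (mem_Ioi.1 hr).ne'
    simp only [dilateTest_apply, smul_eq_mul]
    field_simp
  have h3 : ∫ r in Ioi (0 : ℝ), (-mb * r⁻¹ + (ρ ^ 4)⁻¹ * r ^ 3) * ‖φ r‖ ^ 2
      ≤ (1 + (ρ ^ 4)⁻¹) * ∫ r in Ioi (0 : ℝ), (-mb * r⁻¹ + r ^ 3) * ‖φ r‖ ^ 2 := by
    have hρ4 : 0 < (ρ ^ 4)⁻¹ := by positivity
    have hi : IntegrableOn (fun r => (-mb * r⁻¹ + r ^ 3) * ‖φ r‖ ^ 2) (Ioi 0) := by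
      refine (integrableOn_fn_sq hmb (ofTest mb φ)).congr ?_
      filter_upwards [fn_ofTest hmb φ] with r hr
      rw [hr]
    have hle : ∀ r ∈ Ioi (0 : ℝ), (-mb * r⁻¹ + (ρ ^ 4)⁻¹ * r ^ 3) * ‖φ r‖ ^ 2
        ≤ (1 + (ρ ^ 4)⁻¹) * ((-mb * r⁻¹ + r ^ 3) * ‖φ r‖ ^ 2) := by
      intro r hr
      have hr0 : 0 < r := hr
      rw [← mul_assoc]
      gcongr
      have h5 : 0 ≤ -mb * r⁻¹ := mul_nonneg (by linarith) (by positivity)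
      nlinarith [mul_nonneg hρ4.le h5, pow_pos hr0 3]
    rw [← integral_const_mul]
    refine integral_mono_of_nonneg ?_ (hi.const_mul _) ?_
    · filter_upwards [ae_restrict_mem measurableSet_Ioi] with r hr
      exact mul_nonneg (energy_weight_pos hmb hρ4 r hr).le (sq_nonneg _)
    · filter_upwards [ae_restrict_mem measurableSet_Ioi] with r hr using hle r hr
  have h4 : 0 ≤ ∫ r in Ioi (0 : ℝ), r * ‖deriv φ r‖ ^ 2 :=
    setIntegral_nonneg measurableSet_Ioi fun r (hr : 0 < r) => by positivity
  rw [h1, h2]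
  have : 0 ≤ (ρ ^ 4)⁻¹ := by positivity
  nlinarith

/-- Extension by density: dilated approximants form a Cauchy sequence, and continuity of point
evaluation identifies the limit. -/
theorem exists_dilate (hmb : mb ≤ 0) (hρ : 0 < ρ) (x : H2 mb) :
    ∃ z : H2 mb, ∀ r > 0, val z r = val x (ρ * r) := by
  obtain ⟨φ, hφ⟩ := exists_seq_ofTest_tendsto hmb x
  have hlip : ∀ j k, dist (ofTest mb (dilateTest hρ (φ j))) (ofTest mb (dilateTest hρ (φ k)))
      ≤ Real.sqrt (1 + (ρ ^ 4)⁻¹) * dist (ofTest mb (φ j)) (ofTest mb (φ k)) := by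
    intro j k
    rw [dist_eq_norm, dist_eq_norm, ← ofTest_sub hmb, ← ofTest_sub hmb]
    have h := Real.sqrt_le_sqrt (normSq_ofTest_dilateTest_le hmb hρ (φ j - φ k))
    rw [Real.sqrt_sq (norm_nonneg _), Real.sqrt_mul (by positivity),
      Real.sqrt_sq (norm_nonneg _)] at h
    exact h
  have hcauchy : CauchySeq fun k => ofTest mb (dilateTest hρ (φ k)) := by
    have h0 := hφ.cauchySeq
    rw [cauchySeq_iff_tendsto_dist_atTop_0] at h0 ⊢
    have h1 := h0.const_mul (Real.sqrt (1 + (ρ ^ 4)⁻¹))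
    rw [mul_zero] at h1
    exact squeeze_zero (fun _ => dist_nonneg) (fun p => hlip p.1 p.2) h1
  obtain ⟨z, hz⟩ := cauchySeq_tendsto_of_complete hcauchy
  refine ⟨z, fun r hr => ?_⟩
  have hρr : 0 < ρ * r := mul_pos hρ hr
  refine tendsto_nhds_unique (((continuous_val hmb hr).tendsto z).comp hz) ?_
  refine (((continuous_val hmb hρr).tendsto x).comp hφ).congr fun k => ?_
  simp only [Function.comp, val_ofTest hmb _ hr, val_ofTest hmb _ hρr, dilateTest_apply]

/-- The dilation `r ↦ x(ρ r)` of an element of `H₂(μ̄)`. -/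
def dilate (hmb : mb ≤ 0) (hρ : 0 < ρ) (x : H2 mb) : H2 mb := (exists_dilate hmb hρ x).choose

theorem val_dilate (hmb : mb ≤ 0) (hρ : 0 < ρ) (x : H2 mb) {r : ℝ} (hr : 0 < r) :
    val (dilate hmb hρ x) r = val x (ρ * r) := (exists_dilate hmb hρ x).choose_spec r hr

theorem ae_comp_mul_left (hρ : 0 < ρ) {P : ℝ → Prop}
    (h : ∀ᵐ r ∂(volume.restrict (Ioi (0 : ℝ))), P r) :
    ∀ᵐ r ∂(volume.restrict (Ioi (0 : ℝ))), P (ρ * r) := by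
  rw [ae_restrict_iff' measurableSet_Ioi, ae_iff] at h ⊢
  have h1 := Real.volume_preimage_mul_left hρ.ne' {r | ¬(r ∈ Ioi 0 → P r)}
  rw [h, mul_zero] at h1
  convert h1 using 2
  ext r
  simp [hρ]

theorem dfn_dilate (hmb : mb ≤ 0) (hρ : 0 < ρ) (x : H2 mb) :
    ∀ᵐ r ∂(volume.restrict (Ioi (0 : ℝ))), dfn (dilate hmb hρ x) r = ρ * dfn x (ρ * r) := by
  filter_upwards [ae_comp_mul_left hρ (ae_hasDerivAt_val x), ae_hasDerivAt_val (dilate hmb hρ x),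
    ae_restrict_mem measurableSet_Ioi] with r h1 h2 hr
  have h3 : HasDerivAt (fun t : ℝ => ρ * t) ρ r := by simpa using (hasDerivAt_id r).const_mul ρ
  have h4 := h1.scomp r h3
  rw [Complex.real_smul] at h4
  refine h2.unique (h4.congr_of_eventuallyEq ?_)
  filter_upwards [Ioi_mem_nhds (mem_Ioi.1 hr)] with t ht
  exact val_dilate hmb hρ x ht

theorem dilate_dilate (hmb : mb ≤ 0) {σ : ℝ} (hρ : 0 < ρ) (hσ : 0 < σ) (h : ρ * σ = 1)
    (x : H2 mb) : dilate hmb hρ (dilate hmb hσ x) = x := by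
  refine H2_ext_val hmb fun r hr => ?_
  rw [val_dilate hmb hρ _ hr, val_dilate hmb hσ _ (mul_pos hρ hr), ← mul_assoc, mul_comm σ, h,
    one_mul]

theorem dilate_smul (hmb : mb ≤ 0) (hρ : 0 < ρ) (α : ℂ) (x : H2 mb) :
    dilate hmb hρ (α • x) = α • dilate hmb hρ x := by
  refine H2_ext_val hmb fun r hr => ?_
  rw [val_dilate hmb hρ _ hr, val_smul hmb (mul_pos hρ hr), val_smul hmb hr, val_dilate hmb hρ _ hr]

theorem dilate_ne_zero (hmb : mb ≤ 0) (hρ : 0 < ρ) {x : H2 mb} (hx : x ≠ 0) :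
    dilate hmb hρ x ≠ 0 := by
  intro h
  have hσ : 0 < ρ⁻¹ := inv_pos.2 hρ
  have h1 := dilate_dilate hmb hσ hρ (inv_mul_cancel₀ hρ.ne') x
  have h2 := dilate_smul hmb hσ 0 (0 : H2 mb)
  rw [h] at h1
  rw [zero_smul, zero_smul] at h2
  exact hx (h1.symm.trans h2)

/-- Dilations of weak solutions are weak solutions, with rescaled coefficients. -/
theorem IsWeakSolution.dilate (hmb : mb ≤ 0) (hρ : 0 < ρ) {x : H2 mb}
    (hx : IsWeakSolution c d s x) :
    IsWeakSolution (c * ρ ^ 4) (d * ρ ^ (1 + s)) s (dilate hmb hρ x) := by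
  intro v
  have hσ : 0 < ρ⁻¹ := inv_pos.2 hρ
  -- The original equation is tested with `v(r/ρ)`. Substitution leaves the derivative and `r⁻¹`
  -- integrals unchanged, while the `r³` and `r^s` integrals acquire `ρ⁴` and `ρ^(1+s)`.
  set v' := QuantumFriedman.dilate hmb hσ v with hv'
  have hv : v = QuantumFriedman.dilate hmb hρ v' :=
    (dilate_dilate hmb hρ hσ (mul_inv_cancel₀ hρ.ne') v).symm
  have h := hx v'
  have hρc : (ρ : ℂ) ≠ 0 := by exact_mod_cast hρ.ne'
  have h1 : ∫ r in Ioi (0 : ℝ), (r : ℂ) *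
        (dfn (QuantumFriedman.dilate hmb hρ x) r * star (dfn v r))
      = ∫ r in Ioi (0 : ℝ), (r : ℂ) * (dfn x r * star (dfn v' r)) := by
    rw [hv]
    refine Eq.trans ?_ (setIntegral_comp_mul_left hρ _)
    refine integral_congr_ae ?_
    filter_upwards [dfn_dilate hmb hρ x, dfn_dilate hmb hρ v'] with r e1 e2
    rw [e1, e2]
    simp only [star_mul', RCLike.star_def, Complex.conj_ofReal, Complex.real_smul]
    push_cast
    ring
  have h2 : ∫ r in Ioi (0 : ℝ), ((-mb * r⁻¹ + c * ρ ^ 4 * r ^ 3 : ℝ) : ℂ) *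
        (val (QuantumFriedman.dilate hmb hρ x) r * star (val v r))
      = ∫ r in Ioi (0 : ℝ), ((-mb * r⁻¹ + c * r ^ 3 : ℝ) : ℂ) * (val x r * star (val v' r)) := by
    rw [hv]
    refine Eq.trans ?_ (setIntegral_comp_mul_left hρ _)
    refine setIntegral_congr_fun measurableSet_Ioi fun r hr => ?_
    have hr0 : (r : ℂ) ≠ 0 := by exact_mod_cast (mem_Ioi.1 hr).ne'
    simp only [val_dilate hmb hρ _ hr, Complex.real_smul]
    push_cast
    field_simp
  have h3 : (ρ ^ (1 + s) : ℝ) * ∫ r in Ioi (0 : ℝ), ((r ^ s : ℝ) : ℂ) *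
        (val (QuantumFriedman.dilate hmb hρ x) r * star (val v r))
      = ∫ r in Ioi (0 : ℝ), ((r ^ s : ℝ) : ℂ) * (val x r * star (val v' r)) := by
    rw [hv, ← integral_const_mul]
    refine Eq.trans ?_ (setIntegral_comp_mul_left hρ _)
    refine setIntegral_congr_fun measurableSet_Ioi fun r hr => ?_
    have hr0 : 0 < r := hr
    simp only [val_dilate hmb hρ _ hr, Complex.real_smul]
    rw [Real.mul_rpow hρ.le hr0.le, Real.rpow_add hρ, Real.rpow_one]
    push_cast
    ring
  rw [h1, h2, h, Complex.ofReal_mul, mul_assoc, h3]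

end Dilation

/-! ### The eigenvalue problem -/

section EigenvalueProblem

variable {mb : ℝ}

theorem integrableOn_mul_val {w : ℝ → ℝ} (hm : Measurable w) (hw : ∀ r > 0, 0 ≤ w r)
    {x v : H2 mb} (hx : IntegrableOn (fun r => w r * ‖val x r‖ ^ 2) (Ioi 0))
    (hv : IntegrableOn (fun r => w r * ‖val v r‖ ^ 2) (Ioi 0)) :
    IntegrableOn (fun r => (w r : ℂ) * (val x r * star (val v r))) (Ioi 0) := by
  have hmx := (continuousOn_val x).aestronglyMeasurable (μ := volume) measurableSet_Ioi
  have hmv := (continuousOn_val v).aestronglyMeasurable (μ := volume) measurableSet_Ioi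
  refine Integrable.mono' (hx.add hv)
    ((Complex.measurable_ofReal.comp hm).aestronglyMeasurable.mul (hmx.mul hmv.star)) ?_
  filter_upwards [ae_restrict_mem measurableSet_Ioi] with r hr
  have h0 := hw r hr
  simp only [norm_mul, Complex.norm_real, Real.norm_of_nonneg h0, norm_star, Pi.add_apply]
  nlinarith [mul_nonneg h0 (sq_nonneg (‖val x r‖ - ‖val v r‖)),
    mul_nonneg h0 (sq_nonneg ‖val x r‖), mul_nonneg h0 (sq_nonneg ‖val v r‖)]

/-- The factor `-mb` stays inside: for `mb = 0` the function `r⁻¹ |x|²` alone need not be integrable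
at `0`. -/
theorem integrableOn_inv_val_sq (hmb : mb ≤ 0) (x : H2 mb) :
    IntegrableOn (fun r => -mb * r⁻¹ * ‖val x r‖ ^ 2) (Ioi 0) := by
  have h := (integrableOn_val_sq hmb x).sub (integrableOn_pow_three_val_sq hmb x)
  refine h.congr (ae_of_all _ fun r => ?_)
  simp only [Pi.sub_apply]
  ring

theorem integral_fn_eq_integral_val (hmb : mb ≤ 0) (w : ℝ → ℂ) (x v : H2 mb) :
    ∫ r in Ioi (0 : ℝ), w r * (fn x r * star (fn v r))
      = ∫ r in Ioi (0 : ℝ), w r * (val x r * star (val v r)) := by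
  refine integral_congr_ae ?_
  filter_upwards [fn_ae_eq_val hmb x, fn_ae_eq_val hmb v] with r h1 h2
  rw [h1, h2]

theorem solvesEigenvalueProblem_iff (hmb : mb ≤ 0) (n : ℕ) (κ L : ℝ) (x : H2 mb) :
    SolvesEigenvalueProblem n κ mb L x ↔ IsWeakSolution (16 / (n : ℝ) ^ 2 * (-L))
      (16 / (n : ℝ) ^ 2 * (-κ)) (1 + 2 * ((n : ℝ) - 2) / n) x := by
  refine forall_congr' fun v => ?_
  rw [integral_fn_eq_integral_val hmb, integral_fn_eq_integral_val hmb,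
    integral_fn_eq_integral_val hmb]
  set c := 16 / (n : ℝ) ^ 2 * (-L) with hc
  have h1 : ∫ r in Ioi (0 : ℝ), ((-mb * r⁻¹ + c * r ^ 3 : ℝ) : ℂ) * (val x r * star (val v r))
      = -mb * (∫ r in Ioi (0 : ℝ), ((r⁻¹ : ℝ) : ℂ) * (val x r * star (val v r)))
        + c * (∫ r in Ioi (0 : ℝ), ((r ^ 3 : ℝ) : ℂ) * (val x r * star (val v r))) := by
    have e1 := integrableOn_mul_val (w := fun r => -mb * r⁻¹) (by fun_prop)
      (fun r hr => mul_nonneg (by linarith) (inv_nonneg.2 hr.le))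
      (integrableOn_inv_val_sq hmb x) (integrableOn_inv_val_sq hmb v)
    have e2 := integrableOn_mul_val (w := fun r => r ^ 3) (by fun_prop)
      (fun r hr => pow_nonneg hr.le 3)
      (integrableOn_pow_three_val_sq hmb x) (integrableOn_pow_three_val_sq hmb v)
    -- Pulling constants through needs no integrability; if `∫ r⁻¹ x v̄` diverges, which can only
    -- happen for `mb = 0`, its default value is multiplied by zero.
    rw [← integral_const_mul, ← integral_const_mul]
    refine Eq.trans ?_ ((integral_add e1 (e2.const_mul (c : ℂ))).trans ?_)
    · refine integral_congr_ae (ae_of_all _ fun r => ?_)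
      push_cast
      ring
    · congr 1
      refine integral_congr_ae (ae_of_all _ fun r => ?_)
      push_cast
      ring
  have h2 : ∫ r in Ioi (0 : ℝ), ((r * r ^ (2 * ((n : ℝ) - 2) / n) : ℝ) : ℂ)
        * (val x r * star (val v r))
      = ∫ r in Ioi (0 : ℝ), ((r ^ (1 + 2 * ((n : ℝ) - 2) / n) : ℝ) : ℂ)
        * (val x r * star (val v r)) := by
    refine setIntegral_congr_fun measurableSet_Ioi fun r hr => ?_
    rw [Real.rpow_add hr, Real.rpow_one]
  rw [h1, h2, hc]
  push_cast
  constructor <;> intro h <;> linear_combination h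

end EigenvalueProblem

/-! ### Generalized eigenvalue problems with compact forms -/

/-- An infinite set of real numbers which has only finitely many elements below each bound is
the range of a strictly increasing sequence. -/
theorem exists_strictMono_range_eq {D : Set ℝ} (hD : D.Infinite)
    (hfin : ∀ R, (D ∩ Iic R).Finite) :
    ∃ d : ℕ → ℝ, StrictMono d ∧ range d = D ∧ Tendsto d atTop atTop := by
  classical
  have hIcc : ∀ a b : D, (Icc a b).Finite := by
    intro a b
    refine Finite.of_finite_image ((hfin b).subset ?_) Subtype.val_injective.injOn
    rintro _ ⟨r, hr, rfl⟩
    exact ⟨r.2, hr.2⟩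
  -- A locally finite linear order with a least and no greatest element is isomorphic to `ℕ`; the
  -- isomorphism is the enumeration sought.
  let : LocallyFiniteOrder D := LocallyFiniteOrder.ofFiniteIcc hIcc
  have : Infinite D := hD.to_subtype
  obtain ⟨r₀, hr₀⟩ := hD.nonempty
  obtain ⟨m, hm, hmin⟩ := (hfin r₀).exists_minimalFor id _ ⟨r₀, hr₀, mem_Iic.2 le_rfl⟩
  have hleast : ∀ r ∈ D, m ≤ r := by
    intro r hr
    by_contra! h
    exact h.not_ge (hmin ⟨hr, h.le.trans hm.2⟩ h.le)
  let : OrderBot D := { bot := ⟨m, hm.1⟩, bot_le := fun r => hleast r r.2 }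
  have : NoMaxOrder D := by
    refine ⟨fun a => ?_⟩
    by_contra! h
    refine hD ((hfin a).subset fun r hr => ⟨hr, ?_⟩)
    exact h ⟨r, hr⟩
  let : SuccOrder D := LinearLocallyFiniteOrder.succOrder D
  let : PredOrder D := LinearLocallyFiniteOrder.predOrder D
  let Φ : D ≃o ℕ := orderIsoNatOfLinearSuccPredArch
  have hmono : StrictMono fun i => (Φ.symm i : ℝ) := fun i j hij => Φ.symm.strictMono hij
  have hrange : range (fun i => (Φ.symm i : ℝ)) = D := by
    ext r
    refine ⟨?_, fun hr => ⟨Φ ⟨r, hr⟩, by simp⟩⟩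
    rintro ⟨i, rfl⟩
    exact (Φ.symm i).2
  refine ⟨_, hmono, hrange, tendsto_atTop_atTop_of_monotone hmono.monotone fun R => ?_⟩
  by_contra! h
  refine hD ((hfin R).subset fun r hr => ⟨hr, ?_⟩)
  rw [← hrange] at hr
  obtain ⟨i, rfl⟩ := hr
  exact (h i).le

/-! ### Compact positive operators and bases of eigenvectors -/

section Spectral

variable {X : Type*} [NormedAddCommGroup X] [InnerProductSpace ℂ X] {K : X →L[ℂ] X}

/-- The reciprocals of the positive eigenvalues. -/
def reciprocalEigenvalues (K : X →L[ℂ] X) : Set ℝ :=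
  {d | 0 < d ∧ ∃ x, x ≠ 0 ∧ K x = ((d⁻¹ : ℝ) : ℂ) • x}

theorem inner_eq_zero_of_eigenvectors (hsym : K.IsSymmetric) {a b : ℝ} (hab : a ≠ b) {x y : X}
    (hx : K x = (a : ℂ) • x) (hy : K y = (b : ℂ) • y) : inner ℂ x y = 0 := by
  have h : inner ℂ (K x) y = inner ℂ x (K y) := hsym x y
  rw [hx, hy, inner_smul_left, inner_smul_right, Complex.conj_ofReal] at h
  have h2 : ((a : ℂ) - b) * inner ℂ x y = 0 := by rw [sub_mul, h, sub_self]
  refine (mul_eq_zero.1 h2).resolve_left ?_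
  exact fun h => hab (by exact_mod_cast sub_eq_zero.1 h)

/-- Otherwise infinitely many orthonormal eigenvectors would have eigenvalues at least `1/R`; their
images would lie at mutual distance at least `1/R`, contradicting compactness. -/
theorem finite_reciprocalEigenvalues_inter_Iic (hK : IsCompactOperator K) (hsym : K.IsSymmetric)
    (R : ℝ) : (reciprocalEigenvalues K ∩ Iic R).Finite := by
  by_contra hinf
  have hinf : (reciprocalEigenvalues K ∩ Iic R).Infinite := hinf
  set d : ℕ → ℝ := fun n => (hinf.natEmbedding _ n : ℝ) with hd
  have hdinj : Function.Injective d := fun i j h =>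
    (hinf.natEmbedding _).injective (Subtype.ext h)
  have hdpos : ∀ n, 0 < d n := fun n => (hinf.natEmbedding _ n).2.1.1
  have hdR : ∀ n, d n ≤ R := fun n => (hinf.natEmbedding _ n).2.2
  have hR : 0 < R := (hdpos 0).trans_le (hdR 0)
  have hex : ∀ n, ∃ x : X, ‖x‖ = 1 ∧ K x = (((d n)⁻¹ : ℝ) : ℂ) • x := by
    intro n
    obtain ⟨x, hx0, hx⟩ := (hinf.natEmbedding _ n).2.1.2
    refine ⟨((‖x‖⁻¹ : ℝ) : ℂ) • x, ?_, ?_⟩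
    · rw [norm_smul, Complex.norm_real, norm_inv, norm_norm,
        inv_mul_cancel₀ (norm_ne_zero_iff.2 hx0)]
    · rw [map_smul, hx, smul_comm]
  choose e he1 heK using hex
  have horth : ∀ i j, i ≠ j → inner ℂ (e i) (e j) = 0 := fun i j hij =>
    inner_eq_zero_of_eigenvectors hsym (fun h => hij (hdinj (inv_injective h))) (heK i) (heK j)
  obtain ⟨C, hC, hsub⟩ := hK.image_closedBall_subset_compact 1
  obtain ⟨a, -, φ, hφ, hlim⟩ := hC.tendsto_subseq (x := fun n => K (e n))
    fun n => hsub ⟨e n, by simp [he1], rfl⟩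
  have hcauchy := hlim.cauchySeq
  rw [Metric.cauchySeq_iff'] at hcauchy
  obtain ⟨N, hN⟩ := hcauchy R⁻¹ (inv_pos.2 hR)
  have h1 := hN (N + 1) (Nat.le_succ N)
  simp only [Function.comp] at h1
  have hne : φ (N + 1) ≠ φ N := (hφ (Nat.lt_succ_self N)).ne'
  rw [dist_eq_norm, heK, heK] at h1
  set a1 := (d (φ (N + 1)))⁻¹
  set a2 := (d (φ N))⁻¹
  have h2 : ‖(a1 : ℂ) • e (φ (N + 1)) - (a2 : ℂ) • e (φ N)‖ ^ 2 = a1 ^ 2 + a2 ^ 2 := by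
    rw [@norm_sub_sq ℂ, inner_smul_left, inner_smul_right, horth _ _ hne, norm_smul, norm_smul,
      he1, he1]
    simp
  have h3 : R⁻¹ ≤ a1 := inv_anti₀ (hdpos _) (hdR _)
  have h4 : 0 < R⁻¹ := inv_pos.2 hR
  nlinarith [norm_nonneg ((a1 : ℂ) • e (φ (N + 1)) - (a2 : ℂ) • e (φ N)), sq_nonneg a2]

variable [CompleteSpace X]

/-- The spectral theorem for positive compact operators with simple eigenvalues on an infinite
dimensional space. -/
theorem exists_hilbertBasis_of_simple (hK : IsCompactOperator K) (hsym : K.IsSymmetric)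
    (hpos : ∀ x, ∃ t : ℝ, inner ℂ x (K x) = t ∧ (x ≠ 0 → 0 < t))
    (hsimple : ∀ d : ℝ, ∀ x y, K x = ((d⁻¹ : ℝ) : ℂ) • x → K y = ((d⁻¹ : ℝ) : ℂ) • y → y ≠ 0 →
      ∃ α : ℂ, x = α • y)
    (hdim : ¬ FiniteDimensional ℂ X) :
    ∃ (d : ℕ → ℝ) (b : HilbertBasis ℕ ℂ X), StrictMono d ∧ (∀ i, 0 < d i) ∧
      Tendsto d atTop atTop ∧ (∀ i, K (b i) = (((d i)⁻¹ : ℝ) : ℂ) • b i) ∧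
      ∀ d' : ℝ, 0 < d' → ∀ x, x ≠ 0 → K x = ((d'⁻¹ : ℝ) : ℂ) • x → ∃ i, d' = d i := by
  classical
  set D := reciprocalEigenvalues K with hD
  have hex : ∀ d : D, ∃ x : X, ‖x‖ = 1 ∧ K x = (((d : ℝ)⁻¹ : ℝ) : ℂ) • x := by
    intro d
    obtain ⟨x, hx0, hx⟩ := d.2.2
    refine ⟨((‖x‖⁻¹ : ℝ) : ℂ) • x, ?_, ?_⟩
    · rw [norm_smul, Complex.norm_real, norm_inv, norm_norm,
        inv_mul_cancel₀ (norm_ne_zero_iff.2 hx0)]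
    · rw [map_smul, hx, smul_comm]
  choose e he1 heK using hex
  have horth : Orthonormal ℂ e := by
    refine ⟨he1, fun i j hij => ?_⟩
    exact inner_eq_zero_of_eigenvectors hsym
      (fun h => hij (Subtype.ext (inv_injective h))) (heK i) (heK j)
  -- The eigenspaces of a compact self-adjoint operator span a dense subspace. Positivity makes
  -- every eigenvalue positive, excluding a kernel, and by simplicity each eigenvector is a multiple
  -- of some `e δ`.
  have hspan : (Submodule.span ℂ (range e))ᗮ = ⊥ := by
    rw [eq_bot_iff, ← ContinuousLinearMap.orthogonalComplement_iSup_eigenspaces_eq_bot hK hsym]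
    refine Submodule.orthogonal_le (iSup_le fun μ x hx => ?_)
    have hKx : K x = μ • x := Module.End.mem_eigenspace_iff.1 hx
    by_cases hx0 : x = 0
    · rw [hx0]; exact Submodule.zero_mem _
    obtain ⟨t, ht, htpos⟩ := hpos x
    have hnx : 0 < ‖x‖ := norm_pos_iff.2 hx0
    have hμ : μ = ((t / ‖x‖ ^ 2 : ℝ) : ℂ) := by
      rw [hKx, inner_smul_right, inner_self_eq_norm_sq_to_K] at ht
      have : ((‖x‖ : ℝ) : ℂ) ^ 2 ≠ 0 := by exact_mod_cast (pow_pos hnx 2).ne'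
      push_cast
      rw [eq_div_iff this]
      exact ht
    have hd0 : 0 < t / ‖x‖ ^ 2 := div_pos (htpos hx0) (by positivity)
    set δ : ℝ := (t / ‖x‖ ^ 2)⁻¹ with hδ
    have hδ' : K x = ((δ⁻¹ : ℝ) : ℂ) • x := by rw [hδ, inv_inv, ← hμ, hKx]
    have hmem : δ ∈ D := ⟨inv_pos.2 hd0, x, hx0, hδ'⟩
    have hne : e ⟨δ, hmem⟩ ≠ 0 := fun h => by simpa [h] using he1 ⟨δ, hmem⟩
    obtain ⟨α, hα⟩ := hsimple δ x _ hδ' (heK ⟨δ, hmem⟩) hne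
    rw [hα]
    exact Submodule.smul_mem _ _ (Submodule.subset_span ⟨_, rfl⟩)
  have hinf : D.Infinite := by
    intro hfin
    have : Finite D := hfin
    have hfd : FiniteDimensional ℂ (Submodule.span ℂ (range e)) :=
      FiniteDimensional.span_of_finite ℂ (finite_range e)
    have htop : Submodule.span ℂ (range e) = ⊤ := (Submodule.orthogonal_eq_bot_iff).1 hspan
    rw [htop] at hfd
    exact hdim (Submodule.topEquiv.finiteDimensional)
  obtain ⟨d, hdm, hdr, hdt⟩ := exists_strictMono_range_eq hinf
    (finite_reciprocalEigenvalues_inter_Iic hK hsym)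
  have hmem : ∀ i, d i ∈ D := fun i => hdr ▸ mem_range_self i
  let f : ℕ → D := fun i => ⟨d i, hmem i⟩
  have hf : Function.Injective f := fun i j h => hdm.injective (congrArg Subtype.val h)
  have hfs : Function.Surjective f := by
    rintro ⟨r, hr⟩
    obtain ⟨i, hi⟩ := (hdr.symm ▸ hr : r ∈ range d)
    exact ⟨i, Subtype.ext hi⟩
  have hsp : (Submodule.span ℂ (range (e ∘ f)))ᗮ = ⊥ := by
    rw [hfs.range_comp]; exact hspan
  refine ⟨d, HilbertBasis.mkOfOrthogonalEqBot (horth.comp f hf) hsp, hdm, fun i => (hmem i).1, hdt,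
    fun i => ?_, fun d' hd' x hx0 hx => ?_⟩
  · rw [HilbertBasis.coe_mkOfOrthogonalEqBot]
    exact heK (f i)
  · obtain ⟨i, hi⟩ := (hdr.symm ▸ (⟨hd', x, hx0, hx⟩ : d' ∈ D) : d' ∈ range d)
    exact ⟨i, hi.symm⟩

variable {H G : Type*} [NormedAddCommGroup H] [NormedSpace ℂ H] [CompleteSpace H]
  [NormedAddCommGroup G] [InnerProductSpace ℂ G] [CompleteSpace G]

/-- The image of an unconditional basis under an isomorphism. -/
def mapBasis {ι : Type*} (b : UnconditionalSchauderBasis ι ℂ X) (e : X ≃L[ℂ] H) :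
    UnconditionalSchauderBasis ι ℂ H where
  basis := fun i => e (b i)
  coord := fun i => (b.coord i).comp (e.symm : H →L[ℂ] X)
  ortho := fun i j => by simpa using b.ortho i j
  expansion := fun x => by
    have h := (b.expansion (e.symm x)).mapL (e : X →L[ℂ] H)
    simpa using h

/-- The eigenvectors of the problem `⟪T v, T x⟫ = d ⟪J v, J x⟫ ∀ v`, in which `J` is compact, form
an unconditional basis if the eigenvalues are simple. -/
theorem exists_eigenbasis {T : H →L[ℂ] X} {J : H →L[ℂ] G} {C : NNReal}
    (hT : ∀ x, ‖x‖ ≤ C * ‖T x‖) (hJ : IsCompactOperator J) (hJi : Function.Injective J)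
    (hdim : ¬ FiniteDimensional ℂ H)
    (hsimple : ∀ d : ℝ, ∀ x y, (∀ v, inner ℂ (T v) (T x) = d * inner ℂ (J v) (J x)) →
      (∀ v, inner ℂ (T v) (T y) = d * inner ℂ (J v) (J y)) → y ≠ 0 → ∃ α : ℂ, x = α • y) :
    ∃ (d : ℕ → ℝ) (b : UnconditionalSchauderBasis ℕ ℂ H), StrictMono d ∧ (∀ i, 0 < d i) ∧
      Tendsto d atTop atTop ∧ (∀ i, b i ≠ 0) ∧
      (∀ i v, inner ℂ (T v) (T (b i)) = d i * inner ℂ (J v) (J (b i))) ∧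
      ∀ d' : ℝ, 0 < d' → ∀ x, x ≠ 0 → (∀ v, inner ℂ (T v) (T x) = d' * inner ℂ (J v) (J x)) →
        ∃ i, d' = d i := by
  -- `T` is bounded below, so its range is a Hilbert space isomorphic to `H`, carrying the scalar
  -- product `⟪T v, T x⟫`.
  have hanti : AntilipschitzWith C T := T.antilipschitz_of_bound hT
  have hcl : IsClosed (range T) := hanti.isClosed_range T.uniformContinuous
  let e := T.equivRange hanti.injective hcl
  have he : ∀ x, (e x : X) = T x := fun x => rfl
  have : CompleteSpace T.toLinearMap.range := hcl.completeSpace_coe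
  let A : T.toLinearMap.range →L[ℂ] G := J.comp (e.symm : T.toLinearMap.range →L[ℂ] H)
  have hA : ∀ x, A (e x) = J x := fun x => by simp [A]
  -- `K = A* A` represents the form `⟪J v, J x⟫` with respect to the energy product; the problem
  -- with parameter `d` becomes `K z = d⁻¹ z`.
  let K := (ContinuousLinearMap.adjoint A).comp A
  have hKin : ∀ w z, inner ℂ w (K z) = inner ℂ (A w) (A z) := fun w z =>
    ContinuousLinearMap.adjoint_inner_right A w (A z)
  have hAc : IsCompactOperator A := hJ.comp_clm (e.symm : T.toLinearMap.range →L[ℂ] H)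
  have hKc : IsCompactOperator K := hAc.clm_comp (ContinuousLinearMap.adjoint A)
  have hsym : K.IsSymmetric := fun w z => by
    change inner ℂ (K w) z = inner ℂ w (K z)
    rw [hKin]
    exact ContinuousLinearMap.adjoint_inner_left A z (A w)
  have hAi : Function.Injective A := hJi.comp e.symm.injective
  have heig : ∀ d : ℝ, d ≠ 0 → ∀ x, K (e x) = ((d⁻¹ : ℝ) : ℂ) • e x ↔
      ∀ v, inner ℂ (T v) (T x) = d * inner ℂ (J v) (J x) := by
    intro d hd x
    have hdc : (d : ℂ) ≠ 0 := by exact_mod_cast hd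
    have h1 : ∀ v, inner ℂ (e v) (K (e x)) = inner ℂ (J v) (J x) := fun v => by
      rw [hKin, hA, hA]
    have h2 : ∀ v, inner ℂ (e v) (e x) = inner ℂ (T v) (T x) := fun v => rfl
    constructor
    · intro h v
      rw [← h1 v, h, inner_smul_right, h2]
      push_cast
      rw [← mul_assoc, mul_inv_cancel₀ hdc, one_mul]
    · intro h
      refine ext_inner_left ℂ fun w => ?_
      obtain ⟨v, rfl⟩ := e.surjective w
      rw [h1, inner_smul_right, h2, h]
      push_cast
      rw [← mul_assoc, inv_mul_cancel₀ hdc, one_mul]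
  have hpos : ∀ z, ∃ t : ℝ, inner ℂ z (K z) = t ∧ (z ≠ 0 → 0 < t) := by
    intro z
    refine ⟨‖A z‖ ^ 2, ?_, fun hz => ?_⟩
    · rw [hKin, inner_self_eq_norm_sq_to_K]
      push_cast; rfl
    · have : A z ≠ 0 := fun h => hz (hAi (h.trans (map_zero A).symm))
      exact pow_pos (norm_pos_iff.2 this) 2
  have hdim' : ¬ FiniteDimensional ℂ T.toLinearMap.range := fun h =>
    hdim (e.symm.toLinearEquiv.finiteDimensional)
  have hsimple' : ∀ d : ℝ, ∀ z w, K z = ((d⁻¹ : ℝ) : ℂ) • z → K w = ((d⁻¹ : ℝ) : ℂ) • w → w ≠ 0 →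
      ∃ α : ℂ, z = α • w := by
    intro d z w hz hw hw0
    obtain ⟨x, rfl⟩ := e.surjective z
    obtain ⟨y, rfl⟩ := e.surjective w
    -- With the convention `0⁻¹ = 0`, the value `d = 0` would mean `K w = 0`, which injectivity of
    -- `J` forbids.
    have hd : d ≠ 0 := by
      rintro rfl
      obtain ⟨t, ht, htp⟩ := hpos (e y)
      rw [hw] at ht
      have ht0 := htp hw0
      simp only [inv_zero, Complex.ofReal_zero, zero_smul, inner_zero_right] at ht
      exact ht0.ne (by exact_mod_cast ht)
    obtain ⟨α, hα⟩ := hsimple d x y ((heig d hd x).1 hz) ((heig d hd y).1 hw)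
      fun h => hw0 (by rw [h, map_zero])
    exact ⟨α, by rw [hα, map_smul]⟩
  obtain ⟨d, b, hdm, hd0, hdt, hb, hall⟩ :=
    exists_hilbertBasis_of_simple hKc hsym hpos hsimple' hdim'
  have hbe : ∀ i, e (e.symm (b i)) = b i := fun i => e.apply_symm_apply _
  -- Pulling the Hilbert basis back by an isomorphism that need not be isometric loses orthogonality
  -- in `H` but keeps an unconditional basis.
  refine ⟨d, mapBasis b.toUnconditionalSchauderBasis e.symm, hdm, hd0, hdt, fun i h => ?_, fun i => ?_,
    fun d' hd' x hx0 hx => ?_⟩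
  · have h0 : b i = 0 := by
      rw [← hbe i]
      exact (congrArg e h).trans (map_zero e)
    have h1 := b.orthonormal.1 i
    rw [h0, norm_zero] at h1
    exact zero_ne_one h1
  · refine (heig (d i) (hd0 i).ne' _).1 ?_
    have := hb i
    rw [← hbe i] at this
    exact this
  · exact hall d' hd' (e x) (fun h => hx0 (e.injective (h.trans (map_zero e).symm)))
      ((heig d' hd'.ne' x).2 hx)

end Spectral

/-! ### The eigenfunctions as bases -/

section Bases

variable {mb c d d' s : ℝ}

/-- Bumps around the points `k + 1` are biorthogonal to the evaluations there. Infinite dimension is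
what makes the sequence of eigenvalues infinite. -/
theorem not_finiteDimensional_H2 (hmb : mb ≤ 0) : ¬ FiniteDimensional ℂ (H2 mb) := by
  intro hfd
  let β : (k : ℕ) → ContDiffBump ((k : ℝ) + 1) := fun _ => ⟨1 / 4, 1 / 2, by norm_num, by norm_num⟩
  have hs : ∀ k, tsupport (β k) ⊆ Ioi 0 := by
    intro k r hr
    rw [(β k).tsupport_eq, Real.closedBall_eq_Icc] at hr
    have h1 : (k : ℝ) + 1 - 1 / 2 ≤ r := hr.1
    have h2 : (0 : ℝ) ≤ k := k.cast_nonneg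
    simp only [mem_Ioi]
    linarith
  have hpos : ∀ k : ℕ, (0 : ℝ) < (k : ℝ) + 1 := fun k => by positivity
  have hli : LinearIndependent ℂ
      fun k => ofTest mb (realTest (β k).contDiff (β k).hasCompactSupport (hs k)) := by
    refine LinearIndependent.of_pairwise_dual_eq_zero_one _
      (fun j => (evalCLM hmb (hpos j)).toLinearMap) (fun j k hjk => ?_) fun k => ?_
    · change evalCLM hmb (hpos j) _ = 0
      rw [evalCLM_apply, val_ofTest hmb _ (hpos j), realTest_apply, (β k).zero_of_le_dist]
      · exact Complex.ofReal_zero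
      · have h1 : (1 : ℝ) ≤ |(j : ℝ) - k| := by
          have : (1 : ℤ) ≤ |(j : ℤ) - k| := Int.one_le_abs (sub_ne_zero.2 (by exact_mod_cast hjk))
          exact_mod_cast this
        rw [Real.dist_eq, add_sub_add_right_eq_sub]
        exact (by norm_num : (1 / 2 : ℝ) ≤ 1).trans h1
    · change evalCLM hmb (hpos k) _ = 1
      rw [evalCLM_apply, val_ofTest hmb _ (hpos k), realTest_apply, (β k).one_of_mem_closedBall]
      · exact Complex.ofReal_one
      · exact Metric.mem_closedBall_self (β k).rIn_pos.le
  have := hli.finite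
  exact not_finite ℕ

/-- The test functions are dense in the weighted `L²` spaces. -/
theorem topologicalClosure_range_embedPow (hmb : mb ≤ 0) (hs : 1 ≤ s) (hs3 : s ≤ 3) :
    (embedPow hmb hs hs3).toLinearMap.range.topologicalClosure = ⊤ := by
  rw [Submodule.topologicalClosure_eq_top_iff, Submodule.eq_bot_iff]
  intro g hg
  obtain ⟨hgm, hgi⟩ := (memLp_weighted_iff (measurable_rpow_weight s) (rpow_weight_pos s) _).1
    (Lp.memLp g)
  have hcont : ContinuousOn (fun r : ℝ => r ^ s) (Ioi 0) := fun r hr =>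
    (Real.continuousAt_rpow_const r s (Or.inl (mem_Ioi.1 hr).ne')).continuousWithinAt
  have hloc : LocallyIntegrableOn (fun r => ((r ^ s : ℝ) : ℂ) * g r) (Ioi 0) := by
    refine locallyIntegrableOn_of_intervalIntegrable fun a b ha hb => ?_
    have hsub : uIoc a b ⊆ Ioi 0 := fun r hr => (lt_min ha hb).trans hr.1
    have hsub' : uIcc a b ⊆ Ioi 0 := fun r hr => (lt_min ha hb).trans_le hr.1
    rw [intervalIntegrable_iff]
    have h1 : IntegrableOn (fun r : ℝ => r ^ s) (uIoc a b) :=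
      intervalIntegrable_iff.1 (hcont.mono hsub').intervalIntegrable
    refine Integrable.mono' (h1.add (hgi.mono_set hsub))
      ((Complex.measurable_ofReal.comp (measurable_rpow_weight s)).aestronglyMeasurable.mul
        (hgm.mono_measure (Measure.restrict_mono hsub le_rfl))) ?_
    filter_upwards [ae_restrict_mem measurableSet_uIoc] with r hr
    have hr0 := rpow_weight_pos s r (hsub hr)
    rw [norm_mul, Complex.norm_real, Real.norm_of_nonneg hr0.le, Pi.add_apply]
    nlinarith [sq_nonneg (‖g r‖ - 1), norm_nonneg (g r),
      mul_nonneg hr0.le (sq_nonneg (‖g r‖ - 1)), mul_nonneg hr0.le (norm_nonneg (g r))]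
  -- An element orthogonal to all test functions has `r^s g = 0` as a distribution.
  have hzero := isOpen_Ioi.ae_eq_zero_of_integral_contDiff_smul_eq_zero hloc fun φ hφ hφc hφs => by
    have h1 : inner ℂ (embedPow hmb hs hs3 (ofTest mb (realTest hφ hφc hφs))) g = 0 :=
      hg _ ⟨_, rfl⟩
    rw [inner_weighted (measurable_rpow_weight s) (rpow_weight_pos s)] at h1
    rw [← setIntegral_Ioi_eq_integral, ← h1]
    · refine integral_congr_ae ?_
      filter_upwards [coeFn_embed hmb (measurable_rpow_weight s) (rpow_weight_pos s)
        (embedsWithBound_rpow hmb hs hs3) (ofTest mb (realTest hφ hφc hφs)),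
        ae_restrict_mem measurableSet_Ioi] with r h2 hr
      rw [embedPow, h2, val_ofTest hmb _ hr, realTest_apply, Complex.real_smul]
      simp only [RCLike.star_def, Complex.conj_ofReal]
      ring
    · intro r hr
      rw [image_eq_zero_of_notMem_tsupport fun h => hr (hφs h), zero_smul]
  have h2 : ∀ᵐ r ∂(volume.restrict (Ioi (0 : ℝ))), g r = 0 := by
    rw [ae_restrict_iff' measurableSet_Ioi]
    filter_upwards [hzero] with r hr h0
    refine (mul_eq_zero.1 (hr h0)).resolve_left ?_
    exact_mod_cast (rpow_weight_pos s r h0).ne'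
  refine (Lp.eq_zero_iff_ae_eq_zero).2 ?_
  change ∀ᵐ r ∂(weighted fun r => r ^ s), g r = 0
  rwa [ae_weighted (measurable_rpow_weight s) (rpow_weight_pos s)]

theorem topologicalClosure_span_basis {E : Type*} [NormedAddCommGroup E] [NormedSpace ℂ E]
    {ι : Type*} (b : UnconditionalSchauderBasis ι ℂ E) :
    (Submodule.span ℂ (range b)).topologicalClosure = ⊤ := by
  refine eq_top_iff.2 fun x _ => ?_
  refine mem_closure_of_tendsto (b.expansion x) (Eventually.of_forall fun t => ?_)
  exact Submodule.sum_mem _ fun i _ => Submodule.smul_mem _ _ (Submodule.subset_span ⟨i, rfl⟩)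

theorem topologicalClosure_span_image {E F ι : Type*} [NormedAddCommGroup E] [NormedSpace ℂ E]
    [NormedAddCommGroup F] [NormedSpace ℂ F] (A : E →L[ℂ] F)
    (hA : A.toLinearMap.range.topologicalClosure = ⊤) {b : ι → E}
    (hb : (Submodule.span ℂ (range b)).topologicalClosure = ⊤) :
    (Submodule.span ℂ (range fun i => A (b i))).topologicalClosure = ⊤ := by
  refine top_unique (hA ▸ Submodule.topologicalClosure_minimal _ ?_
    (Submodule.isClosed_topologicalClosure _))
  rintro _ ⟨x, rfl⟩
  have hx : x ∈ closure (Submodule.span ℂ (range b) : Set E) := by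
    rw [← Submodule.topologicalClosure_coe, hb]; trivial
  have h1 := map_mem_closure A.continuous hx (t := (Submodule.span ℂ (range fun i => A (b i)) : Set F))
    fun y hy => by
      have : A.toLinearMap y ∈ (Submodule.span ℂ (range b)).map A.toLinearMap :=
        Submodule.mem_map_of_mem hy
      rw [Submodule.map_span, ← range_comp] at this
      exact this
  exact h1

/-- The energy form is Hermitian, so testing each equation with the other solution gives `d ⟪x, y⟫ =
d' ⟪x, y⟫` for the weight `r^s`. -/
theorem IsWeakSolution.inner_embedPow_eq_zero (hmb : mb ≤ 0) (hc : 0 < c) (hs : 1 ≤ s)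
    (hs3 : s ≤ 3) {x y : H2 mb} (hx : IsWeakSolution c d s x) (hy : IsWeakSolution c d' s y)
    (hd : d ≠ d') : inner ℂ (embedPow hmb hs hs3 x) (embedPow hmb hs hs3 y) = 0 := by
  have h1 := (isWeakSolution_iff_inner hmb hc hs hs3 y).1 hy x
  have h2 := congrArg (starRingEnd ℂ) ((isWeakSolution_iff_inner hmb hc hs hs3 x).1 hx y)
  rw [map_mul, inner_conj_symm, inner_conj_symm, Complex.conj_ofReal, h1] at h2
  have h3 : ((d' : ℂ) - d) * inner ℂ (embedPow hmb hs hs3 x) (embedPow hmb hs hs3 y) = 0 := by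
    rw [sub_mul, h2, sub_self]
  refine (mul_eq_zero.1 h3).resolve_left fun h => hd ?_
  exact_mod_cast (sub_eq_zero.1 h).symm

/-- A basis of `H₂(μ̄)` of eigenfunctions is a complete minimal system in `L²(I,1)`. -/
theorem isCompleteMinimal_embedPow_one (hmb : mb ≤ 0) (hc : 0 < c) (hs : 1 ≤ s) (hs3 : s < 3)
    {d : ℕ → ℝ} (hd : Function.Injective d) (b : UnconditionalSchauderBasis ℕ ℂ (H2 mb))
    (hb : ∀ i, IsWeakSolution c (d i) s (b i)) (hb0 : ∀ i, b i ≠ 0) :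
    IsCompleteMinimal fun i => embedPow hmb (s := 1) le_rfl (by norm_num) (b i) := by
  refine ⟨topologicalClosure_span_image _ (topologicalClosure_range_embedPow hmb _ _)
    (topologicalClosure_span_basis b), ?_⟩
  set J := embedPow hmb hs hs3.le
  -- Pairing with `r^(s-1) b i` in `L²(I,1)` is pairing with `b i` in `L²(I,s)`, where the
  -- eigenfunctions are orthogonal; dividing by the squared norm gives the biorthogonal functionals.
  let g : ℕ → L2 1 := fun i => ((hb i).memLp_rpow_mul hmb hc hs hs3).toLp _
  have hg : ∀ i j, inner ℂ (g i) (embedPow hmb (s := 1) le_rfl (by norm_num) (b j))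
      = inner ℂ (J (b i)) (J (b j)) := by
    intro i j
    rw [inner_weighted (measurable_rpow_weight 1) (rpow_weight_pos 1)]
    simp only [J]
    rw [embedPow, embedPow, inner_embed]
    refine integral_congr_ae ?_
    have h1 := ((hb i).memLp_rpow_mul hmb hc hs hs3).coeFn_toLp
    change ∀ᶠ _ in _, _ at h1
    rw [ae_weighted (measurable_rpow_weight 1) (rpow_weight_pos 1)] at h1
    filter_upwards [h1, coeFn_embed hmb (measurable_rpow_weight 1) (rpow_weight_pos 1)
      (embedsWithBound_rpow hmb le_rfl (by norm_num)) (b j), ae_restrict_mem measurableSet_Ioi]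
      with r h2 h3 hr
    rw [h2, h3, star_mul', RCLike.star_def, Complex.conj_ofReal, Real.rpow_one]
    have h4 : r ^ s = r * r ^ (s - 1) := by
      rw [← Real.rpow_one_add' (mem_Ioi.1 hr).le (by linarith)]
      congr 1; ring
    rw [h4]
    push_cast
    ring
  refine ⟨fun i => (inner ℂ (J (b i)) (J (b i)))⁻¹ • innerSL ℂ (g i), fun i j => ?_⟩
  change (inner ℂ (J (b i)) (J (b i)))⁻¹ * inner ℂ (g i) _ = _
  rw [hg]
  split_ifs with hij
  · subst hij
    refine inv_mul_cancel₀ fun h => hb0 i ?_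
    exact embed_injective hmb _ _ _ ((inner_self_eq_zero.1 h).trans (map_zero J).symm)
  · rw [(hb i).inner_embedPow_eq_zero hmb hc hs hs3.le (hb j) (fun h => hij (hd h)), mul_zero]

/-- The eigenfunctions of the problem with the eigenvalue parameter on the right-hand side form a
basis; the eigenvalues are written as `a ρ^(1+s)`. -/
theorem exists_basis_of_weakSolutions (hmb : mb ≤ 0) (hc : 0 < c) (hs : 1 ≤ s) (hs3 : s < 3)
    {a : ℝ} (ha : 0 < a) :
    ∃ (ρ : ℕ → ℝ) (b : UnconditionalSchauderBasis ℕ ℂ (H2 mb)), StrictMono ρ ∧ (∀ i, 0 < ρ i) ∧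
      Tendsto ρ atTop atTop ∧ (∀ i, b i ≠ 0) ∧
      (∀ i, IsWeakSolution c (a * ρ i ^ (1 + s)) s (b i)) ∧
      ∀ σ > 0, ∀ x : H2 mb, x ≠ 0 → IsWeakSolution c (a * σ ^ (1 + s)) s x → ∃ i, σ = ρ i := by
  have hT : ∀ x, ‖x‖ ≤ (Real.toNNReal (Real.sqrt (1 + c⁻¹)) : ℝ) * ‖energyMap hmb hc x‖ := by
    intro x
    rw [Real.coe_toNNReal _ (Real.sqrt_nonneg _)]
    refine abs_le_of_sq_le_sq' ?_ (by positivity) |>.2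
    rw [mul_pow, Real.sq_sqrt (by positivity)]
    exact norm_le_energyMap hmb hc x
  obtain ⟨d, b, hdm, hd0, hdt, hb0, hb, hall⟩ := exists_eigenbasis hT
    (isCompactOperator_embedPow hmb hs hs3) (embed_injective hmb _ _ _)
    (not_finiteDimensional_H2 hmb) fun d x y hx hy hy0 =>
      ((isWeakSolution_iff_inner hmb hc hs hs3.le x).2 hx).exists_eq_smul hmb
        ((isWeakSolution_iff_inner hmb hc hs hs3.le y).2 hy) hy0
  have hs1 : 0 < 1 + s := by linarith
  -- Solving `d = a ρ^(1+s)` for `ρ` turns the eigenvalue into a dilation parameter; the map is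
  -- increasing because `1 + s > 0`.
  have hρ : ∀ i, a * ((d i / a) ^ (1 + s)⁻¹) ^ (1 + s) = d i := fun i => by
    rw [Real.rpow_inv_rpow (div_pos (hd0 i) ha).le hs1.ne', mul_div_cancel₀ _ ha.ne']
  refine ⟨fun i => (d i / a) ^ (1 + s)⁻¹, b, fun i j hij => ?_,
    fun i => Real.rpow_pos_of_pos (div_pos (hd0 i) ha) _, ?_, hb0, fun i => ?_,
    fun σ hσ x hx0 hx => ?_⟩
  · exact Real.rpow_lt_rpow (div_pos (hd0 i) ha).le (div_lt_div_of_pos_right (hdm hij) ha)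
      (inv_pos.2 hs1)
  · exact (tendsto_rpow_atTop (inv_pos.2 hs1)).comp (hdt.atTop_div_const ha)
  · rw [hρ]
    exact (isWeakSolution_iff_inner hmb hc hs hs3.le _).2 (hb i)
  · obtain ⟨i, hi⟩ := hall (a * σ ^ (1 + s)) (mul_pos ha (Real.rpow_pos_of_pos hσ _)) x hx0
      ((isWeakSolution_iff_inner hmb hc hs hs3.le x).1 hx)
    refine ⟨i, ?_⟩
    simp only
    rw [← hi, mul_div_cancel_left₀ _ ha.ne', Real.rpow_rpow_inv hσ.le hs1.ne']

end Bases

/-! ### The wave functions -/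

section Waves

variable {m : ℕ} {S : Type*} [TopologicalSpace S]
  [ChartedSpace (EuclideanSpace ℝ (Fin m)) S] [IsManifold (𝓡 m) ∞ S]

/-- No differentiability is needed: a nonzero factor is invertible, and for `a = 0` both sides
vanish. Hence the Laplacian commutes with constants without smoothness of `η`. -/
theorem partialDeriv_const_mul (A : Fin m) (a : ℂ) (f : EuclideanSpace ℝ (Fin m) → ℂ)
    (z : EuclideanSpace ℝ (Fin m)) :
    partialDeriv A (fun z => a * f z) z = a * partialDeriv A f z := by
  have h := congrFun (fderiv_const_smul_field (𝕜 := ℝ) (f := f) a) z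
  change fderiv ℝ (a • f) z _ = _
  rw [h]
  rfl

theorem laplaceBeltrami_const_mul (G : RiemMetric m S) (a : ℂ) (η : S → ℂ) (y : S) :
    laplaceBeltrami G (fun z => a * η z) y = a * laplaceBeltrami G η y := by
  unfold laplaceBeltrami
  have h : ∀ B z, partialDeriv B ((fun z => a * η z) ∘ (extChartAt (𝓡 m) y).symm) z
      = a * partialDeriv B (η ∘ (extChartAt (𝓡 m) y).symm) z := fun B z =>
    partialDeriv_const_mul B a (η ∘ (extChartAt (𝓡 m) y).symm) z
  simp only [h]
  rw [mul_left_comm]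
  congr 1
  rw [Finset.mul_sum]
  refine Finset.sum_congr rfl fun A _ => ?_
  rw [← partialDeriv_const_mul]
  congr 1
  ext z
  rw [mul_left_comm]
  congr 1
  rw [Finset.mul_sum]
  exact Finset.sum_congr rfl fun B _ => by ring

/-- Separation of variables. -/
theorem hamilton_eq_zero {n : ℕ} (G : RiemMetric m S) {αM κ μ L : ℝ} {u F : ℝ → ℂ}
    (hu : IsODESolution (muBar n m αM μ) (16 / (n : ℝ) ^ 2 * (-L)) (16 / (n : ℝ) ^ 2 * (-κ))
      (1 + 2 * ((n : ℝ) - 2) / n) u F) {η : S → ℂ} (hη : InEigenspace G μ η) {r : ℝ} (hr : 0 < r)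
    (y : S) : hamilton n G αM 0 L κ (fun s z => u s * η z) r y = 0 := by
  have h1 : (fun s : ℝ => (s : ℂ) * deriv (fun t : ℝ => u t * η y) s)
      =ᶠ[𝓝 r] fun s : ℝ => ((s : ℂ) * F s) * η y := by
    filter_upwards [Ioi_mem_nhds hr] with s hs
    rw [deriv_mul_const_field, (hu.1 s hs).deriv, mul_assoc]
  have h2 : deriv (fun s : ℝ => (s : ℂ) * deriv (fun t : ℝ => u t * η y) s) r
      = (coefficient (muBar n m αM μ) (16 / (n : ℝ) ^ 2 * (-L)) (16 / (n : ℝ) ^ 2 * (-κ))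
        (1 + 2 * ((n : ℝ) - 2) / n) r : ℂ) * u r * η y := by
    rw [h1.deriv_eq, deriv_mul_const_field, (hu.2 r hr).deriv]
  have h3 : laplaceBeltrami G η y = -(μ * η y) := by rw [← hη.2 y, neg_neg]
  have h4 : r ^ (1 + 2 * ((n : ℝ) - 2) / n) = r * r ^ (2 * ((n : ℝ) - 2) / n) := by
    rw [Real.rpow_add hr, Real.rpow_one]
  have hr0 : (r : ℂ) ≠ 0 := by exact_mod_cast hr.ne'
  unfold hamilton
  simp only
  -- On the eigenspace the `r⁻²` terms add up to `r⁻² μ̄ u η`, which cancels the first term of `r⁻¹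
  -- * coefficient * u * η`; the others cancel likewise.
  rw [h2, laplaceBeltrami_const_mul, h3, coefficient, h4, muBar]
  push_cast
  field_simp
  ring

end Waves

/-! ### The eigenvalues -/

/-- For `L = -ρ⁻⁴` one has `λ = ρ^(4(n-1)/n)`, so the dilation factor of `rescaled` is exactly `ρ`.
-/
theorem lam_rpow {n : ℕ} (hn : 2 ≤ n) {ρ : ℝ} (hρ : 0 < ρ) :
    lam n (-(ρ ^ 4)⁻¹) ^ ((n : ℝ) / (4 * ((n : ℝ) - 1))) = ρ := by
  have h2 : (2 : ℝ) ≤ n := by exact_mod_cast hn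
  have h1 : (n : ℝ) - 1 ≠ 0 := by linarith
  rw [lam, neg_neg, ← Real.rpow_natCast, ← Real.rpow_neg hρ.le, ← Real.rpow_mul hρ.le,
    ← Real.rpow_mul hρ.le]
  convert Real.rpow_one ρ using 2
  field_simp
  norm_num

theorem eq_neg_inv_pow_four {L : ℝ} (hL : L < 0) : ∃ ρ > 0, L = -(ρ ^ 4)⁻¹ := by
  refine ⟨(-L) ^ (-(4 : ℝ)⁻¹), Real.rpow_pos_of_pos (neg_pos.2 hL) _, ?_⟩
  rw [← Real.rpow_natCast, ← Real.rpow_mul (neg_pos.2 hL).le]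
  norm_num [Real.rpow_neg_one]

end

end QuantumFriedman

/-! ### The theorem: undoing the normalization by dilations -/

theorem theorem1p7 {n m : ℕ} (hn : 2 ≤ n)
    {S : Type*} [TopologicalSpace S] [T2Space S] [CompactSpace S]
    [ChartedSpace (EuclideanSpace ℝ (Fin m)) S] [IsManifold (𝓡 m) ∞ S]
    (G : QuantumFriedman.RiemMetric m S)
    (αM κ μ : ℝ) (hα : 0 < αM) (hκ : κ < 0)
    (hμ : QuantumFriedman.IsEigenvalue G μ)
    (hμbar : QuantumFriedman.muBar n m αM μ ≤ 0) :
    ∃ (Lbar : ℕ → ℝ) (x : ℕ → QuantumFriedman.H2 (QuantumFriedman.muBar n m αM μ))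
      (u : ℕ → ℝ → ℂ),
      -- the eigenvalues are negative, strictly increasing, and tend to zero
      (∀ i, Lbar i < Lbar (i + 1) ∧ Lbar (i + 1) < 0) ∧
      Tendsto Lbar atTop (𝓝 0) ∧
      -- the `u i` are smooth functions in `H₂(μ̄)` which solve the eigenvalue problem
      (∀ i, ContDiffOn ℝ ∞ (u i) (Ioi 0) ∧ QuantumFriedman.Represents (x i) (u i) ∧ x i ≠ 0 ∧
        QuantumFriedman.SolvesEigenvalueProblem n κ _ (Lbar i) (x i)) ∧
      -- there are no other negative eigenvalues, and all the eigenspaces are one dimensional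
      (∀ L < 0, ∀ v : QuantumFriedman.H2 (QuantumFriedman.muBar n m αM μ), v ≠ 0 →
        QuantumFriedman.SolvesEigenvalueProblem n κ _ L v →
          ∃ i, L = Lbar i ∧ ∃ c : ℂ, v = c • x i) ∧
      -- the wave functions solve the Wheeler-DeWitt equation
      (∀ η : S → ℂ, QuantumFriedman.InEigenspace G μ η → ∀ i, ∀ r > 0, ∀ y,
        QuantumFriedman.hamilton n G αM 0 (Lbar i) κ (fun s z => u i s * η z) r y = 0) ∧
      -- the rescaled eigenfunctions are a basis of `H₂(μ̄)`
      (∃ b : UnconditionalSchauderBasis ℕ ℂ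
          (QuantumFriedman.H2 (QuantumFriedman.muBar n m αM μ)),
        ∀ i, QuantumFriedman.Represents (b i) (QuantumFriedman.rescaled n (Lbar i) (u i))) ∧
      -- and also of `L²(I,1)`
      (∃ h : ∀ i, MemLp (QuantumFriedman.rescaled n (Lbar i) (u i)) 2
          (QuantumFriedman.weighted fun r => r ^ (1 : ℝ)),
        QuantumFriedman.IsCompleteMinimal
          (fun i => ((h i).toLp _ : QuantumFriedman.L2 1))) := by
  have hn2 : (2 : ℝ) ≤ n := by exact_mod_cast hn
  have hn0 : (0 : ℝ) < n := by linarith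
  set c : ℝ := 16 / (n : ℝ) ^ 2 with hc_def
  set s : ℝ := 1 + 2 * ((n : ℝ) - 2) / n with hs_def
  have hc : 0 < c := by positivity
  have hs : 1 ≤ s := le_add_of_nonneg_right (div_nonneg (by linarith) hn0.le)
  have hs3 : s < 3 := by
    have : 2 * ((n : ℝ) - 2) / n < 2 := by rw [div_lt_iff₀ hn0]; linarith
    linarith
  have ha : 0 < c * (-κ) := mul_pos hc (neg_pos.2 hκ)
  -- The cubic coefficient `c = 16/n²` is that of `L = -1`; the `b i` will turn out to be the
  -- rescaled eigenfunctions.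
  obtain ⟨ρ, b, hρm, hρ0, hρt, hb0, hb, hall⟩ :=
    QuantumFriedman.exists_basis_of_weakSolutions hμbar hc hs hs3 ha
  have hσ : ∀ i, 0 < (ρ i)⁻¹ := fun i => inv_pos.2 (hρ0 i)
  -- Dilating by `1/ρ i` restores the coefficient `c * (-κ)` on the right and moves the parameter to
  -- the cubic term, as `L = -(ρ i)⁻⁴`.
  let x := fun i => QuantumFriedman.dilate hμbar (hσ i) (b i)
  have hx0 : ∀ i, x i ≠ 0 := fun i => QuantumFriedman.dilate_ne_zero hμbar (hσ i) (hb0 i)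
  have hx : ∀ i, QuantumFriedman.IsWeakSolution (c * (-(-(ρ i ^ 4)⁻¹))) (c * (-κ)) s (x i) := by
    intro i
    have h := (hb i).dilate hμbar (hσ i)
    rwa [mul_assoc (c * (-κ)), ← Real.mul_rpow (hρ0 i).le (hσ i).le,
      mul_inv_cancel₀ (hρ0 i).ne', Real.one_rpow, mul_one, inv_pow, ← neg_neg (ρ i ^ 4)⁻¹] at h
  have hresc : ∀ i, ∀ r > 0, QuantumFriedman.rescaled n (-(ρ i ^ 4)⁻¹) (QuantumFriedman.val (x i)) r
      = QuantumFriedman.val (b i) r := by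
    intro i r hr
    rw [QuantumFriedman.rescaled, QuantumFriedman.lam_rpow hn (hρ0 i),
      QuantumFriedman.val_dilate hμbar _ _ (mul_pos (hρ0 i) hr), inv_mul_cancel_left₀ (hρ0 i).ne']
  have h1s : ∀ i, QuantumFriedman.val (b i) =ᵐ[QuantumFriedman.weighted fun r => r ^ (1 : ℝ)]
      QuantumFriedman.rescaled n (-(ρ i ^ 4)⁻¹) (QuantumFriedman.val (x i)) := fun i =>
    QuantumFriedman.ae_weighted_of_forall (QuantumFriedman.measurable_rpow_weight 1)
      (QuantumFriedman.rpow_weight_pos 1) fun r hr => (hresc i r hr).symm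
  have hmem := fun i => QuantumFriedman.memLp_val (QuantumFriedman.measurable_rpow_weight 1)
    (QuantumFriedman.rpow_weight_pos 1)
    (QuantumFriedman.embedsWithBound_rpow hμbar le_rfl (by norm_num)) (b i)
  refine ⟨fun i => -(ρ i ^ 4)⁻¹, x, fun i => QuantumFriedman.val (x i), fun i => ⟨?_, ?_⟩, ?_,
    fun i => ⟨?_, QuantumFriedman.represents_val hμbar _, hx0 i,
      (QuantumFriedman.solvesEigenvalueProblem_iff hμbar n κ _ _).2 (hx i)⟩, ?_, ?_,
    ⟨b, fun i => ?_⟩, fun i => (hmem i).ae_eq (h1s i), ?_⟩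
  · have h1 : ρ i ^ 4 < ρ (i + 1) ^ 4 :=
      pow_lt_pow_left₀ (hρm (Nat.lt_succ_self i)) (hρ0 i).le (by norm_num)
    exact neg_lt_neg (inv_strictAnti₀ (pow_pos (hρ0 i) 4) h1)
  · exact neg_neg_of_pos (inv_pos.2 (pow_pos (hρ0 _) 4))
  · have h1 : Tendsto (fun i => (ρ i ^ 4)⁻¹) atTop (𝓝 0) :=
      tendsto_inv_atTop_zero.comp ((tendsto_pow_atTop (by norm_num)).comp hρt)
    simpa using h1.neg
  · obtain ⟨F, hF⟩ := (hx i).exists_isODESolution hμbar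
    exact hF.contDiffOn
  · intro L hL v hv0 hv
    obtain ⟨σ, hσ0, rfl⟩ := QuantumFriedman.eq_neg_inv_pow_four hL
    have hv := (QuantumFriedman.solvesEigenvalueProblem_iff hμbar n κ _ _).1 hv
    -- Conversely, dilating a solution for `L = -σ⁻⁴` by `σ` brings its cubic coefficient back to
    -- `c`, so `σ` must be one of the `ρ i`.
    have hdil := hv.dilate hμbar hσ0
    rw [← hc_def, ← hs_def, neg_neg, mul_assoc c (σ ^ 4)⁻¹, inv_mul_cancel₀ (pow_pos hσ0 4).ne',
      mul_one] at hdil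
    obtain ⟨i, rfl⟩ := hall σ hσ0 _ (QuantumFriedman.dilate_ne_zero hμbar hσ0 hv0) hdil
    exact ⟨i, rfl, hv.exists_eq_smul hμbar (hx i) (hx0 i)⟩
  · intro η hη i r hr y
    obtain ⟨F, hF⟩ := (hx i).exists_isODESolution hμbar
    exact QuantumFriedman.hamilton_eq_zero G hF hη hr y
  · refine (QuantumFriedman.fn_ae_eq_val hμbar (b i)).trans ?_
    filter_upwards [ae_restrict_mem measurableSet_Ioi] with r hr
    exact (hresc i r hr).symm
  · convert QuantumFriedman.isCompleteMinimal_embedPow_one hμbar hc hs hs3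
      (d := fun i => c * (-κ) * ρ i ^ (1 + s)) (fun i j hij => ?_) b hb hb0 using 2 with i
    · exact (MemLp.toLp_eq_toLp_iff _ (hmem i)).2 (h1s i).symm
    · refine hρm.injective ?_
      have h1 := mul_left_cancel₀ ha.ne' hij
      exact (Real.rpow_left_inj (hρ0 i).le (hρ0 j).le (by linarith)).1 h1
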